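/- All sequences are finite sequences of pairwise distinct integers. The Cartesian tree $C(x)$ of a sequence $x$ is empty if $x$ is empty; otherwise its root is the position $g$ of the smallest value, and its left and right subtrees are the Cartesian trees of the parts of $x$ before and after position $g$. Write $x\approx_{CT}y$ if $C(x)=C(y)$, and let $\tau(x,i)$ be $x$ with the elements at positions $i,i+1$ exchanged. Two sequences $x,y$ of length $m$ are a *one-swap Cartesian-tree match*, $x\overset{\tau}{\approx}_{CT}y$, if $x\approx_{CT}y$ or there are $x'\approx_{CT}x$, $y'\approx_{CT}y$ and $1\le i\le m-1$ with $x'=\tau(y',i)$ and $y'=\tau(x',i)$. The parent-distance table $PD_x$ has $PD_x[h]=h-\max\{j<h: x[j]<x[h]\}$ if such a $j$ exists and $PD_x[h]=0$ otherwise. The swap neighbourhood of $C(p)$ is the set of all trees $C(\tau(x,i))$ with $C(x)=C(p)$ and $1\le i\le m-1$. For a pattern $p$ of length $m$ let $$D(p)=\{PD_p\}\cup\{PD_y : C(y)\text{ lies in the swap neighbourhood of }C(p)\}.$$ The Aho–Corasick automaton of $D(p)$ has as states the nodes of the trie of $D(p)$, i.e. the prefixes of its words; its final states are the words of $D(p)$.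 The failure link of a state $PD_u$ with $u$ nonempty is $PD_s$ for the longest proper suffix $s$ of $u$ such that $PD_s$ is a state. From a state of depth $d$, reading a parent-distance $v$ of the text, it follows the trie edge labelled $v$ (labelled $0$ if $v>d$) if there is one; otherwise it takes the failure link and tries again. **Theorem.** There is an algorithm for a word RAM which, given a pattern $p$ of length $m\ge 2$ and a text $t$ of length $n$, first builds in memory the Aho–Corasick automaton of $D(p)$, then reads the text once position by position, making the move of the automaton on the parent-distance of each text position and reporting the current window of length $m$ exactly when a final state is reached. It outputs each start position $j$, $1\le j\le n-m+1$, with $t[j\ldots j+m-1]\overset{\tau}{\approx}_{CT}p$ exactly once and outputs nothing else. In the worst case it takes $O((m^2+n)\log m)$ time and $O(m^2)$ space, with absolute constants. Here time is the number of elementary instructions and tests; space is the number of memory words of $O(\log(m+n))$ bits, not counting the read-only inputs, whose elements are only compared with each other, and the write-only output. -/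

import Mathlib

namespace SwapCT

/-! ### Cartesian trees, swaps and matching

Sequences are lists of integers; positions are counted from `0`. -/

/-- The smallest value of the nonempty sequence with first element `a` and remaining elements `l`. -/
def minVal (a : ℤ) (l : List ℤ) : ℤ := l.foldr min a

theorem minVal_mem (a : ℤ) (l : List ℤ) : minVal a l ∈ a :: l := by
  induction l with
  | nil => simp [minVal]
  | cons b l ih =>
    have h : minVal a (b :: l) = min b (minVal a l) := rfl
    rw [h]
    rcases min_choice b (minVal a l) with h | h <;> rw [h]
    · simp
    · simp only [List.mem_cons] at ih ⊢
      tauto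

/-- The Cartesian tree of a sequence: its root is the position `g` of the smallest value, its left
and right subtrees are the Cartesian trees of what precedes and what follows position `g`. The
label of a node is its rank in the infix order, so the tree is given by its shape. -/
def cartesianTree : List ℤ → BinaryTree Unit
  | [] => .nil
  | a :: l =>
    .node ()
      (cartesianTree ((a :: l).take ((a :: l).idxOf (minVal a l))))
      (cartesianTree ((a :: l).drop ((a :: l).idxOf (minVal a l) + 1)))
termination_by x => x.length
decreasing_by
  · have h := List.idxOf_lt_length_of_mem (minVal_mem a l)
    simp only [List.length_take]
    omega
  · simp only [List.length_drop, List.length_cons]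
    omega

/-- `x ≈_CT y`: both sequences have the same Cartesian tree. -/
def CTMatch (x y : List ℤ) : Prop := cartesianTree x = cartesianTree y

/-- `τ(x, i)`: exchange the elements of `x` at the adjacent positions `i` and `i + 1`. -/
def swap (x : List ℤ) (i : ℕ) : List ℤ :=
  if h : i + 1 < x.length then (x.set i x[i + 1]).set (i + 1) x[i] else x

/-- `CT_τ` matching: the same Cartesian tree, up to at most one swap. Sequences have pairwise
distinct elements. -/
def SwapMatch (x y : List ℤ) : Prop :=
  CTMatch x y ∨
    ∃ x' y' : List ℤ, ∃ i : ℕ, x'.Nodup ∧ y'.Nodup ∧ i + 1 < x.length ∧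
      CTMatch x' x ∧ CTMatch y' y ∧ x' = swap y' i ∧ y' = swap x' i

/-- The factor of length `m` of `t` that starts at position `j`. -/
def factor (t : List ℤ) (j m : ℕ) : List ℤ := (t.drop j).take m

/-- The parent-distance of position `h` in `x`: the distance from `h` back to the nearest earlier
position with a smaller value, and `0` if there is none. -/
def pdAt (x : List ℤ) (h : ℕ) : ℕ :=
  if hs : ((Finset.range h).filter (fun j => x.getD j 0 < x.getD h 0)).Nonempty then
    h - ((Finset.range h).filter (fun j => x.getD j 0 < x.getD h 0)).max' hs
  else 0

/-- The parent-distance table of `x`. -/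
def parentDistance (x : List ℤ) : List ℕ := (List.range x.length).map (pdAt x)

/-- The neighbours of the tree `T` for a swap at position `i`. -/
def neighboursAt (T : BinaryTree Unit) (i : ℕ) : Set (BinaryTree Unit) :=
  {T' | ∃ x : List ℤ, x.Nodup ∧ T = cartesianTree x ∧ i + 1 < x.length ∧
    T' = cartesianTree (swap x i)}

/-- The swap neighbourhood of the tree `T`. -/
def neighbourhood (T : BinaryTree Unit) : Set (BinaryTree Unit) := ⋃ i : ℕ, neighboursAt T i

/-- The words the automaton of the pattern `p` has to recognise: the parent-distance table of `p`
and the parent-distance tables of the trees in the swap neighbourhood of `C(p)`. -/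
def neighbourTables (p : List ℤ) : Set (List ℕ) :=
  {parentDistance p} ∪
    {w | ∃ y : List ℤ, y.Nodup ∧ cartesianTree y ∈ neighbourhood (cartesianTree p) ∧
      w = parentDistance y}

/-! ### The Aho-Corasick automaton of a set of parent-distance tables -/

/-- The states: the nodes of the trie of `D`, each given by the word spelled from the root. -/
def trieNodes (D : Set (List ℕ)) : Set (List ℕ) := {w | ∃ d ∈ D, w <+: d}

/-- A parent-distance `v` seen from a window that holds only the `d` preceding positions: a parent
outside of the window is lost. -/
def clip (d v : ℕ) : ℕ := if v ≤ d then v else 0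

/-- If `w` is the parent-distance table of `y`, this is the parent-distance table of the suffix of
`y` that is left after `k` elements are removed in front. -/
def tableSuffix (w : List ℕ) (k : ℕ) : List ℕ := (w.drop k).mapIdx clip

open Classical in
/-- The failure function: the table of the longest proper suffix that is a node of the trie. -/
noncomputable def failure (D : Set (List ℕ)) (w : List ℕ) : List ℕ :=
  (((List.range w.length).map (fun k => tableSuffix w (k + 1))).find?
    (fun u => decide (u ∈ trieNodes D))).getD []

theorem failure_length_lt (D : Set (List ℕ)) (w : List ℕ) (hw : w ≠ []) :
    (failure D w).length < w.length := by
  classical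
  have h0 : 0 < w.length := List.length_pos_of_ne_nil hw
  unfold failure
  cases h : ((List.range w.length).map (fun k => tableSuffix w (k + 1))).find?
      (fun u => decide (u ∈ trieNodes D)) with
  | none => simpa using h0
  | some u =>
    have hu := List.mem_of_find?_eq_some h
    obtain ⟨k, _, rfl⟩ := List.mem_map.1 hu
    simp only [Option.getD_some, tableSuffix, List.length_mapIdx, List.length_drop]
    omega

open Classical in
/-- One move of the automaton from state `w` on the parent-distance `v` of the next text position:
follow the edge of the trie if there is one, else take the failure link and try again. -/
noncomputable def acStep (D : Set (List ℕ)) (w : List ℕ) (v : ℕ) : List ℕ :=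
  if w ++ [clip w.length v] ∈ trieNodes D then w ++ [clip w.length v]
  else if _h : w = [] then []
  else acStep D (failure D w) v
termination_by w.length
decreasing_by exact failure_length_lt D w _h

/-- The state reached after the parent-distances of the first `k` positions of `t` were read. -/
noncomputable def acRun (D : Set (List ℕ)) (t : List ℤ) : ℕ → List ℕ
  | 0 => []
  | k + 1 => acStep D (acRun D t k) (pdAt t k)

/-! ### A word RAM with a step count

A program has finitely many registers and a memory of words, each holding a natural number below
the word bound. The pattern and the text are read-only arrays of elements of a totally ordered set,
which are accessed by comparisons only. The output is a write-only stream. -/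

/-- What a run depends on: the two input sequences, the number of memory cells, the word bound. -/
structure Env where
  pat : List ℤ
  text : List ℤ
  space : ℕ
  word : ℕ

/-- Registers, memory and the numbers written to the output so far. -/
structure Store where
  reg : ℕ → ℕ
  mem : ℕ → ℕ
  out : List ℕ

/-- At the start all registers and memory cells are `0` and nothing has been written. -/
def Store.init : Store := ⟨fun _ => 0, fun _ => 0, []⟩

/-- Arithmetic operations (subtraction is truncated, division rounds down). -/
inductive Op
  | add | sub | mul | div

def Op.eval : Op → ℕ → ℕ → ℕ
  | .add, a, b => a + b
  | .sub, a, b => a - b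
  | .mul, a, b => a * b
  | .div, a, b => a / b

/-- Elementary instructions; `x`, `y`, `z` are names of registers. -/
inductive Instr
  /-- `x := c` -/
  | const (x c : ℕ)
  /-- `x := y` -/
  | copy (x y : ℕ)
  /-- `x := y o z` -/
  | arith (o : Op) (x y z : ℕ)
  /-- `x := mem[y]` -/
  | load (x y : ℕ)
  /-- `mem[x] := y` -/
  | store (x y : ℕ)
  /-- `x :=` length of the pattern -/
  | patLen (x : ℕ)
  /-- `x :=` length of the text -/
  | textLen (x : ℕ)
  /-- write `x` to the output -/
  | emit (x : ℕ)

/-- Assign the value `v` to register `x`; there is no successor if `v` does not fit into a word. -/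
def Store.setReg (E : Env) (s : Store) (x v : ℕ) : Option Store :=
  if v < E.word then some { s with reg := Function.update s.reg x v } else none

/-- The effect of an instruction; `none` is a crash (overflow or access outside of the memory). -/
def Instr.eval (E : Env) (s : Store) : Instr → Option Store
  | .const x c => s.setReg E x c
  | .copy x y => s.setReg E x (s.reg y)
  | .arith o x y z => s.setReg E x (o.eval (s.reg y) (s.reg z))
  | .load x y => if s.reg y < E.space then s.setReg E x (s.mem (s.reg y)) else none
  | .store x y =>
    if s.reg x < E.space then some { s with mem := Function.update s.mem (s.reg x) (s.reg y) }
    else none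
  | .patLen x => s.setReg E x E.pat.length
  | .textLen x => s.setReg E x E.text.length
  | .emit x => some { s with out := s.out ++ [s.reg x] }

/-- Elementary tests; `x`, `y` are names of registers. -/
inductive Test
  /-- `x < y` -/
  | lt (x y : ℕ)
  /-- `x = y` -/
  | eq (x y : ℕ)
  /-- `p[x] < p[y]` -/
  | patLt (x y : ℕ)
  /-- `t[x] < t[y]` -/
  | textLt (x y : ℕ)

/-- Compare two elements of an input array; `none` if a position is out of range. -/
def cmpAt (l : List ℤ) (i j : ℕ) : Option Bool :=
  match l[i]?, l[j]? with
  | some a, some b => some (decide (a < b))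
  | _, _ => none

/-- The outcome of a test; `none` is a crash. -/
def Test.eval (E : Env) (s : Store) : Test → Option Bool
  | .lt x y => some (decide (s.reg x < s.reg y))
  | .eq x y => some (decide (s.reg x = s.reg y))
  | .patLt x y => cmpAt E.pat (s.reg x) (s.reg y)
  | .textLt x y => cmpAt E.text (s.reg x) (s.reg y)

/-- Programs. -/
inductive Cmd
  | prim (i : Instr)
  | seq (a b : Cmd)
  | ite (c : Test) (a b : Cmd)
  | loop (c : Test) (a : Cmd)

/-- `Exec E a s T s'`: program `a`, started in `s`, halts in `s'` without a crash after exactly `T`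
elementary instructions and tests. -/
inductive Exec (E : Env) : Cmd → Store → ℕ → Store → Prop
  | prim {i : Instr} {s s' : Store} (h : i.eval E s = some s') : Exec E (.prim i) s 1 s'
  | seq {a b : Cmd} {s r s' : Store} {T U : ℕ} (ha : Exec E a s T r) (hb : Exec E b r U s') :
      Exec E (.seq a b) s (T + U) s'
  | iteTrue {c : Test} {a b : Cmd} {s s' : Store} {T : ℕ} (hc : c.eval E s = some true)
      (ha : Exec E a s T s') : Exec E (.ite c a b) s (1 + T) s'
  | iteFalse {c : Test} {a b : Cmd} {s s' : Store} {T : ℕ} (hc : c.eval E s = some false)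
      (hb : Exec E b s T s') : Exec E (.ite c a b) s (1 + T) s'
  | loopFalse {c : Test} {a : Cmd} {s : Store} (hc : c.eval E s = some false) :
      Exec E (.loop c a) s 1 s
  | loopTrue {c : Test} {a : Cmd} {s r s' : Store} {T U : ℕ} (hc : c.eval E s = some true)
      (ha : Exec E a s T r) (hl : Exec E (.loop c a) r U s') :
      Exec E (.loop c a) s (1 + T + U) s'

/-! ### Automaton-based matching programs -/

/-- The memory of `s` holds the Aho-Corasick automaton of `D`: its states are numbered
`0, …, N - 1`, state number `k` is `node k`, the root has number `0`, and the cells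
`4k, 4k+1, 4k+2, 4k+3` hold the parent of state `k` in the trie, the label of the edge from that
parent, the failure link of state `k`, and the flag `1` exactly if state `k` is final. -/
structure HoldsAutomaton (E : Env) (D : Set (List ℕ)) (s : Store) (N : ℕ) (node : ℕ → List ℕ) :
    Prop where
  fits : 4 * N ≤ E.space
  bij : Set.BijOn node (Set.Iio N) (trieNodes D)
  root : node 0 = []
  parent : ∀ k, 0 < k → k < N → s.mem (4 * k) < N ∧
    node k = node (s.mem (4 * k)) ++ [s.mem (4 * k + 1)]
  fail : ∀ k, 0 < k → k < N → s.mem (4 * k + 2) < N ∧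
    node (s.mem (4 * k + 2)) = failure D (node k)
  final : ∀ k, k < N → (s.mem (4 * k + 3) = 1 ↔ node k ∈ D)

/-- A program that first builds an automaton and then reads the text: the part `build`, the part
`step` executed once for each text position, and the registers for the number of text positions
already read, the length of the text, the number of states, and the current state. -/
structure MatchProgram where
  build : Cmd
  step : Cmd
  pos : ℕ
  len : ℕ
  size : ℕ
  state : ℕ

/-- The whole program: `build; while pos < len do step`. -/
def MatchProgram.cmd (P : MatchProgram) : Cmd :=
  .seq P.build (.loop (.lt P.pos P.len) P.step)

open Classical in
/-- On the inputs of `E`, the part `build` stores the Aho-Corasick automaton of `D` in the memory,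
and each execution of `step` makes the move of that automaton on the next text position and
reports the start of the current window exactly if the state reached is final. The store after
`k` text positions is `tr k`. -/
def MatchProgram.RunsAutomaton (P : MatchProgram) (E : Env) (D : Set (List ℕ))
    (tr : ℕ → Store) : Prop :=
  (∃ T, Exec E P.build Store.init T (tr 0)) ∧
  (∀ k < E.text.length, ∃ T, Exec E P.step (tr k) T (tr (k + 1))) ∧
  (∃ N : ℕ, ∃ node : ℕ → List ℕ,
    HoldsAutomaton E D (tr 0) N node ∧ (tr 0).reg P.size = N ∧
    ∀ k ≤ E.text.length, (tr k).reg P.pos = k ∧ (tr k).reg P.len = E.text.length ∧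
      (tr k).reg P.state < N ∧ node ((tr k).reg P.state) = acRun D E.text k) ∧
  (tr 0).out = [] ∧
  (∀ k < E.text.length, (tr (k + 1)).out =
    if acRun D E.text (k + 1) ∈ D then (tr k).out ++ [k + 1 - E.pat.length] else (tr k).out)

end SwapCT

/-!
A sequence is described by the parents of its positions, the nearest earlier positions with smaller
values: two sequences of distinct values have the same Cartesian tree exactly if they have the same
parents (`cartesianTree_eq_iff`), and parent-distances are another way to write down parents. Hence
a factor of the text matches the pattern up to one swap if and only if its table is one of the
words of the automaton (`swapMatch_iff`).

The set of words is explicit. If `x` has the parents of the pattern and positions `i`, `i + 1` are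
exchanged, the parents change in one of two ways. If `x` increases there, the larger element, now
in front, gets a parent on the chain of parents that starts at `i - 1`; if `x` decreases, a final
part of the children of position `i + 1` become children of position `i`. Every such choice is
realized by some `x`, because blocks of values can be moved up without changing a parent
(`exists_shift`). The choice of the old parent of `i`, or of no children, is determined by `i`. Any
other choice determines `i`: the first position after the new parent with a smaller value is `i`,
and the children that move are children of `i + 1`. So there are at most `3m` words, each given by
three numbers, and its letters can be computed in constant time each (`neighbourTables_eq`).

The trie has at most `1 + 3m²` nodes. In order to reach the child along a given edge in constant
time within `O(m²)` memory, a node has a table of its children, of length `m + 1`, only if it has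
at least two of them. The insertion of one word gives a table to at most one node, so `3m` slots
for tables are enough (`TrieCore.attach`, `avail_attach`).

The failure link of a node is the result of a move from the failure link of its parent
(`failure_concat`). The links are computed depth by depth, simultaneously along all words. Along
each word the length of the failure state pays for the links that are followed, so this phase takes
time `O(m²)` (`wp_failPhase`).

While the text is read, the parent of a position is found by following the chain of parents from
the position before it. Only the parents of the last `m` positions are kept, in a cyclic array: a
parent that is farther away does not influence the moves (`Near.clip_lab`, `acStep_congr`). The
length of the chain and the length of the current state pay for the search and the move
(`wp_textStep`). The state reached after `k` positions is the longest suffix of the text read so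
far whose table is in the trie, so it is final exactly if the last `m` positions are a match
(`acRun_mem_iff`).

Altogether the time is `O(m² + n)`, and the logarithmic factor is not needed.
-/

namespace SwapCT

/-! ### Parents of positions -/

/-- The parent of position `h` in the sequence `f`, the nearest earlier position with a smaller
value, moved up by one so that `0` stands for a missing parent. -/
def prv (f : ℕ → ℤ) (h : ℕ) : ℕ := Nat.findGreatest (fun q => q = 0 ∨ f (q - 1) < f h) h

theorem prv_le (f : ℕ → ℤ) (h : ℕ) : prv f h ≤ h := Nat.findGreatest_le _

theorem prv_spec (f : ℕ → ℤ) (h : ℕ) : prv f h = 0 ∨ f (prv f h - 1) < f h :=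
  Nat.findGreatest_spec (P := fun q => q = 0 ∨ f (q - 1) < f h) (Nat.zero_le h) (Or.inl rfl)

theorem le_prv {f : ℕ → ℤ} {q h : ℕ} (hq : q ≤ h) (hf : q = 0 ∨ f (q - 1) < f h) : q ≤ prv f h :=
  Nat.le_findGreatest (P := fun q => q = 0 ∨ f (q - 1) < f h) hq hf

theorem le_of_prv_le {f : ℕ → ℤ} {h j : ℕ} (h1 : prv f h ≤ j) (h2 : j < h) : f h ≤ f j := by
  by_contra hc
  have := le_prv (f := f) (q := j + 1) (h := h) h2 (Or.inr (by simpa using hc))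
  omega

theorem prv_eq {f : ℕ → ℤ} {q h : ℕ} (h1 : q ≤ h) (h2 : q = 0 ∨ f (q - 1) < f h)
    (h3 : ∀ j, q ≤ j → j < h → f h ≤ f j) : prv f h = q := by
  refine le_antisymm ?_ (le_prv h1 h2)
  by_contra hc
  rcases prv_spec f h with h0 | h0
  · omega
  · have := prv_le f h
    have := h3 (prv f h - 1) (by omega) (by omega)
    omega

/-- The values after the parent of `h` and before `h` are larger than the value at `h`, if values
are distinct. -/
theorem lt_of_prv_le {f : ℕ → ℤ} {h j m : ℕ} (hf : Set.InjOn f (Set.Iio m)) (hm : h < m)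
    (h1 : prv f h ≤ j) (h2 : j < h) : f h < f j := by
  refine lt_of_le_of_ne (le_of_prv_le h1 h2) fun he => ?_
  have := hf (show h ∈ Set.Iio m from hm) (show j ∈ Set.Iio m from lt_trans h2 hm) he
  omega

theorem prv_congr {f g : ℕ → ℤ} {h : ℕ} (H : ∀ j ≤ h, f j = g j) : prv f h = prv g h := by
  refine (prv_eq (prv_le f h) ?_ fun j h1 h2 => ?_).symm
  · rcases prv_spec f h with h0 | h0
    · exact Or.inl h0
    · have := prv_le f h
      exact Or.inr (by rwa [← H _ (by omega), ← H _ le_rfl])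
  · rw [← H _ h2.le, ← H _ le_rfl]
    exact le_of_prv_le h1 h2

/-- The parent-distance at position `h` that belongs to the parent `q`. -/
def lab (q h : ℕ) : ℕ := if q = 0 then 0 else h + 1 - q

theorem lab_le (q h : ℕ) : lab q h ≤ h := by unfold lab; split <;> omega

theorem lab_inj {q q' h : ℕ} (h1 : q ≤ h) (h2 : q' ≤ h) (he : lab q h = lab q' h) : q = q' := by
  unfold lab at he
  split at he <;> split at he <;> omega

/-- The values of a sequence as a function of the position. -/
abbrev vals (x : List ℤ) (h : ℕ) : ℤ := x.getD h 0

theorem pdAt_eq (x : List ℤ) (h : ℕ) : pdAt x h = lab (prv (vals x) h) h := by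
  unfold pdAt
  split
  · rename_i hs
    have hchar : ∀ j, j ∈ (Finset.range h).filter (fun j => x.getD j 0 < x.getD h 0) ↔
        j < h ∧ vals x j < vals x h := fun j => by simp [vals]
    generalize (Finset.range h).filter (fun j => x.getD j 0 < x.getD h 0) = S at hs hchar
    obtain ⟨h1, h1'⟩ := (hchar _).1 (Finset.max'_mem S hs)
    have : prv (vals x) h = S.max' hs + 1 := by
      refine prv_eq h1 (Or.inr (by simpa using h1')) fun j h2 h3 => ?_
      by_contra hc
      have := Finset.le_max' S j ((hchar j).2 ⟨h3, not_le.1 hc⟩)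
      omega
    rw [this]; simp [lab]
  · rename_i hs
    have : prv (vals x) h = 0 := by
      rcases prv_spec (vals x) h with h0 | h0
      · exact h0
      · by_contra hc
        have := prv_le (vals x) h
        exact hs ⟨prv (vals x) h - 1, by
          simp only [Finset.mem_filter, Finset.mem_range]
          exact ⟨by omega, h0⟩⟩
    simp [this, lab]

theorem parentDistance_eq_map (x : List ℤ) :
    parentDistance x = (List.range x.length).map (fun h => lab (prv (vals x) h) h) := by
  unfold parentDistance
  exact List.map_congr_left fun h _ => pdAt_eq x h

@[simp] theorem parentDistance_length (x : List ℤ) : (parentDistance x).length = x.length := by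
  simp [parentDistance]

/-- Two sequences with the same length and the same parents. -/
def SameParents (x y : List ℤ) : Prop :=
  x.length = y.length ∧ ∀ h < x.length, prv (vals x) h = prv (vals y) h

theorem parentDistance_eq_iff {x y : List ℤ} :
    parentDistance x = parentDistance y ↔ SameParents x y := by
  constructor
  · intro he
    have hl : x.length = y.length := by simpa using congrArg List.length he
    refine ⟨hl, fun h hh => ?_⟩
    rw [parentDistance_eq_map, parentDistance_eq_map, ← hl] at he
    have := List.map_inj_left.1 he h (List.mem_range.2 hh)
    exact lab_inj (prv_le _ _) (prv_le _ _) this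
  · rintro ⟨hl, hp⟩
    rw [parentDistance_eq_map, parentDistance_eq_map, ← hl]
    exact List.map_congr_left fun h hh => by rw [hp h (List.mem_range.1 hh)]

/-! ### Cartesian trees and parents -/

theorem minVal_le (a : ℤ) (l : List ℤ) : ∀ v ∈ a :: l, minVal a l ≤ v := by
  induction l with
  | nil => simp [minVal]
  | cons b l ih =>
    have h : minVal a (b :: l) = min b (minVal a l) := rfl
    rw [h]
    simp only [List.mem_cons] at ih ⊢
    rintro v (rfl | rfl | hv)
    · exact (min_le_right _ _).trans (ih _ (Or.inl rfl))
    · exact min_le_left _ _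
    · exact (min_le_right _ _).trans (ih _ (Or.inr hv))

theorem vals_injOn {x : List ℤ} (hx : x.Nodup) : Set.InjOn (vals x) (Set.Iio x.length) := by
  intro i hi j hj he
  simp only [Set.mem_Iio] at hi hj
  simp only [vals, List.getD_eq_getElem _ _ hi, List.getD_eq_getElem _ _ hj] at he
  exact (List.Nodup.getElem_inj_iff hx).1 he

/-- A Cartesian tree decomposes at the position of the smallest value. -/
theorem cartesianTree_root {x : List ℤ} (hx : x.Nodup) (hne : x ≠ []) :
    ∃ g < x.length, (∀ h < x.length, vals x g ≤ vals x h) ∧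
      cartesianTree x = .node () (cartesianTree (x.take g)) (cartesianTree (x.drop (g + 1))) := by
  cases x with
  | nil => exact absurd rfl hne
  | cons a l =>
    have hg := List.idxOf_lt_length_of_mem (minVal_mem a l)
    refine ⟨(a :: l).idxOf (minVal a l), hg, fun h hh => ?_, by rw [cartesianTree]⟩
    have e1 : vals (a :: l) ((a :: l).idxOf (minVal a l)) = minVal a l := by
      rw [vals, List.getD_eq_getElem _ _ hg]; exact List.getElem_idxOf hg
    have e2 : vals (a :: l) h = (a :: l)[h] := List.getD_eq_getElem _ _ hh
    rw [e1, e2]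
    exact minVal_le a l _ (List.getElem_mem hh)

theorem vals_take {x : List ℤ} {g h : ℕ} (hh : h < g) : vals (x.take g) h = vals x h := by
  simp [vals, List.getD_eq_getElem?_getD, hh]

theorem vals_drop (x : List ℤ) (g h : ℕ) : vals (x.drop g) h = vals x (g + h) := by
  simp [vals, List.getD_eq_getElem?_getD, List.getElem?_drop]

theorem prv_take {x : List ℤ} {g h : ℕ} (hh : h < g) :
    prv (vals (x.take g)) h = prv (vals x) h :=
  prv_congr fun j hj => vals_take (by omega)

/-- Removing the first `g` elements moves the parents and removes those before position `g`. -/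
theorem prv_drop (x : List ℤ) (g h : ℕ) :
    prv (vals (x.drop g)) h = prv (vals x) (g + h) - g := by
  have h1 := prv_le (vals x) (g + h)
  refine prv_eq (by omega) ?_ fun j h2 h3 => ?_
  · by_cases hc : prv (vals x) (g + h) ≤ g
    · left; omega
    · right
      rw [vals_drop, vals_drop]
      rcases prv_spec (vals x) (g + h) with h0 | h0
      · omega
      · rwa [show g + (prv (vals x) (g + h) - g - 1) = prv (vals x) (g + h) - 1 by omega]
  · rw [vals_drop, vals_drop]
    exact le_of_prv_le (by omega) (by omega)

theorem prv_root {x : List ℤ} {g : ℕ} (hg : g < x.length)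
    (hmin : ∀ h < x.length, vals x g ≤ vals x h) : prv (vals x) g = 0 := by
  rcases prv_spec (vals x) g with h0 | h0
  · exact h0
  · have := prv_le (vals x) g
    have := hmin (prv (vals x) g - 1) (by omega)
    omega

theorem lt_prv_of_root_lt {x : List ℤ} (hx : x.Nodup) {g h : ℕ} (hg : g < x.length)
    (hmin : ∀ h < x.length, vals x g ≤ vals x h) (hgh : g < h) (hh : h < x.length) :
    g + 1 ≤ prv (vals x) h := by
  refine le_prv hgh (Or.inr ?_)
  refine lt_of_le_of_ne (hmin h hh) fun he => ?_
  have := vals_injOn hx (show g ∈ Set.Iio _ from hg) (show h ∈ Set.Iio _ from hh) he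
  omega

theorem numNodes_cartesianTree {n : ℕ} :
    ∀ x : List ℤ, x.length = n → x.Nodup → (cartesianTree x).numNodes = n := by
  induction n using Nat.strong_induction_on with
  | _ n ih =>
    intro x hn hx
    by_cases hne : x = []
    · subst hne; simp at hn; subst hn; simp [cartesianTree, BinaryTree.numNodes]
    · obtain ⟨g, hg, -, hC⟩ := cartesianTree_root hx hne
      rw [hC, BinaryTree.numNodes, ih g (by omega) _ (by simp; omega) (hx.sublist
          (List.take_sublist _ _)),
        ih (n - (g + 1)) (by omega) _ (by simp; omega) (hx.sublist (List.drop_sublist _ _))]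
      omega

/-- Cartesian trees and tables of parents carry the same information. -/
theorem cartesianTree_eq_iff_aux {n : ℕ} :
    ∀ x y : List ℤ, x.length = n → x.Nodup → y.Nodup →
      (cartesianTree x = cartesianTree y ↔ SameParents x y) := by
  induction n using Nat.strong_induction_on with
  | _ n ih =>
    intro x y hn hx hy
    by_cases hlen : x.length = y.length
    swap
    · constructor
      · intro he
        have := congrArg BinaryTree.numNodes he
        rw [numNodes_cartesianTree x rfl hx, numNodes_cartesianTree y rfl hy] at this
        exact absurd this hlen
      · exact fun h => absurd h.1 hlen
    by_cases hne : x = []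
    · subst hne
      have : y = [] := List.length_eq_zero_iff.1 (by simpa using hlen.symm)
      subst this
      simp [SameParents]
    have hney : y ≠ [] := fun h => hne (List.length_eq_zero_iff.1 (by simp [hlen, h]))
    obtain ⟨g, hg, hmin, hC⟩ := cartesianTree_root hx hne
    obtain ⟨g', hg', hmin', hC'⟩ := cartesianTree_root hy hney
    have key : g = g' → (cartesianTree x = cartesianTree y ↔ SameParents x y) := by
      rintro rfl
      rw [hC, hC', BinaryTree.node.injEq,
        ih g (by omega) (x.take g) (y.take g) (by simp; omega)
          (hx.sublist (List.take_sublist _ _)) (hy.sublist (List.take_sublist _ _)),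
        ih (n - (g + 1)) (by omega) (x.drop (g + 1)) (y.drop (g + 1)) (by simp; omega)
          (hx.sublist (List.drop_sublist _ _)) (hy.sublist (List.drop_sublist _ _))]
      constructor
      · rintro ⟨-, h1, h2⟩
        refine ⟨hlen, fun h hh => ?_⟩
        rcases lt_trichotomy h g with hlt | rfl | hgt
        · have := h1.2 h (by simp; omega)
          rwa [prv_take hlt, prv_take hlt] at this
        · rw [prv_root hg hmin, prv_root hg' hmin']
        · have := h2.2 (h - (g + 1)) (by simp; omega)
          rw [prv_drop, prv_drop, show g + 1 + (h - (g + 1)) = h by omega] at this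
          have := lt_prv_of_root_lt hx hg hmin hgt hh
          have := lt_prv_of_root_lt hy hg' hmin' hgt (by omega)
          omega
      · intro h
        refine ⟨rfl, ⟨by simp; omega, fun j hj => ?_⟩, ⟨by simp; omega, fun j hj => ?_⟩⟩
        · have hj' : j < g := by simp at hj; omega
          rw [prv_take hj', prv_take hj']
          exact h.2 j (by omega)
        · have hj' : j < x.length - (g + 1) := by simpa using hj
          rw [prv_drop, prv_drop, h.2 _ (by omega)]
    constructor
    · intro he
      refine (key ?_).1 he
      rw [hC, hC', BinaryTree.node.injEq] at he
      have := congrArg BinaryTree.numNodes he.2.1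
      rw [numNodes_cartesianTree _ rfl (hx.sublist (List.take_sublist _ _)),
        numNodes_cartesianTree _ rfl (hy.sublist (List.take_sublist _ _))] at this
      simp at this
      omega
    · intro h
      refine (key ?_).2 h
      -- the smallest value is at the last position without a parent
      have h1 := prv_root hg hmin
      have h2 := prv_root hg' hmin'
      rcases lt_trichotomy g g' with hlt | he | hgt
      · have := lt_prv_of_root_lt hx hg hmin hlt (by omega)
        have := h.2 g' (by omega)
        omega
      · exact he
      · have := lt_prv_of_root_lt hy hg' hmin' hgt (by omega)
        have := h.2 g (by omega)
        omega

theorem cartesianTree_eq_iff {x y : List ℤ} (hx : x.Nodup) (hy : y.Nodup) :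
    cartesianTree x = cartesianTree y ↔ SameParents x y :=
  cartesianTree_eq_iff_aux x y rfl hx hy

/-! ### Parents after a swap -/

/-- The parents of the sequence obtained by a swap at positions `i`, `i + 1` from a sequence with
parents `q`. If `i` is the parent of `i + 1`, the new element at position `i` may get any parent
`c` on the chain of parents that starts at `i - 1`. Otherwise the children of `i + 1` from position
`H` on become children of `i`. -/
def swapRow (q : ℕ → ℕ) (m i c H h : ℕ) : ℕ :=
  if i + 1 < m then
    if q (i + 1) = i + 1 then
      if h = i then c else if h = i + 1 then q i else if q h = i + 1 then i + 2 else q h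
    else
      if h = i then q (i + 1) else if h = i + 1 then i + 1
      else if q h = i + 2 ∧ H ≤ h then i + 1 else q h
  else q h

section swap
variable {f g : ℕ → ℤ} {m i : ℕ}

/-- The parents after a swap that moves the larger value to the front: the parent of this value
becomes an argument of `swapRow`. -/
theorem prv_swap_of_lt (hf : Set.InjOn f (Set.Iio m)) (hi : i + 1 < m)
    (hg : ∀ h, g h = if h = i then f (i + 1) else if h = i + 1 then f i else f h)
    (hlt : f i < f (i + 1)) (H h : ℕ) (hh : h < m) :
    prv g h = swapRow (prv f) m i (prv g i) H h := by
  have hq : prv f (i + 1) = i + 1 := prv_eq le_rfl (Or.inr (by simpa using hlt)) (by omega)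
  have hle := prv_le f h
  have hsp := prv_spec f h
  have hgt := fun j h1 h2 => lt_of_prv_le hf (h := h) (j := j) hh h1 h2
  rw [swapRow, if_pos hi, if_pos hq]
  split_ifs with h1 h2 h3
  · rw [h1]
  · subst h2
    have hle := prv_le f i
    have hsp := prv_spec f i
    refine prv_eq (by omega) ?_ fun j h4 h5 => ?_
    · rcases Nat.eq_zero_or_pos (prv f i) with h0 | hpos
      · exact Or.inl h0
      · have h0 := hsp.resolve_left hpos.ne'
        refine Or.inr ?_
        rw [hg, hg, if_neg (by omega), if_neg (by omega), if_neg (by omega), if_pos rfl]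
        exact h0
    · rw [hg, hg j, if_neg (by omega), if_pos rfl]
      split_ifs with h6 h7
      · exact hlt.le
      · exact le_rfl
      · exact le_of_prv_le h4 (by omega)
  · rw [h3] at hle hsp hgt
    refine prv_eq (by omega) ?_ fun j h4 h5 => ?_
    · right
      rw [hg, hg h, if_neg (by omega), if_pos (by omega), if_neg h1, if_neg h2]
      simpa using hsp
    · rw [hg, hg j, if_neg h1, if_neg h2, if_neg (by omega), if_neg (by omega)]
      exact (hgt j (by omega) h5).le
  · refine prv_eq hle ?_ fun j h4 h5 => ?_
    · rcases Nat.eq_zero_or_pos (prv f h) with h0 | hpos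
      · exact Or.inl h0
      · have h0 := hsp.resolve_left hpos.ne'
        right
        rw [hg, hg h, if_neg h1, if_neg h2, if_neg (by omega)]
        split_ifs with h4
        · rw [h4] at h0
          exact hlt.trans h0
        · exact h0
    · rw [hg, hg j, if_neg h1, if_neg h2]
      split_ifs with h6 h7
      · exact (hgt (i + 1) (by omega) (by omega)).le
      · by_cases h8 : prv f h ≤ i
        · exact (hgt i h8 (by omega)).le
        · have : prv f h = i + 1 := by omega
          exact absurd this h3
      · exact (hgt j h4 h5).le

/-- The parents after a swap that moves the larger value to the back: it keeps the children of
`i + 1` that have larger values, which are those before some position `H`, as the values of the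
children of a position decrease from left to right. -/
theorem prv_swap_of_gt (hf : Set.InjOn f (Set.Iio m)) (hi : i + 1 < m)
    (hg : ∀ h, g h = if h = i then f (i + 1) else if h = i + 1 then f i else f h)
    (hlt : f (i + 1) < f i) (c H : ℕ)
    (hH : ∀ h < m, i + 1 < h → prv f h = i + 2 → (H ≤ h ↔ f h < f i)) (h : ℕ) (hh : h < m) :
    prv g h = swapRow (prv f) m i c H h := by
  have hq' := prv_le f (i + 1)
  have hq : prv f (i + 1) ≠ i + 1 := fun he => by
    have := prv_spec f (i + 1)
    rw [he] at this
    simp at this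
    omega
  have hle := prv_le f h
  have hsp := prv_spec f h
  have hgt := fun j h1 h2 => lt_of_prv_le hf (h := h) (j := j) hh h1 h2
  rw [swapRow, if_pos hi, if_neg hq]
  split_ifs with h1 h2 h3
  · subst h1
    have hsp := prv_spec f (h + 1)
    refine prv_eq (by omega) ?_ fun j h4 h5 => ?_
    · rcases Nat.eq_zero_or_pos (prv f (h + 1)) with h0 | hpos
      · exact Or.inl h0
      · have h0 := hsp.resolve_left hpos.ne'
        refine Or.inr ?_
        rw [hg, hg h, if_neg (by omega), if_neg (by omega), if_pos rfl]
        exact h0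
    · rw [hg, hg j, if_pos rfl, if_neg (by omega), if_neg (by omega)]
      exact le_of_prv_le h4 (by omega)
  · subst h2
    refine prv_eq le_rfl (Or.inr ?_) fun j h4 h5 => by omega
    rw [hg, hg (i + 1), if_pos (by omega), if_neg (by omega), if_pos rfl]
    exact hlt
  · obtain ⟨h3, h3'⟩ := h3
    rw [h3] at hle hsp hgt
    have hfi := (hH h hh (by omega) h3).1 h3'
    refine prv_eq (by omega) ?_ fun j h4 h5 => ?_
    · right
      rw [hg, hg h, if_pos (by omega), if_neg h1, if_neg h2]
      simpa using hsp
    · rw [hg, hg j, if_neg h1, if_neg h2, if_neg (by omega)]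
      split_ifs with h6
      · exact hfi.le
      · exact (hgt j (by omega) h5).le
  · refine prv_eq hle ?_ fun j h4 h5 => ?_
    · rcases Nat.eq_zero_or_pos (prv f h) with h0 | hpos
      · exact Or.inl h0
      · have h0 := hsp.resolve_left hpos.ne'
        right
        rw [hg, hg h, if_neg h1, if_neg h2]
        split_ifs with h4 h5
        · rw [h4] at h0
          exact absurd ((hgt (i + 1) (by omega) (by omega)).trans hlt) h0.not_gt
        · have h6 : prv f h = i + 2 := by omega
          have h7 : ¬ f h < f i := fun hc => h3 ⟨h6, (hH h hh (by omega) h6).2 hc⟩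
          refine lt_of_le_of_ne (not_lt.1 h7) fun he => ?_
          have := hf (show i ∈ Set.Iio m from by simp; omega) (show h ∈ Set.Iio m from hh) he
          omega
        · exact h0
    · rw [hg, hg j, if_neg h1, if_neg h2]
      split_ifs with h6 h7
      · exact (hgt (i + 1) (by omega) (by omega)).le
      · by_cases h8 : prv f h ≤ i
        · exact (hgt i h8 (by omega)).le
        · have h9 : prv f h = i + 1 := by omega
          rw [h9] at hgt hsp
          have := hgt (i + 1) (by omega) (by omega)
          simp at hsp
          omega
      · exact (hgt j h4 h5).le

end swap

/-! ### Moving blocks of values without changing a parent -/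

section shift
variable {f : ℕ → ℤ} {m : ℕ}

/-- Raising the values by multiples of a large number keeps the parents if the multiples respect
the order between each position and its parent, and between each position and those that lie
between it and its parent. -/
theorem exists_shift (hf : Set.InjOn f (Set.Iio m)) (k : ℕ → ℕ)
    (h1 : ∀ h < m, ∀ j < h, prv f h = j + 1 → f j < f h → (∀ l < h, j < l → f h < f l) → k j ≤ k h)
    (h2 : ∀ h < m, ∀ j < h, prv f h ≤ j → (∀ l < h, j ≤ l → f h < f l) → k h ≤ k j) :
    ∃ x : List ℤ, x.Nodup ∧ x.length = m ∧ (∀ h < m, prv (vals x) h = prv f h) ∧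
      ∀ a < m, ∀ b < m, k a < k b → vals x a < vals x b := by
  -- a multiple of `M` outweighs all differences of values
  obtain ⟨M, hM⟩ : ∃ M : ℤ, ∀ a < m, ∀ b < m, f a - f b < M := by
    have hpos : ∀ a < m, |f a| ≤ ∑ i ∈ Finset.range m, |f i| := fun a ha =>
      Finset.single_le_sum (f := fun i => |f i|) (fun i _ => abs_nonneg _) (Finset.mem_range.2 ha)
    refine ⟨2 * ∑ i ∈ Finset.range m, |f i| + 1, fun a ha b hb => ?_⟩
    have := hpos a ha
    have := hpos b hb
    have := le_abs_self (f a)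
    have := neg_abs_le (f b)
    linarith
  have hM0 : ∀ a < m, 0 < M := fun a ha => by simpa using hM a ha a ha
  let x := (List.range m).map (fun h => f h + M * k h)
  have hv : ∀ h < m, vals x h = f h + M * k h := fun h hh => by
    simp [x, vals, hh]
  have hlt : ∀ a < m, ∀ b < m, k a < k b → vals x a < vals x b := fun a ha b hb hk => by
    rw [hv a ha, hv b hb]
    have h3 := hM a ha b hb
    have h4 : M * ((k a : ℤ) + 1) ≤ M * k b :=
      mul_le_mul_of_nonneg_left (by exact_mod_cast hk) (hM0 a ha).le
    linarith
  have hle : ∀ a < m, ∀ b < m, k a ≤ k b → f a < f b → vals x a < vals x b :=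
    fun a ha b hb hk hab => by
      rw [hv a ha, hv b hb]
      have h4 : M * (k a : ℤ) ≤ M * k b :=
        mul_le_mul_of_nonneg_left (by exact_mod_cast hk) (hM0 a ha).le
      linarith
  refine ⟨x, ?_, by simp [x], fun h hh => ?_, hlt⟩
  · refine List.Nodup.map_on (fun a ha b hb he => ?_) List.nodup_range
    rw [List.mem_range] at ha hb
    rw [← hv a ha, ← hv b hb] at he
    rcases lt_trichotomy (k a) (k b) with hk | hk | hk
    · exact absurd he (hlt a ha b hb hk).ne
    · rw [hv a ha, hv b hb, hk] at he
      exact hf ha hb (by linarith)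
    · exact absurd he (hlt b hb a ha hk).ne'
  · have hp := prv_le f h
    have hgt := fun j h1 h2 => lt_of_prv_le hf (h := h) (j := j) hh h1 h2
    refine prv_eq hp ?_ fun j h3 h4 => ?_
    · rcases Nat.eq_zero_or_pos (prv f h) with h0 | h0
      · exact Or.inl h0
      · have h3 := (prv_spec f h).resolve_left h0.ne'
        exact Or.inr (hle _ (by omega) _ hh (h1 h hh _ (by omega) (by omega) h3
          fun l hl hl' => hgt l (by omega) hl) h3)
    · exact (hle h hh j (by omega) (h2 h hh j h4 h3 fun l hl hl' => hgt l (by omega) hl)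
        (hgt j h3 h4)).le

open Classical in
/-- If `i` is the parent of `i + 1`, each `c` on the chain of parents starting at `i - 1` can become
the parent of the larger element when positions `i` and `i + 1` are exchanged: raise the right
subtree of `i`, and raise the positions from `c` to `i - 1` even more. -/
theorem exists_chain (hf : Set.InjOn f (Set.Iio m)) {i c : ℕ} (hi : i + 1 < m)
    (hq : prv f (i + 1) = i + 1) (hci : c ≤ i) (hc : prv f i ≤ c)
    (hch : ∀ l < i, c ≤ l → c ≤ prv f l) :
    ∃ x : List ℤ, x.Nodup ∧ x.length = m ∧ (∀ h < m, prv (vals x) h = prv f h) ∧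
      (c = 0 ∨ vals x (c - 1) < vals x (i + 1)) ∧
      ∀ j < i, c ≤ j → vals x (i + 1) < vals x j := by
  have hfi : f i < f (i + 1) := by simpa [hq] using prv_spec f (i + 1)
  have hcl : ∀ l < i, c ≤ l → f i < f l := fun l h1 h2 =>
    lt_of_prv_le hf (by omega) (hc.trans h2) h1
  let k : ℕ → ℕ := fun h => if c ≤ h ∧ h < i then 2
    else if i < h ∧ ∀ l, i < l → l ≤ h → f i < f l then 1 else 0
  have k2 : ∀ h, c ≤ h → h < i → k h = 2 := fun h h1 h2 => if_pos ⟨h1, h2⟩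
  have k1 : ∀ h, i < h → (∀ l, i < l → l ≤ h → f i < f l) → k h = 1 := fun h h1 h2 => by
    simp only [k]
    rw [if_neg (by omega), if_pos ⟨h1, h2⟩]
  have kcases : ∀ h, (c ≤ h ∧ h < i ∧ k h = 2) ∨
      (i < h ∧ (∀ l, i < l → l ≤ h → f i < f l) ∧ k h = 1) ∨ k h = 0 := fun h => by
    by_cases h1 : c ≤ h ∧ h < i
    · exact Or.inl ⟨h1.1, h1.2, k2 h h1.1 h1.2⟩
    · by_cases h2 : i < h ∧ ∀ l, i < l → l ≤ h → f i < f l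
      · exact Or.inr (Or.inl ⟨h2.1, h2.2, k1 h h2.1 h2.2⟩)
      · right; right
        simp only [k]
        rw [if_neg h1, if_neg h2]
  refine (exists_shift hf k (fun h hh j hj hp hlt hbt => ?_)
    (fun h hh j hj hp hbt => ?_)).elim fun x ⟨hx, hxl, hxp, hxk⟩ => ?_
  rotate_left 2
  · refine ⟨x, hx, hxl, hxp, ?_, fun j h1 h2 => hxk _ hi _ (by omega) ?_⟩
    · rcases Nat.eq_zero_or_pos c with h0 | h0
      · exact Or.inl h0
      · right
        refine hxk _ (by omega) _ hi ?_
        rw [k1 (i + 1) (by omega) fun l h1 h2 => by rwa [show l = i + 1 by omega]]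
        rcases kcases (c - 1) with h | h | h <;> omega
    · rw [k1 (i + 1) (by omega) fun l h1 h2 => by rwa [show l = i + 1 by omega], k2 j h2 h1]
      exact Nat.one_lt_two
  · rcases kcases j with ⟨h1, h2, h3⟩ | ⟨h1, h2, h3⟩ | h3
    · rcases lt_trichotomy h i with h4 | h4 | h4
      · rw [h3, k2 h (by omega) h4]
      · subst h4; omega
      · have := hbt i h4 h2
        have := hcl j h2 h1
        omega
    · rw [h3, k1 h (by omega) fun l h4 h5 => ?_]
      rcases lt_trichotomy l j with h6 | h6 | h6
      · exact h2 l h4 h6.le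
      · exact h2 l h4 h6.le
      · have h7 := h2 j h1 le_rfl
        rcases h5.lt_or_eq with h8 | h8
        · exact (h7.trans hlt).trans (hbt l h8 h6)
        · rw [h8]; exact h7.trans hlt
    · omega
  · rcases kcases h with ⟨h1, h2, h3⟩ | ⟨h1, h2, h3⟩ | h3
    · rw [h3, k2 j (le_trans (hch h h2 h1) hp) (by omega)]
    · have : i + 1 ≤ prv f h := le_prv h1 (Or.inr (by simpa using h2 h h1 le_rfl))
      rw [h3, k1 j (by omega) fun l h4 h5 => h2 l h4 (by omega)]
    · omega

open Classical in
/-- If `i` is not the parent of `i + 1`, the value at `i` can be placed below any final part of the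
values of the right children of `i + 1`. -/
theorem exists_threshold (hf : Set.InjOn f (Set.Iio m)) {i H : ℕ} (hi : i + 1 < m)
    (hq : prv f (i + 1) ≠ i + 1) (hH : H = m ∨ H < m ∧ prv f H = i + 2) :
    ∃ x : List ℤ, x.Nodup ∧ x.length = m ∧ (∀ h < m, prv (vals x) h = prv f h) ∧
      ∀ h < m, i + 1 < h → prv f h = i + 2 → (H ≤ h ↔ vals x h < vals x i) := by
  have hq' := prv_le f (i + 1)
  have hfi : f (i + 1) < f i := lt_of_prv_le hf hi (by omega) (by omega)
  let k : ℕ → ℕ := fun h =>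
    if i + 1 < h ∧ h < H ∧ ∀ l, i + 1 < l → l ≤ h → f (i + 1) < f l then 2
    else if h ≤ i ∧ ∀ l, h ≤ l → l ≤ i → f (i + 1) < f l then 1 else 0
  have k2 : ∀ h, i + 1 < h → h < H → (∀ l, i + 1 < l → l ≤ h → f (i + 1) < f l) → k h = 2 :=
    fun h h1 h2 h3 => if_pos ⟨h1, h2, h3⟩
  have k1 : ∀ h, h ≤ i → (∀ l, h ≤ l → l ≤ i → f (i + 1) < f l) → k h = 1 := fun h h1 h2 => by
    simp only [k]
    rw [if_neg (by omega), if_pos ⟨h1, h2⟩]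
  have kcases : ∀ h,
      (i + 1 < h ∧ h < H ∧ (∀ l, i + 1 < l → l ≤ h → f (i + 1) < f l) ∧ k h = 2) ∨
      (h ≤ i ∧ (∀ l, h ≤ l → l ≤ i → f (i + 1) < f l) ∧ k h = 1) ∨ k h = 0 := fun h => by
    by_cases h1 : i + 1 < h ∧ h < H ∧ ∀ l, i + 1 < l → l ≤ h → f (i + 1) < f l
    · exact Or.inl ⟨h1.1, h1.2.1, h1.2.2, k2 h h1.1 h1.2.1 h1.2.2⟩
    · by_cases h2 : h ≤ i ∧ ∀ l, h ≤ l → l ≤ i → f (i + 1) < f l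
      · exact Or.inr (Or.inl ⟨h2.1, h2.2, k1 h h2.1 h2.2⟩)
      · right; right
        simp only [k]
        rw [if_neg h1, if_neg h2]
  have ki : k i = 1 := k1 i le_rfl fun l h1 h2 => by rwa [show l = i by omega]
  refine (exists_shift hf k (fun h hh j hj hp hlt hbt => ?_)
    (fun h hh j hj hp hbt => ?_)).elim fun x ⟨hx, hxl, hxp, hxk⟩ => ?_
  rotate_left 2
  · refine ⟨x, hx, hxl, hxp, fun h hh h1 h2 => ?_⟩
    have hfh : f (i + 1) < f h := by simpa [h2] using prv_spec f h
    by_cases h3 : h < H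
    · have h4 : k h = 2 := k2 h h1 h3 fun l h4 h5 => by
        rcases h5.lt_or_eq with h6 | h6
        · exact hfh.trans (lt_of_prv_le hf hh (by omega) h6)
        · rwa [h6]
      have := hxk i (by omega) h hh (by omega)
      constructor <;> intro <;> omega
    · have h4 : k h = 0 := by
        rcases kcases h with h | h | h
        · omega
        · omega
        · exact h
      have := hxk h hh i (by omega) (by omega)
      constructor <;> intro <;> omega
  · rcases kcases j with ⟨h1, h2, h2', h3⟩ | ⟨h1, h2, h3⟩ | h3
    · have h4 : h < H := by
        rcases hH with h5 | ⟨h5, h6⟩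
        · omega
        · by_contra h7
          have h8 : f H < f j := lt_of_prv_le hf h5 (by omega) h2
          rcases (not_lt.1 h7).lt_or_eq with h9 | h9
          · have := hbt H h9 h2
            omega
          · subst h9; omega
      rw [h3, k2 h (by omega) h4 fun l h4 h5 => ?_]
      rcases le_or_gt l j with h6 | h6
      · exact h2' l h4 h6
      · have h7 := h2' j h1 le_rfl
        rcases h5.lt_or_eq with h8 | h8
        · exact (h7.trans hlt).trans (hbt l h8 h6)
        · rw [h8]; exact h7.trans hlt
    · have h4 := h2 j le_rfl h1
      rcases lt_trichotomy h (i + 1) with h5 | h5 | h5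
      · rw [h3, k1 h (by omega) fun l h6 h7 => h2 l (by omega) h7]
      · subst h5; omega
      · have := hbt (i + 1) h5 (by omega)
        omega
    · omega
  · rcases kcases h with ⟨h1, h2, h2', h3⟩ | ⟨h1, h2, h3⟩ | h3
    · have : i + 2 ≤ prv f h := le_prv h1 (Or.inr (by simpa using h2' h h1 le_rfl))
      rw [h3, k2 j (by omega) (by omega) fun l h4 h5 => h2' l h4 (by omega)]
    · rw [h3, k1 j (by omega) fun l h4 h5 => ?_]
      rcases le_or_gt h l with h6 | h6
      · exact h2 l h6 h5
      · exact (h2 h le_rfl h1).trans (hbt l h6 h4)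
    · omega

end shift

/-! ### The words of the automaton -/

theorem length_swap (x : List ℤ) (i : ℕ) : (swap x i).length = x.length := by
  unfold swap; split <;> simp

theorem vals_swap {x : List ℤ} {i : ℕ} (hi : i + 1 < x.length) (h : ℕ) :
    vals (swap x i) h = if h = i then vals x (i + 1) else if h = i + 1 then vals x i
      else vals x h := by
  have e1 : vals x (i + 1) = x[i + 1] := List.getD_eq_getElem _ _ hi
  have e2 : vals x i = x[i] := List.getD_eq_getElem _ _ (by omega)
  rw [e1, e2]
  simp only [vals, swap, dif_pos hi, List.getD_eq_getElem?_getD, List.getElem?_set,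
    List.length_set]
  split_ifs <;> first | omega | simp

theorem swap_swap (x : List ℤ) (i : ℕ) : swap (swap x i) i = x := by
  by_cases hi : i + 1 < x.length
  · refine List.ext_getElem (by simp [length_swap]) fun h h1 h2 => ?_
    have hi' : i + 1 < (swap x i).length := by rwa [length_swap]
    rw [← List.getD_eq_getElem _ 0 h1, ← List.getD_eq_getElem _ 0 h2]
    change vals _ h = vals _ h
    rw [vals_swap hi', vals_swap hi, vals_swap hi, vals_swap hi]
    split_ifs with h3 h4 <;> first | omega | (subst_vars; rfl)
  · simp [swap, hi]

theorem nodup_of_injOn {x : List ℤ} (h : Set.InjOn (vals x) (Set.Iio x.length)) : x.Nodup := by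
  rw [List.nodup_iff_injective_get]
  intro a b hab
  have := h (show a.1 ∈ Set.Iio _ from a.2) (show b.1 ∈ Set.Iio _ from b.2) (by
    simpa [vals] using hab)
  exact Fin.ext this

theorem nodup_swap {x : List ℤ} (hx : x.Nodup) (i : ℕ) : (swap x i).Nodup := by
  by_cases hi : i + 1 < x.length
  · refine nodup_of_injOn fun a ha b hb hab => ?_
    rw [length_swap] at ha hb
    rw [vals_swap hi, vals_swap hi] at hab
    have hinj := vals_injOn hx
    have hia : i ∈ Set.Iio x.length := by simp; omega
    have hib : i + 1 ∈ Set.Iio x.length := hi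
    split_ifs at hab
    · omega
    · have := hinj hib hia hab; omega
    · have := hinj hib hb hab; omega
    · have := hinj hia hib hab; omega
    · omega
    · have := hinj hia hb hab; omega
    · have := hinj ha hib hab; omega
    · have := hinj ha hia hab; omega
    · exact hinj ha hb hab
  · simpa [swap, hi] using hx

theorem SameParents.symm {x y : List ℤ} (h : SameParents x y) : SameParents y x :=
  ⟨h.1.symm, fun j hj => (h.2 j (h.1 ▸ hj)).symm⟩

theorem mem_neighbourTables_iff {p : List ℤ} (hp : p.Nodup) {w : List ℕ} :
    w ∈ neighbourTables p ↔ w = parentDistance p ∨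
      ∃ x : List ℤ, ∃ i : ℕ, x.Nodup ∧ SameParents p x ∧ i + 1 < p.length ∧
        w = parentDistance (swap x i) := by
  simp only [neighbourTables, neighbourhood, neighboursAt, Set.mem_union, Set.mem_singleton_iff,
    Set.mem_ofPred_eq, Set.mem_iUnion]
  refine or_congr Iff.rfl ⟨?_, ?_⟩
  · rintro ⟨y, hy, ⟨i, x, hx, hpx, hi, hyx⟩, rfl⟩
    have hsp := (cartesianTree_eq_iff hp hx).1 hpx
    exact ⟨x, i, hx, hsp, by rwa [hsp.1], parentDistance_eq_iff.2
      ((cartesianTree_eq_iff hy (nodup_swap hx i)).1 hyx)⟩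
  · rintro ⟨x, i, hx, hpx, hi, rfl⟩
    exact ⟨swap x i, nodup_swap hx i, ⟨i, x, hx, (cartesianTree_eq_iff hp hx).2 hpx,
      by rwa [← hpx.1], rfl⟩, rfl⟩

/-- As a swap undoes itself, it suffices to swap a sequence with the Cartesian tree of the
pattern. -/
theorem swapMatch_iff {p y : List ℤ} (hp : p.Nodup) (hy : y.Nodup) :
    SwapMatch y p ↔ parentDistance y ∈ neighbourTables p := by
  rw [mem_neighbourTables_iff hp, parentDistance_eq_iff]
  refine or_congr (cartesianTree_eq_iff hy hp) ⟨?_, ?_⟩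
  · rintro ⟨x', y', i, hx', hy', hi, h1, h2, h3, h4⟩
    have h5 := (cartesianTree_eq_iff hx' hy).1 h1
    have h6 := (cartesianTree_eq_iff hy' hp).1 h2
    have h7 : y.length = p.length := by rw [← h5.1, ← h6.1, h3, length_swap]
    exact ⟨y', i, hy', h6.symm, by omega, parentDistance_eq_iff.2 (h3 ▸ h5.symm)⟩
  · rintro ⟨x, i, hx, hpx, hi, he⟩
    have h1 := parentDistance_eq_iff.1 he
    refine ⟨swap x i, x, i, nodup_swap hx i, hx, ?_,
      (cartesianTree_eq_iff (nodup_swap hx i) hy).2 h1.symm,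
      (cartesianTree_eq_iff hx hp).2 hpx.symm, rfl, (swap_swap x i).symm⟩
    rw [h1.1, length_swap, ← hpx.1]
    exact hi

/-- The first position from `c` on whose parent lies before `c - 1`, or `m` if there is none. -/
def nxt (q : ℕ → ℕ) (m c : ℕ) : ℕ :=
  Nat.find (p := fun i => c ≤ i ∧ (m ≤ i ∨ q i < c)) ⟨max c m, le_max_left _ _,
      Or.inl (le_max_right _ _)⟩

theorem nxt_spec (q : ℕ → ℕ) (m c : ℕ) : c ≤ nxt q m c ∧ (m ≤ nxt q m c ∨ q (nxt q m c) < c) :=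
  Nat.find_spec (p := fun i => c ≤ i ∧ (m ≤ i ∨ q i < c)) _

theorem nxt_min {q : ℕ → ℕ} {m c i : ℕ} (h1 : c ≤ i) (h2 : i < nxt q m c) : i < m ∧ c ≤ q i := by
  have := Nat.find_min (p := fun i => c ≤ i ∧ (m ≤ i ∨ q i < c)) _ h2
  omega

theorem nxt_eq {q : ℕ → ℕ} {m c i : ℕ} (h1 : c ≤ i) (h2 : m ≤ i ∨ q i < c)
    (h3 : ∀ j, c ≤ j → j < i → j < m ∧ c ≤ q j) : nxt q m c = i := by
  rcases lt_trichotomy (nxt q m c) i with h | h | h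
  · have h4 := nxt_spec q m c
    have := h3 _ h4.1 h
    omega
  · exact h
  · have := nxt_min h1 h
    omega

/-- The swaps to be tried, as arguments `i`, `c`, `H` of `swapRow`. There are three groups of `m`
candidates: for each `i` the two extreme choices; for each `c` the one position `i` where `c - 1` is
a proper ancestor removed from the chain of parents; for each `H` the one `i` such that `H` is a
child of `i + 1`. A value `i ≥ m - 1` stands for no swap. -/
def prm (q : ℕ → ℕ) (m s : ℕ) : ℕ × ℕ × ℕ :=
  if s / m = 0 then (s % m, q (s % m), m)
  else if s / m = 1 then (nxt q m (s % m + 1), s % m + 1, m)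
  else
    let i := if 1 < q (s % m) then q (s % m) - 2 else m
    (i, q i, s % m)

/-- The parents described by the candidate number `s`. -/
def row (q : ℕ → ℕ) (m s : ℕ) : ℕ → ℕ :=
  swapRow q m (prm q m s).1 (prm q m s).2.1 (prm q m s).2.2

/-- The table of parent-distances described by the candidate number `s`. -/
def word (q : ℕ → ℕ) (m s : ℕ) : List ℕ := (List.range m).map (fun h => lab (row q m s h) h)

@[simp] theorem length_word (q : ℕ → ℕ) (m s : ℕ) : (word q m s).length = m := by simp [word]

theorem parentDistance_eq_of_row {x : List ℤ} {m : ℕ} (hm : x.length = m) {r : ℕ → ℕ}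
    (h : ∀ h < m, prv (vals x) h = r h) :
    parentDistance x = (List.range m).map (fun h => lab (r h) h) := by
  rw [parentDistance_eq_map, hm]
  exact List.map_congr_left fun j hj => by rw [h j (List.mem_range.1 hj)]

theorem swapRow_congr {q q' : ℕ → ℕ} {m : ℕ} (hq : ∀ h < m, q h = q' h) (i c H : ℕ) {h : ℕ}
    (hh : h < m) : swapRow q m i c H h = swapRow q' m i c H h := by
  unfold swapRow
  by_cases hi : i + 1 < m
  · rw [if_pos hi, if_pos hi, hq h hh, hq i (by omega), hq _ hi]
  · rw [if_neg hi, if_neg hi, hq h hh]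

section words
variable {p : List ℤ}

/-- A candidate that moves the larger value to the front is a table of a neighbour if the new parent
lies on the chain of parents. -/
theorem row_mem_of_chain (hp : p.Nodup) {i c : ℕ} (hi : i + 1 < p.length)
    (hq : prv (vals p) (i + 1) = i + 1) (hci : c ≤ i) (hc : prv (vals p) i ≤ c)
    (hch : ∀ l < i, c ≤ l → c ≤ prv (vals p) l) (H : ℕ) :
    (List.range p.length).map (fun h => lab (swapRow (prv (vals p)) p.length i c H h) h) ∈
      neighbourTables p := by
  obtain ⟨x, hx, hxl, hxp, h1, h2⟩ := exists_chain (vals_injOn hp) hi hq hci hc hch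
  rw [mem_neighbourTables_iff hp]
  refine Or.inr ⟨x, i, hx, ⟨hxl.symm, fun h hh => (hxp h hh).symm⟩, hi, ?_⟩
  have hi' : i + 1 < x.length := by rwa [hxl]
  have hlt : vals x i < vals x (i + 1) := by
    have := prv_spec (vals x) (i + 1)
    rw [hxp _ hi, hq] at this
    simpa using this
  symm
  refine parentDistance_eq_of_row (by rw [length_swap, hxl]) fun h hh => ?_
  rw [prv_swap_of_lt (vals_injOn hx) hi' (vals_swap hi') hlt H h (by rwa [hxl]), hxl,
    swapRow_congr hxp _ _ _ hh]
  congr 1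
  refine prv_eq hci ?_ fun j h3 h4 => ?_
  · rcases Nat.eq_zero_or_pos c with h0 | h0
    · exact Or.inl h0
    · right
      rw [vals_swap hi', vals_swap hi', if_neg (by omega), if_neg (by omega), if_pos rfl]
      exact h1.resolve_left h0.ne'
  · rw [vals_swap hi', vals_swap hi', if_pos rfl, if_neg (by omega), if_neg (by omega)]
    exact (h2 j h4 h3).le

/-- A candidate that moves the larger value to the back is a table of a neighbour if the children
from one of them on change their parent. -/
theorem row_mem_of_threshold (hp : p.Nodup) {i H : ℕ} (hi : i + 1 < p.length)
    (hq : prv (vals p) (i + 1) ≠ i + 1)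
    (hH : H = p.length ∨ H < p.length ∧ prv (vals p) H = i + 2) (c : ℕ) :
    (List.range p.length).map (fun h => lab (swapRow (prv (vals p)) p.length i c H h) h) ∈
      neighbourTables p := by
  obtain ⟨x, hx, hxl, hxp, h1⟩ := exists_threshold (vals_injOn hp) hi hq hH
  rw [mem_neighbourTables_iff hp]
  refine Or.inr ⟨x, i, hx, ⟨hxl.symm, fun h hh => (hxp h hh).symm⟩, hi, ?_⟩
  have hi' : i + 1 < x.length := by rwa [hxl]
  have hlt : vals x (i + 1) < vals x i := by
    have h2 := prv_le (vals x) (i + 1)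
    rw [hxp _ hi] at h2
    exact lt_of_prv_le (vals_injOn hx) hi' (by rw [hxp _ hi]; omega) (by omega)
  symm
  refine parentDistance_eq_of_row (by rw [length_swap, hxl]) fun h hh => ?_
  rw [prv_swap_of_gt (vals_injOn hx) hi' (vals_swap hi') hlt c H (fun j hj h3 h4 => ?_) h
    (by rwa [hxl]), hxl, swapRow_congr hxp _ _ _ hh]
  rw [hxl] at hj
  exact h1 j hj h3 (by rwa [← hxp j hj])

theorem row_eq_parentDistance {i : ℕ} (hi : ¬ i + 1 < p.length) (c H : ℕ) :
    (List.range p.length).map (fun h => lab (swapRow (prv (vals p)) p.length i c H h) h) =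
      parentDistance p := by
  symm
  refine parentDistance_eq_of_row rfl fun h hh => ?_
  rw [swapRow, if_neg hi]

/-- No position strictly between the parent of `i` and `i` has a parent before that of `i`. -/
theorem prv_chain (hp : p.Nodup) {i : ℕ} (hi : i < p.length) :
    ∀ l < i, prv (vals p) i ≤ l → prv (vals p) i ≤ prv (vals p) l := fun l h1 h2 => by
  refine le_prv h2 ?_
  rcases prv_spec (vals p) i with h0 | h0
  · exact Or.inl h0
  · exact Or.inr (h0.trans (lt_of_prv_le (vals_injOn hp) hi h2 h1))

theorem word_mem (hp : p.Nodup) (s : ℕ) :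
    word (prv (vals p)) p.length s ∈ neighbourTables p := by
  unfold word row
  set q := prv (vals p) with hqdef
  by_cases hi : (prm q p.length s).1 + 1 < p.length
  swap
  · rw [row_eq_parentDistance hi]
    exact Or.inl rfl
  by_cases hq : q ((prm q p.length s).1 + 1) = (prm q p.length s).1 + 1
  · have key : (prm q p.length s).2.1 ≤ (prm q p.length s).1 ∧
        q (prm q p.length s).1 ≤ (prm q p.length s).2.1 ∧
        ∀ l < (prm q p.length s).1, (prm q p.length s).2.1 ≤ l → (prm q p.length s).2.1 ≤ q l := by
      have hpr := prv_chain hp (show (prm q p.length s).1 < p.length by omega)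
      have hle := prv_le (vals p) (prm q p.length s).1
      unfold prm at hi hpr hle ⊢
      split_ifs at hi hpr hle ⊢ with h1 h2
      · exact ⟨hle, le_rfl, hpr⟩
      · have h3 := nxt_spec q p.length (s % p.length + 1)
        simp only at hi
        exact ⟨h3.1, by simp only; omega, fun l h4 h5 => (nxt_min h5 h4).2⟩
      all_goals exact ⟨hle, le_rfl, hpr⟩
    exact row_mem_of_chain hp hi hq key.1 key.2.1 key.2.2 _
  · refine row_mem_of_threshold hp hi hq ?_ _
    unfold prm at hi hq ⊢
    split_ifs at hi hq ⊢ with h1 h2 h3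
    · exact Or.inl rfl
    · exact Or.inl rfl
    · right
      refine ⟨Nat.mod_lt _ (by omega), ?_⟩
      change q (s % p.length) = q (s % p.length) - 2 + 2
      omega
    · simp only at hi; omega

/-- A swap that does not choose an end of the range of possible parents or children is found in the
second or third group of candidates. -/
theorem exists_word_of_mem (hp : p.Nodup) (hm : 0 < p.length) {w : List ℕ}
    (hw : w ∈ neighbourTables p) :
    ∃ s < 3 * p.length, w = word (prv (vals p)) p.length s := by
  unfold word row
  set q := prv (vals p) with hqdef
  -- the three groups of candidates
  have s0 : ∀ r < p.length, prm q p.length r = (r, q r, p.length) := fun r hr => by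
    rw [prm, if_pos (Nat.div_eq_of_lt hr), Nat.mod_eq_of_lt hr]
  have s1 : ∀ r < p.length,
      prm q p.length (p.length + r) = (nxt q p.length (r + 1), r + 1, p.length) := fun r hr => by
    have h1 : (p.length + r) / p.length = 1 := by
      rw [Nat.add_div_left _ hm, Nat.div_eq_of_lt hr]
    rw [prm, h1, if_neg one_ne_zero, if_pos rfl, Nat.add_mod_left, Nat.mod_eq_of_lt hr]
  have s2 : ∀ r < p.length, 1 < q r →
      prm q p.length (2 * p.length + r) = (q r - 2, q (q r - 2), r) := fun r hr h1 => by
    have h2 : (2 * p.length + r) / p.length = 2 := by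
      rw [mul_comm, Nat.mul_add_div hm, Nat.div_eq_of_lt hr]
    have h3 : (2 * p.length + r) % p.length = r := by
      rw [mul_comm, Nat.mul_add_mod, Nat.mod_eq_of_lt hr]
    rw [prm, h2, h3, if_neg (by omega), if_neg (by omega), if_pos h1]
  rcases (mem_neighbourTables_iff hp).1 hw with rfl | ⟨x, i, hx, hpx, hi, rfl⟩
  · refine ⟨p.length - 1, by omega, ?_⟩
    rw [s0 _ (by omega)]
    exact (row_eq_parentDistance (by simp only; omega) _ _).symm
  have hi' : i + 1 < x.length := by rwa [← hpx.1]
  have hxi := vals_injOn hx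
  have hv := vals_swap hi'
  rcases lt_trichotomy (vals x i) (vals x (i + 1)) with hlt | heq | hlt
  · set c := prv (vals (swap x i)) i with hc
    have hrow : ∀ H, parentDistance (swap x i) =
        (List.range p.length).map (fun h => lab (swapRow q p.length i c H h) h) := fun H => by
      refine parentDistance_eq_of_row (by rw [length_swap, hpx.1]) fun h hh => ?_
      rw [prv_swap_of_lt hxi hi' hv hlt H h (by rwa [← hpx.1]), ← hpx.1,
        swapRow_congr hpx.2 _ _ _ hh]
    have hci : c ≤ i := prv_le _ _
    have hcgt : ∀ l < i, c ≤ l → vals x (i + 1) ≤ vals x l := fun l h1 h2 => by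
      have := le_of_prv_le h2 h1
      rwa [hv, hv, if_pos rfl, if_neg (by omega), if_neg (by omega)] at this
    have hcs : c = 0 ∨ vals x (c - 1) < vals x (i + 1) := by
      rcases Nat.eq_zero_or_pos c with h0 | h0
      · exact Or.inl h0
      · right
        have := (prv_spec (vals (swap x i)) i).resolve_left h0.ne'
        rwa [hv, hv, if_neg (by omega), if_neg (by omega), if_pos rfl] at this
    have hqi : q i ≤ c := by
      rw [hqdef, hpx.2 i (by omega)]
      refine le_prv (prv_le _ _) ?_
      rcases Nat.eq_zero_or_pos (prv (vals x) i) with h0 | h0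
      · exact Or.inl h0
      · have h1 := prv_le (vals x) i
        right
        rw [hv, hv, if_neg (by omega), if_neg (by omega), if_pos rfl]
        exact ((prv_spec (vals x) i).resolve_left h0.ne').trans hlt
    rcases hqi.lt_or_eq with h1 | h1
    · refine ⟨p.length + (c - 1), by omega, ?_⟩
      rw [s1 _ (by omega), Nat.sub_add_cancel (by omega), nxt_eq hci (Or.inr h1) fun j h2 h3 => ?_]
      · exact hrow _
      · refine ⟨by omega, ?_⟩
        rw [hqdef, hpx.2 j (by omega)]
        exact le_prv h2 (hcs.imp_right fun h => h.trans_le (hcgt j h3 h2))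
    · refine ⟨i, by omega, ?_⟩
      rw [s0 _ (by omega), h1]
      exact hrow _
  · have := hxi (show i ∈ Set.Iio _ from (by simp; omega)) (show i + 1 ∈ Set.Iio _ from hi') heq
    omega
  · have hrow : ∀ c H, (∀ h < p.length, i + 1 < h → q h = i + 2 → (H ≤ h ↔ vals x h < vals x i)) →
        parentDistance (swap x i) =
          (List.range p.length).map (fun h => lab (swapRow q p.length i c H h) h) :=
      fun c H hH => by
        refine parentDistance_eq_of_row (by rw [length_swap, hpx.1]) fun h hh => ?_
        rw [prv_swap_of_gt hxi hi' hv hlt c H (fun j h1 h2 h3 => ?_) h (by rwa [← hpx.1]), ← hpx.1,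
          swapRow_congr hpx.2 _ _ _ hh]
        rw [← hpx.1] at h1
        exact hH j h1 h2 ((hpx.2 j h1).trans h3)
    by_cases hex : ∃ h, h < p.length ∧ i + 1 < h ∧ q h = i + 2 ∧ vals x h < vals x i
    · classical
      obtain ⟨h1, h2, h3, h4⟩ := Nat.find_spec hex
      have hmin := fun j => Nat.find_min (m := j) hex
      set H := Nat.find hex
      refine ⟨2 * p.length + H, by omega, ?_⟩
      rw [s2 H h1 (by omega), h3]
      refine hrow _ _ fun h h5 h6 h7 => ⟨fun h8 => ?_, fun h8 => ?_⟩
      · rcases h8.lt_or_eq with h9 | h9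
        · refine lt_trans ?_ h4
          rw [hqdef, hpx.2 h h5] at h7
          exact lt_of_prv_le hxi (by rwa [← hpx.1]) (by omega) h9
        · rwa [← h9]
      · by_contra h9
        exact hmin h (not_le.1 h9) ⟨h5, h6, h7, h8⟩
    · refine ⟨i, by omega, ?_⟩
      rw [s0 _ (by omega)]
      refine hrow _ _ fun h h5 h6 h7 => ⟨fun h8 => ?_, fun h8 => ?_⟩
      · exact absurd (show p.length ≤ h from h8) (by omega)
      · exact absurd ⟨h, h5, h6, h7, h8⟩ hex

/-- The words of the automaton are the tables described by the `3m` candidates. -/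
theorem neighbourTables_eq (hp : p.Nodup) (hm : 0 < p.length) :
    neighbourTables p = {w | ∃ s < 3 * p.length, w = word (prv (vals p)) p.length s} := by
  ext w
  refine ⟨exists_word_of_mem hp hm, ?_⟩
  rintro ⟨s, -, rfl⟩
  exact word_mem hp s

end words

/-! ### Moves of the automaton -/

theorem clip_clip {d d' v : ℕ} (h : d ≤ d') : clip d (clip d' v) = clip d v := by
  unfold clip; split_ifs <;> omega

theorem clip_le (d v : ℕ) : clip d v ≤ d := by unfold clip; split_ifs <;> omega

@[simp] theorem length_tableSuffix (w : List ℕ) (k : ℕ) :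
    (tableSuffix w k).length = w.length - k := by simp [tableSuffix]

theorem getElem_tableSuffix (w : List ℕ) (k h : ℕ) (hh : h < (tableSuffix w k).length) :
    (tableSuffix w k)[h] = clip h (w[k + h]'(by simp at hh; omega)) := by
  simp [tableSuffix]

theorem tableSuffix_tableSuffix (w : List ℕ) (a b : ℕ) :
    tableSuffix (tableSuffix w a) b = tableSuffix w (a + b) := by
  refine List.ext_getElem (by simp; omega) fun h h1 h2 => ?_
  rw [getElem_tableSuffix, getElem_tableSuffix, getElem_tableSuffix, clip_clip (by omega)]
  simp only [Nat.add_assoc]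

theorem tableSuffix_concat {w : List ℕ} {k : ℕ} (hk : k ≤ w.length) (v : ℕ) :
    tableSuffix (w ++ [v]) k = tableSuffix w k ++ [clip (w.length - k) v] := by
  simp [tableSuffix, List.drop_append_of_le_length hk, List.mapIdx_append]

theorem tableSuffix_length (w : List ℕ) : tableSuffix w w.length = [] := by
  simp [tableSuffix]

section automaton
variable {D : Set (List ℕ)}

theorem trieNodes_of_prefix {u w : List ℕ} (h : u <+: w) (hw : w ∈ trieNodes D) :
    u ∈ trieNodes D := by
  obtain ⟨d, hd, hwd⟩ := hw
  exact ⟨d, hd, h.trans hwd⟩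

theorem trieNodes_of_concat {u : List ℕ} {v : ℕ} (hw : u ++ [v] ∈ trieNodes D) :
    u ∈ trieNodes D := trieNodes_of_prefix (List.prefix_append _ _) hw

/-- `u` is the table of the longest suffix of `w`, among those that lack at least `a` elements, that
is a state. -/
def IsLongest (D : Set (List ℕ)) (w : List ℕ) (a : ℕ) (u : List ℕ) : Prop :=
  ∃ e, a ≤ e ∧ e ≤ w.length ∧ u = tableSuffix w e ∧ u ∈ trieNodes D ∧
    ∀ e', a ≤ e' → e' < e → tableSuffix w e' ∉ trieNodes D

theorem IsLongest.unique {w u u' : List ℕ} {a : ℕ} (h : IsLongest D w a u)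
    (h' : IsLongest D w a u') : u = u' := by
  obtain ⟨e, h1, -, rfl, h2, h3⟩ := h
  obtain ⟨e', h1', -, rfl, h2', h3'⟩ := h'
  rcases lt_trichotomy e e' with hlt | rfl | hlt
  · exact absurd h2 (h3' e h1 hlt)
  · rfl
  · exact absurd h2' (h3 e' h1' hlt)

theorem isLongest_failure (h0 : [] ∈ trieNodes D) {w : List ℕ} (hw : w ≠ []) :
    IsLongest D w 1 (failure D w) := by
  classical
  have hlen : 0 < w.length := List.length_pos_of_ne_nil hw
  unfold failure
  cases h : ((List.range w.length).map (fun k => tableSuffix w (k + 1))).find?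
      (fun u => decide (u ∈ trieNodes D)) with
  | none =>
    rw [List.find?_eq_none] at h
    refine absurd h0 ?_
    have := h (tableSuffix w (w.length - 1 + 1))
      (List.mem_map.2 ⟨w.length - 1, List.mem_range.2 (by omega), rfl⟩)
    rw [Nat.sub_add_cancel hlen, tableSuffix_length] at this
    simpa using this
  | some u =>
    rw [List.find?_eq_some_iff_getElem] at h
    obtain ⟨h1, i, hi, h2, h3⟩ := h
    simp only [List.length_map, List.length_range] at hi
    simp only [List.getElem_map, List.getElem_range] at h2 h3
    refine ⟨i + 1, by omega, by omega, h2.symm, by simpa using h1, fun e' h4 h5 => ?_⟩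
    have := h3 (e' - 1) (by omega)
    rw [Nat.sub_add_cancel h4] at this
    simpa using this

/-- Following failure links from a suffix of `w` finds the longest suffix of `w ++ [v]` that is a
state. -/
theorem isLongest_acStep_aux (h0 : [] ∈ trieNodes D) {w : List ℕ} {v a : ℕ} {n : ℕ} :
    ∀ e, w.length - e = n → a ≤ e → e ≤ w.length → tableSuffix w e ∈ trieNodes D →
      (∀ e', a ≤ e' → e' < e → tableSuffix (w ++ [v]) e' ∉ trieNodes D) →
      IsLongest D (w ++ [v]) a (acStep D (tableSuffix w e) v) := by
  induction n using Nat.strong_induction_on with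
  | _ n ih =>
    intro e hn hae he hu hmin
    rw [acStep]
    have hc : tableSuffix (w ++ [v]) e =
        tableSuffix w e ++ [clip (tableSuffix w e).length v] := by
      rw [tableSuffix_concat he, length_tableSuffix]
    split_ifs with h1 h2
    · exact ⟨e, hae, by simp; omega, hc.symm, h1, hmin⟩
    · have he' : e = w.length := by
        have := congrArg List.length h2
        simp at this
        omega
      refine ⟨w.length + 1, by omega, by simp, ?_, h0, fun e' h3 h4 => ?_⟩
      · exact (List.length_eq_zero_iff.1 (by simp)).symm
      · rcases (Nat.le_of_lt_succ h4).lt_or_eq with h5 | h5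
        · exact hmin e' h3 (by omega)
        · rw [h5, ← he', hc]; exact h1
    · have hlt := failure_length_lt D _ h2
      obtain ⟨f, hf1, hf2, hf3, hf4, hf5⟩ := isLongest_failure h0 h2
      rw [hf3, tableSuffix_tableSuffix] at *
      rw [length_tableSuffix] at hf2
      simp only [length_tableSuffix] at hlt
      refine ih (w.length - (e + f)) (by omega) (e + f) rfl (by omega) (by omega) hf4
        fun e' h3 h4 => ?_
      rcases lt_trichotomy e' e with h5 | h5 | h5
      · exact hmin e' h3 h5
      · rw [h5, hc]; exact h1
      · intro h6
        rw [tableSuffix_concat (by omega)] at h6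
        have h7 := hf5 (e' - e) (by omega) (by omega)
        rw [tableSuffix_tableSuffix, Nat.add_sub_cancel' h5.le] at h7
        exact h7 (trieNodes_of_concat h6)

theorem IsLongest.concat (h0 : [] ∈ trieNodes D) {w u : List ℕ} {a : ℕ} (v : ℕ)
    (h : IsLongest D w a u) : IsLongest D (w ++ [v]) a (acStep D u v) := by
  obtain ⟨e, h1, h2, rfl, h3, h4⟩ := h
  refine isLongest_acStep_aux h0 e rfl h1 h2 h3 fun e' h5 h6 h7 => h4 e' h5 h6 ?_
  rw [tableSuffix_concat (by omega)] at h7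
  exact trieNodes_of_concat h7

/-- The failure link of a state is found by a move of the automaton from the failure link of its
parent. -/
theorem failure_concat (h0 : [] ∈ trieNodes D) {w : List ℕ} (hw : w ≠ []) (v : ℕ) :
    failure D (w ++ [v]) = acStep D (failure D w) v :=
  (isLongest_failure h0 (by simp)).unique ((isLongest_failure h0 hw).concat h0 v)

theorem length_acStep_le (w : List ℕ) (v : ℕ) : (acStep D w v).length ≤ w.length + 1 := by
  induction w using acStep.induct D v with
  | case1 w h => rw [acStep, if_pos h]; simp
  | case2 h => rw [acStep, if_neg h, dif_pos rfl]; simp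
  | case3 w h1 h2 ih =>
    rw [acStep, if_neg h1, dif_neg h2]
    have := failure_length_lt D w h2
    omega

/-- A move depends only on the part of the parent-distance that lies inside the window. -/
theorem acStep_congr {w : List ℕ} {v v' : ℕ} (hv : ∀ d ≤ w.length, clip d v = clip d v') :
    acStep D w v = acStep D w v' := by
  induction w using acStep.induct D v with
  | case1 w h =>
    rw [acStep, if_pos h, acStep, ← hv _ le_rfl, if_pos h]
  | case2 h =>
    rw [acStep, if_neg h, dif_pos rfl, acStep, ← hv _ le_rfl, if_neg h, dif_pos rfl]
  | case3 w h1 h2 ih =>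
    rw [acStep.eq_def D w v, if_neg h1, dif_neg h2, acStep.eq_def D w v', ← hv _ le_rfl,
      if_neg h1, dif_neg h2]
    exact ih fun d hd => hv d (hd.trans (failure_length_lt D w h2).le)

theorem isLongest_acRun (h0 : [] ∈ trieNodes D) (t : List ℤ) (k : ℕ) :
    IsLongest D ((List.range k).map (pdAt t)) 0 (acRun D t k) := by
  induction k with
  | zero => exact ⟨0, le_rfl, by simp, by simp [acRun, tableSuffix], h0, by omega⟩
  | succ k ih =>
    rw [acRun, List.range_succ, List.map_append]
    exact ih.concat h0 _

/-- Cutting a factor out of a text clips the parent-distances. -/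
theorem parentDistance_factor {t : List ℤ} {j m : ℕ} (h : j + m ≤ t.length) :
    parentDistance (factor t j m) = tableSuffix ((List.range (j + m)).map (pdAt t)) j := by
  have hl : (factor t j m).length = m := by simp [factor]; omega
  refine List.ext_getElem (by simp [hl]) fun i h1 h2 => ?_
  have hi : i < m := by simpa [hl] using h1
  rw [getElem_tableSuffix, List.getElem_map, List.getElem_range]
  simp only [parentDistance, List.getElem_map, List.getElem_range]
  rw [pdAt_eq, pdAt_eq]
  unfold factor
  rw [prv_take hi, prv_drop]
  have := prv_le (vals t) (j + i)
  unfold lab clip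
  split_ifs <;> omega

/-- The automaton of a set of words of length `m` is in a final state exactly if the table of the
current window is one of the words. -/
theorem acRun_mem_iff {m : ℕ} (hD : ∀ d ∈ D, d.length = m) (h0 : [] ∈ trieNodes D) (t : List ℤ)
    {k : ℕ} (hk : k ≤ t.length) :
    acRun D t k ∈ D ↔ m ≤ k ∧ parentDistance (factor t (k - m) m) ∈ D := by
  obtain ⟨e, -, h1, h2, h3, h4⟩ := isLongest_acRun h0 t k
  simp only [List.length_map, List.length_range] at h1
  have hl : (acRun D t k).length = k - e := by rw [h2]; simp
  constructor
  · intro h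
    have h5 := hD _ h
    have h6 : k - m = e := by omega
    refine ⟨by omega, ?_⟩
    rw [parentDistance_factor (by omega), Nat.sub_add_cancel (by omega), h6, ← h2]
    exact h
  · rintro ⟨h5, h6⟩
    rw [parentDistance_factor (by omega), Nat.sub_add_cancel (by omega)] at h6
    have h7 : ¬ k - m < e := fun h => h4 _ (Nat.zero_le _) h ⟨_, h6, List.prefix_rfl⟩
    obtain ⟨d, hd, hpre⟩ := h3
    have h8 := hpre.length_le
    rw [hD d hd] at h8
    rw [h2, show e = k - m by omega]
    exact h6

end automaton

/-! ### A trie in arrays -/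

/-- The arrays `A` with the value `v` stored in cell `i` of array `a`. -/
def set2 (A : ℕ → ℕ → ℕ) (a i v : ℕ) : ℕ → ℕ → ℕ := fun b j => if b = a ∧ j = i then v else A b j

theorem set2_apply (A : ℕ → ℕ → ℕ) (a i v b j : ℕ) :
    set2 A a i v b j = if b = a ∧ j = i then v else A b j := rfl

/-- The child of state `q` along the edge `v`, or `0` if there is none. The arrays `0`, `1`, `4`
hold the parent, the label of the edge from the parent, and the depth of a state. A state with at
most one child has it in array `5`; otherwise array `6` holds the position in array `7` of a table
of its children. -/
def look (A : ℕ → ℕ → ℕ) (q v : ℕ) : ℕ :=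
  if A 6 q ≠ 0 then A 7 (A 6 q + v) else if A 1 (A 5 q) = v then A 5 q else 0

/-- The arrays `A` hold a trie with states `0, …, N - 1`, where state `k` spells `node k`. -/
structure TrieCore (m : ℕ) (A : ℕ → ℕ → ℕ) (N : ℕ) (node : ℕ → List ℕ) : Prop where
  pos : 0 < N
  root : node 0 = []
  par_lt : ∀ k, 0 < k → k < N → A 0 k < k
  node_eq : ∀ k, 0 < k → k < N → node k = node (A 0 k) ++ [A 1 k]
  lab_le : ∀ k, 0 < k → k < N → A 1 k ≤ m
  look_par : ∀ k, 0 < k → k < N → look A (A 0 k) (A 1 k) = k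
  look_sound : ∀ q < N, ∀ v ≤ m, look A q v ≠ 0 →
    look A q v < N ∧ A 0 (look A q v) = q ∧ A 1 (look A q v) = v
  dep : ∀ k < N, A 4 k = (node k).length

/-- The tables of children occupy different slots among the first `s` ones, and all other slots are
empty. -/
structure Tables (m : ℕ) (A : ℕ → ℕ → ℕ) (N s : ℕ) : Prop where
  fresh : ∀ k, N ≤ k → A 5 k = 0 ∧ A 6 k = 0
  only_lt : ∀ q, A 5 q < N
  only_lab : ∀ q, A 5 q ≠ 0 → A 1 (A 5 q) ≤ m
  form : ∀ q, A 6 q ≠ 0 → ∃ r < s, A 6 q = r * (m + 1) + 1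
  inj : ∀ q q', A 6 q ≠ 0 → A 6 q = A 6 q' → q = q'
  zero : ∀ r, s ≤ r → ∀ v ≤ m, A 7 (r * (m + 1) + 1 + v) = 0

/-- The slot `s` is available for a table of state `q`: it is empty, or `q` needs no table as it has
no children. -/
def Avail (m : ℕ) (A : ℕ → ℕ → ℕ) (N s q : ℕ) : Prop :=
  Tables m A N s ∨ Tables m A N (s + 1) ∧ A 5 q = 0 ∧ A 6 q = 0

/-- Add the new state `N` as the child of `q` along the edge `v`. If this is the second child of
`q`, the children of `q` move to a table in slot `s`. -/
def attach (A : ℕ → ℕ → ℕ) (m N s q v : ℕ) : ℕ → ℕ → ℕ :=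
  let B := set2 (set2 (set2 A 0 N q) 1 N v) 4 N (A 4 q + 1)
  if A 6 q = 0 then
    if A 5 q = 0 then set2 B 5 q N
    else set2 (set2 (set2 B 6 q (s * (m + 1) + 1)) 7 (s * (m + 1) + 1 + A 1 (A 5 q)) (A 5 q))
      7 (s * (m + 1) + 1 + v) N
  else set2 B 7 (A 6 q + v) N

theorem slot_inj {m r r' v v' : ℕ} (hv : v ≤ m) (hv' : v' ≤ m)
    (h : r * (m + 1) + 1 + v = r' * (m + 1) + 1 + v') : r = r' ∧ v = v' := by
  rcases lt_trichotomy r r' with hlt | rfl | hlt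
  · have := Nat.mul_le_mul_right (m + 1) (Nat.succ_le_of_lt hlt)
    rw [Nat.succ_mul] at this
    omega
  · exact ⟨rfl, by omega⟩
  · have := Nat.mul_le_mul_right (m + 1) (Nat.succ_le_of_lt hlt)
    rw [Nat.succ_mul] at this
    omega

section trie
variable {m N s q v : ℕ} {A : ℕ → ℕ → ℕ} {node : ℕ → List ℕ}

theorem Tables.mono (h : Tables m A N s) : Tables m A N (s + 1) :=
  { h with
    form := fun q hq => by
      obtain ⟨r, hr, e⟩ := h.form q hq
      exact ⟨r, by omega, e⟩
    zero := fun r hr => h.zero r (by omega) }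

theorem Avail.tables (h : Avail m A N s q) : Tables m A N (s + 1) := h.elim Tables.mono And.left

theorem look_eq_zero (h5 : A 5 q = 0) (h6 : A 6 q = 0) (v : ℕ) : look A q v = 0 := by
  simp [look, h5, h6]

theorem Avail.look (h : Avail m A N s q) (hk : look A q v ≠ 0) :
    Avail m A N s (SwapCT.look A q v) :=
  h.elim Or.inl fun h => absurd (look_eq_zero h.2.1 h.2.2 v) hk

theorem attach_zero (k : ℕ) : attach A m N s q v 0 k = if k = N then q else A 0 k := by
  unfold attach; split_ifs <;> simp [set2_apply, *]

theorem attach_one (k : ℕ) : attach A m N s q v 1 k = if k = N then v else A 1 k := by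
  unfold attach; split_ifs <;> simp [set2_apply, *]

theorem attach_four (k : ℕ) : attach A m N s q v 4 k = if k = N then A 4 q + 1 else A 4 k := by
  unfold attach; split_ifs <;> simp [set2_apply, *]

theorem attach_five (k : ℕ) :
    attach A m N s q v 5 k = if A 6 q = 0 ∧ A 5 q = 0 ∧ k = q then N else A 5 k := by
  unfold attach; split_ifs <;> simp_all [set2_apply]

theorem attach_six (k : ℕ) : attach A m N s q v 6 k =
    if A 6 q = 0 ∧ A 5 q ≠ 0 ∧ k = q then s * (m + 1) + 1 else A 6 k := by
  unfold attach; split_ifs <;> simp_all [set2_apply]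

theorem attach_seven (k : ℕ) : attach A m N s q v 7 k =
    if A 6 q = 0 then
      if A 5 q = 0 then A 7 k
      else if k = s * (m + 1) + 1 + v then N
      else if k = s * (m + 1) + 1 + A 1 (A 5 q) then A 5 q else A 7 k
    else if k = A 6 q + v then N else A 7 k := by
  unfold attach; split_ifs <;> simp_all [set2_apply]

theorem attach_other {a : ℕ} (h : a = 2 ∨ a = 3 ∨ 8 ≤ a) : attach A m N s q v a = A a := by
  have : a ≠ 0 ∧ a ≠ 1 ∧ a ≠ 4 ∧ a ≠ 5 ∧ a ≠ 6 ∧ a ≠ 7 := by omega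
  funext k
  unfold attach; split_ifs <;> simp [set2_apply, this]

/-- Adding a state changes the answer of `look` for its own edge only, also if the children of `q`
move to a table. -/
theorem look_attach (hav : Avail m A N s q) (hq : q < N) (hv : v ≤ m) (hl : look A q v = 0)
    {q' v' : ℕ} (hv' : v' ≤ m) :
    look (attach A m N s q v) q' v' = if q' = q ∧ v' = v then N else look A q' v' := by
  have ht := hav.tables
  have hN : ∀ q', A 5 q' ≠ N := fun q' => (ht.only_lt q').ne
  by_cases h6 : A 6 q = 0
  · by_cases h5 : A 5 q = 0
    · by_cases hqq : q' = q
      · subst hqq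
        simp only [look, attach_six, attach_five, attach_one, attach_seven, h5, h6]
        by_cases hvv : v' = v
        · simp [hvv]
        · simp [hvv, Ne.symm hvv]
      · simp [look, attach_six, attach_five, attach_one, attach_seven, h5, h6, hqq, hN]
    · have ht' : Tables m A N s := hav.resolve_right fun h => h5 h.2.1
      have hc := ht'.only_lab q h5
      have hcv : A 1 (A 5 q) ≠ v := fun he => by
        simp [look, h6, he] at hl
        exact h5 hl
      by_cases hqq : q' = q
      · subst hqq
        have l6 : attach A m N s q' v 6 q' = s * (m + 1) + 1 := by
          rw [attach_six, if_pos ⟨h6, h5, rfl⟩]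
        rw [look, l6, if_pos (by omega), attach_seven, if_pos h6, if_neg h5]
        by_cases hvv : v' = v
        · rw [if_pos (by omega), if_pos ⟨rfl, hvv⟩]
        · rw [if_neg (by omega), if_neg (show ¬(q' = q' ∧ v' = v) from fun h => hvv h.2), look,
            if_neg (not_not.2 h6)]
          by_cases hvc : A 1 (A 5 q') = v'
          · rw [if_pos (by omega), if_pos hvc]
          · rw [if_neg (by omega), if_neg hvc, ht'.zero s le_rfl v' hv']
      · by_cases h6' : A 6 q' = 0
        · simp [look, attach_six, attach_five, attach_one, h5, h6, hqq, hN, h6']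
        · obtain ⟨r, hr, e⟩ := ht'.form q' h6'
          have n1 : A 6 q' + v' ≠ s * (m + 1) + 1 + v := fun h => by
            have := slot_inj hv' hv (e ▸ h); omega
          have n2 : A 6 q' + v' ≠ s * (m + 1) + 1 + A 1 (A 5 q) := fun h => by
            have := slot_inj hv' hc (e ▸ h); omega
          simp [look, attach_six, attach_seven, h5, h6, hqq, h6', n1, n2]
  · by_cases hqq : q' = q
    · subst hqq
      simp [look, attach_six, attach_seven, h6]
    · by_cases h6' : A 6 q' = 0
      · simp [look, attach_six, attach_five, attach_one, h6, hqq, hN, h6']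
      · obtain ⟨r, hr, e⟩ := ht.form q h6
        obtain ⟨r', hr', e'⟩ := ht.form q' h6'
        have n1 : A 6 q' + v' ≠ A 6 q + v := fun h => by
          rw [e, e'] at h
          have h1 := (slot_inj hv' hv h).1
          exact hqq (ht.inj q' q h6' (by rw [e, e', h1]))
        simp [look, attach_six, attach_seven, h6, hqq, h6', n1]

theorem tables_attach (hav : Avail m A N s q) (hq : q < N) (hv : v ≤ m) :
    Tables m (attach A m N s q v) (N + 1) (s + 1) := by
  have ht := hav.tables
  refine ⟨fun k hk => ?_, fun k => ?_, fun k hk => ?_, fun k hk => ?_, fun k k' hk hkk => ?_,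
    fun r hr w hw => ?_⟩
  · rw [attach_five, attach_six, if_neg (by omega), if_neg (by omega)]
    exact ht.fresh k (by omega)
  · rw [attach_five]
    have := ht.only_lt k
    split_ifs <;> omega
  · rw [attach_five] at hk ⊢
    rw [attach_one]
    split_ifs at hk ⊢ with h1 h2 h3
    · exact hv
    · exact absurd rfl h2
    · exact hv
    · exact ht.only_lab k hk
  · rw [attach_six] at hk ⊢
    split_ifs at hk ⊢ with h1
    · exact ⟨s, by omega, rfl⟩
    · exact ht.form k hk
  · rw [attach_six, attach_six] at hkk
    rw [attach_six] at hk
    have key : ∀ j, A 6 q = 0 → A 5 q ≠ 0 → A 6 j ≠ s * (m + 1) + 1 := fun j h6 h5 he => by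
      have ht' : Tables m A N s := hav.resolve_right fun h => h5 h.2.1
      obtain ⟨r, hr, e⟩ := ht'.form j (by omega)
      have := slot_inj (m := m) (Nat.zero_le _) (Nat.zero_le _)
        (show r * (m + 1) + 1 + 0 = s * (m + 1) + 1 + 0 by omega)
      omega
    split_ifs at hk hkk with h1 h2 h3
    · rw [h1.2.2, h2.2.2]
    · exact absurd hkk.symm (key k' h1.1 h1.2.1)
    · exact absurd hkk (key k h3.1 h3.2.1)
    · exact ht.inj k k' hk hkk
  · have hz := ht.zero r hr w hw
    rw [attach_seven]
    have hne : ∀ u ≤ m, r * (m + 1) + 1 + w ≠ s * (m + 1) + 1 + u := fun u hu h => by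
      have := slot_inj hw hu h
      omega
    split_ifs with h6 h5 h1 h2 h3
    · exact hz
    · exact absurd h1 (hne v hv)
    · exact absurd h2 (hne _ (ht.only_lab q h5))
    · exact hz
    · obtain ⟨r', hr', e⟩ := ht.form q h6
      rw [e] at h3
      have := slot_inj hw hv h3
      omega
    · exact hz

/-- After a state has been added, slot `s` counts as available for the new state, which has no
children: the insertion of the rest of the word needs no further slot. -/
theorem avail_attach (hav : Avail m A N s q) (hq : q < N) (hv : v ≤ m) :
    Avail m (attach A m N s q v) (N + 1) s N := by
  refine Or.inr ⟨tables_attach hav hq hv, ?_, ?_⟩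
  · rw [attach_five, if_neg (by omega)]; exact (hav.tables.fresh N le_rfl).1
  · rw [attach_six, if_neg (by omega)]; exact (hav.tables.fresh N le_rfl).2

theorem TrieCore.attach (h : TrieCore m A N node) (hav : Avail m A N s q) (hq : q < N)
    (hv : v ≤ m) (hl : look A q v = 0) :
    TrieCore m (attach A m N s q v) (N + 1) (Function.update node N (node q ++ [v])) := by
  have hpos := h.pos
  have hla := fun q' v' => look_attach hav hq hv hl (q' := q') (v' := v')
  refine ⟨by omega, ?_, fun k h0 hk => ?_, fun k h0 hk => ?_, fun k h0 hk => ?_,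
    fun k h0 hk => ?_, fun k hk w hw => ?_, fun k hk => ?_⟩
  · rw [Function.update_of_ne hpos.ne]; exact h.root
  · rw [attach_zero]
    split_ifs with h1
    · omega
    · exact h.par_lt k h0 (by omega)
  · rw [attach_zero, attach_one]
    split_ifs with h1
    · subst h1
      rw [Function.update_self, Function.update_of_ne hq.ne]
    · have := h.par_lt k h0 (by omega)
      rw [Function.update_of_ne h1, Function.update_of_ne (by omega)]
      exact h.node_eq k h0 (by omega)
  · rw [attach_one]
    split_ifs with h1
    · exact hv
    · exact h.lab_le k h0 (by omega)
  · rw [attach_zero, attach_one]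
    split_ifs with h1
    · rw [hla _ _ hv, if_pos ⟨rfl, rfl⟩, h1]
    · have h2 := h.look_par k h0 (by omega)
      rw [hla _ _ (h.lab_le k h0 (by omega)), if_neg, h2]
      rintro ⟨h3, h4⟩
      rw [h3, h4] at h2
      omega
  · rw [hla _ _ hw]
    split_ifs with h1
    · intro _
      rw [attach_zero, attach_one, if_pos rfl, if_pos rfl]
      exact ⟨by omega, h1.1.symm, h1.2.symm⟩
    · intro h2
      rcases Nat.lt_succ_iff_lt_or_eq.1 hk with h3 | h3
      · have := h.look_sound k h3 w hw h2
        rw [attach_zero, attach_one, if_neg (by omega), if_neg (by omega)]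
        exact ⟨by omega, this.2⟩
      · subst h3
        have := hav.tables.fresh k le_rfl
        exact absurd (look_eq_zero this.1 this.2 w) h2
  · rw [attach_four]
    split_ifs with h1
    · subst h1
      rw [Function.update_self, h.dep q hq]; simp
    · rw [Function.update_of_ne h1]
      exact h.dep k (by omega)

/-- Different states spell different words, as the edges to the children of a state have different
labels. -/
theorem TrieCore.inj (h : TrieCore m A N node) : Set.InjOn node (Set.Iio N) := by
  have key : ∀ n k k', k < N → k' < N → (node k).length = n → node k = node k' → k = k' := by
    intro n
    induction n with
    | zero =>
      intro k k' hk hk' hn he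
      have hz : ∀ k, k < N → (node k).length = 0 → k = 0 := fun k hk hn => by
        by_contra h0
        rw [h.node_eq k (by omega) hk] at hn
        simp at hn
      rw [hz k hk hn, hz k' hk' (he ▸ hn)]
    | succ n ih =>
      intro k k' hk hk' hn he
      have hz : ∀ k, (node k).length = n + 1 → 0 < k := fun k hn => by
        by_contra h0
        rw [show k = 0 by omega, h.root] at hn
        simp at hn
      have h1 := hz k hn
      have h2 := hz k' (he ▸ hn)
      have hp := h.par_lt k h1 hk
      have hp' := h.par_lt k' h2 hk'
      rw [h.node_eq k h1 hk] at hn he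
      rw [h.node_eq k' h2 hk'] at he
      obtain ⟨e1, e2⟩ := List.append_inj' he rfl
      have e3 := ih _ _ (hp.trans hk) (hp'.trans hk') (by simpa using hn) e1
      rw [← h.look_par k h1 hk, ← h.look_par k' h2 hk', e3, List.singleton_injective e2]
  exact fun k hk k' hk' he => key _ k k' hk hk' rfl he

theorem TrieCore.node_look (h : TrieCore m A N node) (hq : q < N) (hv : v ≤ m)
    (hl : look A q v ≠ 0) : look A q v < N ∧ node (look A q v) = node q ++ [v] := by
  obtain ⟨h1, h2, h3⟩ := h.look_sound q hq v hv hl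
  refine ⟨h1, ?_⟩
  rw [h.node_eq _ (by omega) h1, h2, h3]

theorem TrieCore.look_eq (h : TrieCore m A N node) {k : ℕ} (hq : q < N) (hk : k < N)
    (he : node k = node q ++ [v]) : look A q v = k := by
  have h0 : 0 < k := by
    by_contra h0
    rw [show k = 0 by omega, h.root] at he
    simp at he
  have hp := h.par_lt k h0 hk
  rw [h.node_eq k h0 hk] at he
  obtain ⟨e1, e2⟩ := List.append_inj' he rfl
  have e3 := h.inj (hp.trans hk) hq e1
  rw [← h.look_par k h0 hk, e3, List.singleton_injective e2]

end trie

/-! ### Reasoning about programs -/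

/-- The program does not assign register `x`. -/
def Cmd.keeps (x : ℕ) : Cmd → Bool
  | .prim (.const y _) | .prim (.copy y _) | .prim (.arith _ y _ _) | .prim (.load y _)
  | .prim (.patLen y) | .prim (.textLen y) => y != x
  | .prim (.store _ _) | .prim (.emit _) => true
  | .seq a b | .ite _ a b => a.keeps x && b.keeps x
  | .loop _ a => a.keeps x

/-- The program does not write to the memory. -/
def Cmd.noStore : Cmd → Bool
  | .prim (.store _ _) => false
  | .prim _ => true
  | .seq a b | .ite _ a b => a.noStore && b.noStore
  | .loop _ a => a.noStore

/-- The program writes no output. -/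
def Cmd.noEmit : Cmd → Bool
  | .prim (.emit _) => false
  | .prim _ => true
  | .seq a b | .ite _ a b => a.noEmit && b.noEmit
  | .loop _ a => a.noEmit

/-- What can be read off the text of the program `c` about a run from `s` to `r`. -/
structure Frame (c : Cmd) (s r : Store) : Prop where
  reg : ∀ x, c.keeps x = true → r.reg x = s.reg x
  mem : c.noStore = true → r.mem = s.mem
  out : c.noEmit = true → r.out = s.out

theorem Frame.refl (c : Cmd) (s : Store) : Frame c s s := ⟨fun _ _ => rfl, fun _ => rfl,
    fun _ => rfl⟩

theorem Frame.trans {c : Cmd} {s r u : Store} (h : Frame c s r) (h' : Frame c r u) : Frame c s u :=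
  ⟨fun x hx => (h'.reg x hx).trans (h.reg x hx), fun hx => (h'.mem hx).trans (h.mem hx),
    fun hx => (h'.out hx).trans (h.out hx)⟩

theorem Frame.of_loop {c : Test} {a : Cmd} {s r : Store} (h : Frame a s r) :
    Frame (.loop c a) s r := ⟨h.reg, h.mem, h.out⟩

theorem setReg_eq_some {E : Env} {s s' : Store} {x v : ℕ} :
    s.setReg E x v = some s' ↔ v < E.word ∧ { s with reg := Function.update s.reg x v } = s' := by
  unfold Store.setReg
  split_ifs with h <;> simp [h]

theorem Frame.of_setReg {E : Env} {c : Cmd} {s s' : Store} {x v : ℕ} (h : s.setReg E x v = some s')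
    (hc : ∀ y, c.keeps y = true → x ≠ y) : Frame c s s' := by
  obtain ⟨-, rfl⟩ := setReg_eq_some.1 h
  exact ⟨fun y hy => Function.update_of_ne (hc y hy).symm _ _, fun _ => rfl, fun _ => rfl⟩

theorem Exec.frame {E : Env} {c : Cmd} {s s' : Store} {T : ℕ} (h : Exec E c s T s') :
    Frame c s s' := by
  induction h with
  | @prim i s s' h =>
    cases i with
    | store x y =>
      simp only [Instr.eval] at h
      split_ifs at h
      rw [Option.some.injEq] at h
      subst h
      exact ⟨fun _ _ => rfl, fun h => by simp [Cmd.noStore] at h, fun _ => rfl⟩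
    | emit x =>
      simp only [Instr.eval, Option.some.injEq] at h
      subst h
      exact ⟨fun _ _ => rfl, fun _ => rfl, fun h => by simp [Cmd.noEmit] at h⟩
    | load x y =>
      simp only [Instr.eval] at h
      split_ifs at h
      exact Frame.of_setReg h fun y hy => by simpa [Cmd.keeps] using hy
    | _ => exact Frame.of_setReg h fun y hy => by simpa [Cmd.keeps] using hy
  | seq _ _ iha ihb =>
    exact ⟨fun x hx => by
        simp only [Cmd.keeps, Bool.and_eq_true] at hx
        exact (ihb.reg x hx.2).trans (iha.reg x hx.1),
      fun hx => by
        simp only [Cmd.noStore, Bool.and_eq_true] at hx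
        exact (ihb.mem hx.2).trans (iha.mem hx.1),
      fun hx => by
        simp only [Cmd.noEmit, Bool.and_eq_true] at hx
        exact (ihb.out hx.2).trans (iha.out hx.1)⟩
  | iteTrue _ _ ih =>
    exact ⟨fun x hx => by
        simp only [Cmd.keeps, Bool.and_eq_true] at hx
        exact ih.reg x hx.1,
      fun hx => by
        simp only [Cmd.noStore, Bool.and_eq_true] at hx
        exact ih.mem hx.1,
      fun hx => by
        simp only [Cmd.noEmit, Bool.and_eq_true] at hx
        exact ih.out hx.1⟩
  | iteFalse _ _ ih =>
    exact ⟨fun x hx => by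
        simp only [Cmd.keeps, Bool.and_eq_true] at hx
        exact ih.reg x hx.2,
      fun hx => by
        simp only [Cmd.noStore, Bool.and_eq_true] at hx
        exact ih.mem hx.2,
      fun hx => by
        simp only [Cmd.noEmit, Bool.and_eq_true] at hx
        exact ih.out hx.2⟩
  | loopFalse _ => exact Frame.refl _ _
  | loopTrue _ _ _ iha ihl => exact (Frame.of_loop iha).trans ihl

/-- Registers and memory cells hold words. -/
def Bdd (E : Env) (s : Store) : Prop := (∀ x, s.reg x < E.word) ∧ ∀ a, s.mem a < E.word

theorem Bdd.setReg {E : Env} {s s' : Store} {x v : ℕ} (hs : Bdd E s)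
    (h : s.setReg E x v = some s') : Bdd E s' := by
  obtain ⟨hv, rfl⟩ := setReg_eq_some.1 h
  refine ⟨fun y => ?_, hs.2⟩
  by_cases hy : y = x
  · subst hy; simpa using hv
  · simpa [hy] using hs.1 y

theorem Exec.bdd {E : Env} {c : Cmd} {s s' : Store} {T : ℕ} (h : Exec E c s T s') (hs : Bdd E s) :
    Bdd E s' := by
  induction h with
  | @prim i s s' h =>
    cases i with
    | store x y =>
      simp only [Instr.eval] at h
      split_ifs at h
      rw [Option.some.injEq] at h
      subst h
      refine ⟨hs.1, fun a => ?_⟩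
      by_cases ha : a = s.reg x
      · subst ha; simpa using hs.1 y
      · simpa [ha] using hs.2 a
    | emit x =>
      simp only [Instr.eval, Option.some.injEq] at h
      subst h
      exact hs
    | load x y =>
      simp only [Instr.eval] at h
      split_ifs at h
      exact hs.setReg h
    | _ => exact hs.setReg h
  | seq _ _ iha ihb => exact ihb (iha hs)
  | iteTrue _ _ ih => exact ih hs
  | iteFalse _ _ ih => exact ih hs
  | loopFalse _ => exact hs
  | loopTrue _ _ _ iha ihl => exact ihl (iha hs)

/-- The setting of a run for a pattern of length `m` and a text of length `n`: the memory has room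
for eleven arrays of length `K = 5m²`, and the words are large enough for all numbers that occur.
The length `5m²` is enough for the at most `1 + 3m²` states and for `3m` tables of `m + 1`
children. -/
structure Ctx where
  E : Env
  K : ℕ
  m : ℕ
  n : ℕ
  two_le : 2 ≤ m
  K_eq : K = 5 * (m * m)
  pat_len : E.pat.length = m
  text_len : E.text.length = n
  space : 12 * K ≤ E.space
  word : 12 * K + n + 100 ≤ E.word

theorem Ctx.le_K (X : Ctx) : 10 * X.m ≤ X.K := by
  rw [X.K_eq]
  have := Nat.mul_le_mul_right X.m X.two_le
  omega

/-- The address of cell `i` of array `a`. The arrays `0` to `3` are interleaved at the bottom of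
the memory, the others above them. -/
def addr (K a i : ℕ) : ℕ := if a < 4 then 4 * i + a else 4 * K + 8 * i + (a - 4)

/-- The arrays held in the memory. -/
def arr (K : ℕ) (mem : ℕ → ℕ) (a i : ℕ) : ℕ := if a < 11 ∧ i < K then mem (addr K a i) else 0

theorem addr_lt {K a i : ℕ} (ha : a < 11) (hi : i < K) : addr K a i < 12 * K := by
  unfold addr; split_ifs <;> omega

theorem arr_update {K a i : ℕ} (ha : a < 11) (hi : i < K) (mem : ℕ → ℕ) (v : ℕ) :
    arr K (Function.update mem (addr K a i) v) = set2 (arr K mem) a i v := by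
  funext b j
  rw [set2_apply]
  unfold arr
  by_cases h : b = a ∧ j = i
  · rw [if_pos h, h.1, h.2, if_pos ⟨ha, hi⟩, Function.update_self]
  · rw [if_neg h]
    split_ifs with h1
    · rw [Function.update_of_ne]
      unfold addr
      split_ifs <;> omega
    · rfl

/-- The store satisfies the conventions of all parts of the program but the first: the registers
from `90` on hold constants. -/
structure Inv (X : Ctx) (s : Store) : Prop where
  bdd : Bdd X.E s
  rM : s.reg 90 = X.m
  rN : s.reg 91 = X.n
  r1 : s.reg 92 = 1
  r0 : s.reg 93 = 0
  r4 : s.reg 94 = 4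
  r8 : s.reg 95 = 8
  base : ∀ a < 11, s.reg (96 + a) = if a < 4 then a else 4 * X.K + (a - 4)
  rW : s.reg 107 = 3 * X.m

theorem Inv.of_eq {X : Ctx} {s r : Store} (h : Inv X s) (hb : Bdd X.E r)
    (he : ∀ x, 90 ≤ x → r.reg x = s.reg x) : Inv X r :=
  ⟨hb, (he _ (by omega)).trans h.rM, (he _ (by omega)).trans h.rN, (he _ (by omega)).trans h.r1,
    (he _ (by omega)).trans h.r0, (he _ (by omega)).trans h.r4, (he _ (by omega)).trans h.r8,
    fun a ha => (he _ (by omega)).trans (h.base a ha), (he _ (by omega)).trans h.rW⟩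

theorem Inv.arr_lt {X : Ctx} {s : Store} (h : Inv X s) (a i : ℕ) :
    arr X.K s.mem a i < X.E.word := by
  unfold arr
  split_ifs
  · exact h.bdd.2 _
  · have := X.word; omega

/-- Assign the value `v` to register `x`. -/
def Store.set (s : Store) (x v : ℕ) : Store := { s with reg := Function.update s.reg x v }

/-- Store the value `v` in cell `i` of array `a`. -/
def Store.put (s : Store) (K a i v : ℕ) : Store :=
  { s with mem := Function.update s.mem (addr K a i) v }

theorem set_reg (s : Store) (x v y : ℕ) : (s.set x v).reg y = if y = x then v else s.reg y := by
  simp [Store.set, Function.update_apply]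

theorem set_mem (s : Store) (x v : ℕ) : (s.set x v).mem = s.mem := rfl
theorem set_out (s : Store) (x v : ℕ) : (s.set x v).out = s.out := rfl
theorem put_reg (s : Store) (K a i v : ℕ) : (s.put K a i v).reg = s.reg := rfl

theorem put_arr {K a i : ℕ} (ha : a < 11) (hi : i < K) (s : Store) (v : ℕ) :
    arr K (s.put K a i v).mem = set2 (arr K s.mem) a i v := arr_update ha hi _ _

/-- Started in `s`, the program `c` halts after a number `T` of steps in a store `s'` such that
`Q T s'`; the constants in the registers are kept. -/
def wp (X : Ctx) (c : Cmd) (s : Store) (Q : ℕ → Store → Prop) : Prop :=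
  Inv X s → ∃ T s', Exec X.E c s T s' ∧ Inv X s' ∧ Q T s'

section rules
variable {X : Ctx} {s : Store} {Q Q' : ℕ → Store → Prop} {a b c : Cmd}

theorem wp.mono (h : wp X c s Q) (hq : ∀ T r, Inv X r → Frame c s r → Q T r → Q' T r) :
    wp X c s Q' := fun hs => by
  obtain ⟨T, r, h1, h2, h3⟩ := h hs
  exact ⟨T, r, h1, h2, hq T r h2 h1.frame h3⟩

theorem wp_seq (h : wp X a s (fun T r => wp X b r (fun U u => Q (T + U) u))) :
    wp X (.seq a b) s Q := fun hs => by
  obtain ⟨T, r, h1, h2, h3⟩ := h hs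
  obtain ⟨U, u, h4, h5, h6⟩ := h3 h2
  exact ⟨T + U, u, .seq h1 h4, h5, h6⟩

theorem wp_set {i : Instr} {x v : ℕ} (hi : i.eval X.E s = s.setReg X.E x v) (hx : x < 90)
    (hv : v < X.E.word) (hQ : Q 1 (s.set x v)) : wp X (.prim i) s Q := fun hs => by
  have he : i.eval X.E s = some (s.set x v) := by
    rw [hi, setReg_eq_some]; exact ⟨hv, rfl⟩
  have hx : Exec X.E (.prim i) s 1 (s.set x v) := .prim he
  refine ⟨1, _, hx, hs.of_eq (hx.bdd hs.bdd) fun y hy => ?_, hQ⟩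
  rw [set_reg, if_neg (by omega)]

theorem wp_const {x v : ℕ} (hv : v < X.E.word) (hQ : Q 1 (s.set x v))
    (hx : x < 90 := by decide) : wp X (.prim (.const x v)) s Q := wp_set rfl hx hv hQ

theorem wp_copy {x y : ℕ} (hQ : Inv X s → Q 1 (s.set x (s.reg y))) (hx : x < 90 := by decide) :
    wp X (.prim (.copy x y)) s Q := fun hs => wp_set rfl hx (hs.bdd.1 y) (hQ hs) hs

theorem wp_add {x y z : ℕ} (hv : s.reg y + s.reg z < X.E.word)
    (hQ : Q 1 (s.set x (s.reg y + s.reg z))) (hx : x < 90 := by decide) :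
    wp X (.prim (.arith .add x y z)) s Q := wp_set rfl hx hv hQ

theorem wp_mul {x y z : ℕ} (hv : s.reg y * s.reg z < X.E.word)
    (hQ : Q 1 (s.set x (s.reg y * s.reg z))) (hx : x < 90 := by decide) :
    wp X (.prim (.arith .mul x y z)) s Q := wp_set rfl hx hv hQ

theorem wp_sub {x y z : ℕ} (hQ : Q 1 (s.set x (s.reg y - s.reg z))) (hx : x < 90 := by decide) :
    wp X (.prim (.arith .sub x y z)) s Q := fun hs =>
  wp_set rfl hx ((Nat.sub_le _ _).trans_lt (hs.bdd.1 y)) hQ hs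

theorem wp_div {x y z : ℕ} (hQ : Q 1 (s.set x (s.reg y / s.reg z))) (hx : x < 90 := by decide) :
    wp X (.prim (.arith .div x y z)) s Q := fun hs =>
  wp_set rfl hx ((Nat.div_le_self _ _).trans_lt (hs.bdd.1 y)) hQ hs

theorem wp_emit {x : ℕ} (hQ : Q 1 { s with out := s.out ++ [s.reg x] }) :
    wp X (.prim (.emit x)) s Q := fun hs =>
  ⟨1, _, .prim rfl, hs.of_eq hs.bdd fun _ _ => rfl, hQ⟩

theorem wp_ite_lt {x y : ℕ} (ha : s.reg x < s.reg y → wp X a s (fun T => Q (1 + T)))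
    (hb : s.reg y ≤ s.reg x → wp X b s (fun T => Q (1 + T))) :
    wp X (.ite (.lt x y) a b) s Q := fun hs => by
  by_cases h : s.reg x < s.reg y
  · obtain ⟨T, r, h1, h2, h3⟩ := ha h hs
    exact ⟨_, r, .iteTrue (by simp [Test.eval, h]) h1, h2, h3⟩
  · obtain ⟨T, r, h1, h2, h3⟩ := hb (not_lt.1 h) hs
    exact ⟨_, r, .iteFalse (by simp [Test.eval, h]) h1, h2, h3⟩

theorem wp_ite_eq {x y : ℕ} (ha : s.reg x = s.reg y → wp X a s (fun T => Q (1 + T)))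
    (hb : s.reg x ≠ s.reg y → wp X b s (fun T => Q (1 + T))) :
    wp X (.ite (.eq x y) a b) s Q := fun hs => by
  by_cases h : s.reg x = s.reg y
  · obtain ⟨T, r, h1, h2, h3⟩ := ha h hs
    exact ⟨_, r, .iteTrue (by simp [Test.eval, h]) h1, h2, h3⟩
  · obtain ⟨T, r, h1, h2, h3⟩ := hb h hs
    exact ⟨_, r, .iteFalse (by simp [Test.eval, h]) h1, h2, h3⟩

/-- A test that compares the elements of the sequence `l` at two positions. -/
theorem wp_ite_cmp {t : Test} {l : List ℤ} {i j : ℕ} (ht : t.eval X.E s = cmpAt l i j)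
    (hi : i < l.length) (hj : j < l.length)
    (ha : vals l i < vals l j → wp X a s (fun T => Q (1 + T)))
    (hb : vals l j ≤ vals l i → wp X b s (fun T => Q (1 + T))) :
    wp X (.ite t a b) s Q := fun hs => by
  have he : t.eval X.E s = some (decide (vals l i < vals l j)) := by
    rw [ht]
    simp [cmpAt, vals, hi, hj]
  by_cases h : vals l i < vals l j
  · obtain ⟨T, r, h1, h2, h3⟩ := ha h hs
    exact ⟨_, r, .iteTrue (by rw [he, decide_eq_true h]) h1, h2, h3⟩
  · obtain ⟨T, r, h1, h2, h3⟩ := hb (not_lt.1 h) hs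
    exact ⟨_, r, .iteFalse (by rw [he, decide_eq_false h]) h1, h2, h3⟩

/-- The rule for loops: `I b r` states that the store `r` may occur at the head of the loop and that
at most `b` steps remain. -/
theorem wp_loop {t : Test} {R : Store → Prop} (I : ℕ → Store → Prop) {k : ℕ} (h0 : I k s)
    (step : ∀ k r, I k r → Inv X r → Frame a s r →
      (t.eval X.E r = some false ∧ 1 ≤ k ∧ R r) ∨
      (t.eval X.E r = some true ∧ wp X a r (fun T u => ∃ k', I k' u ∧ 1 + T + k' ≤ k))) :
    wp X (.loop t a) s (fun T r => T ≤ k ∧ R r) := by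
  have key : ∀ k r, I k r → Inv X r → Frame a s r →
      ∃ T u, Exec X.E (.loop t a) r T u ∧ Inv X u ∧ T ≤ k ∧ R u := by
    intro k
    induction k using Nat.strong_induction_on with
    | _ k ih =>
      intro r hI hr hf
      rcases step k r hI hr hf with ⟨h1, h2, h3⟩ | ⟨h1, h2⟩
      · exact ⟨1, r, .loopFalse h1, hr, h2, h3⟩
      · obtain ⟨T, u, h3, h4, k', h5, h6⟩ := h2 hr
        obtain ⟨U, w, h7, h8, h9, h10⟩ := ih k' (by omega) u h5 h4 (hf.trans h3.frame)
        exact ⟨_, w, .loopTrue h1 h3 h7, h8, by omega, h10⟩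
  exact fun hs => key k s h0 hs (Frame.refl _ _)

end rules

/-- Do nothing. -/
def skip : Cmd := .prim (.copy 0 0)

/-- `x := ` cell number `y` of array `a`. Register `0` is used for addresses. -/
def ld (a x y : ℕ) : Cmd :=
  .seq (.prim (.arith .mul 0 y (if a < 4 then 94 else 95)))
    (.seq (.prim (.arith .add 0 0 (96 + a))) (.prim (.load x 0)))

/-- Store `x` in cell number `y` of array `a`. -/
def st (a y x : ℕ) : Cmd :=
  .seq (.prim (.arith .mul 0 y (if a < 4 then 94 else 95)))
    (.seq (.prim (.arith .add 0 0 (96 + a))) (.prim (.store 0 x)))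

section macros
variable {X : Ctx} {s : Store} {Q : ℕ → Store → Prop}

theorem wp_skip (hQ : Q 1 (s.set 0 (s.reg 0))) : wp X skip s Q := wp_copy fun _ => hQ

theorem exec_addr {a y : ℕ} (hs : Inv X s) (ha : a < 11) (hy : s.reg y < X.K) :
    s.reg y * s.reg (if a < 4 then 94 else 95) < X.E.word ∧
    s.reg y * s.reg (if a < 4 then 94 else 95) + s.reg (96 + a) = addr X.K a (s.reg y) := by
  have := X.word
  unfold addr
  rw [hs.base a ha]
  split_ifs
  · rw [hs.r4]; omega
  · rw [hs.r8]; omega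

theorem wp_ld {a x y : ℕ} (hy : s.reg y < X.K)
    (hQ : Q 3 ((s.set 0 (addr X.K a (s.reg y))).set x (arr X.K s.mem a (s.reg y))))
    (ha : a < 11 := by decide) (hx : x < 90 := by decide) : wp X (ld a x y) s Q := fun hs => by
  obtain ⟨h1, h2⟩ := exec_addr hs ha hy
  have hal := addr_lt ha hy
  have hw := X.word
  have hsp := X.space
  refine wp_seq (wp_mul h1 (wp_seq (wp_add ?_ ?_))) hs
  · rw [set_reg, set_reg, if_pos (rfl : 0 = 0), if_neg (show ¬96 + a = 0 by omega), h2]; omega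
  · rw [set_reg, set_reg, if_pos (rfl : 0 = 0), if_neg (show ¬96 + a = 0 by omega), h2]
    refine wp_set (v := arr X.K s.mem a (s.reg y)) ?_ hx (hs.arr_lt _ _) ?_
    · simp only [Instr.eval, set_reg, if_pos, set_mem]
      rw [if_pos (by omega)]
      simp [arr, ha, hy]
    · convert hQ using 1
      simp [Store.set]

theorem wp_st {a x y : ℕ} (hy : s.reg y < X.K)
    (hQ : Q 3 ((s.set 0 (addr X.K a (s.reg y))).put X.K a (s.reg y) (s.reg x)))
    (ha : a < 11 := by decide) (hx : x ≠ 0 := by decide) : wp X (st a y x) s Q := fun hs => by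
  obtain ⟨h1, h2⟩ := exec_addr hs ha hy
  have hal := addr_lt ha hy
  have hw := X.word
  have hsp := X.space
  refine wp_seq (wp_mul h1 (wp_seq (wp_add ?_ ?_))) hs
  · rw [set_reg, set_reg, if_pos (rfl : 0 = 0), if_neg (show ¬96 + a = 0 by omega), h2]; omega
  · rw [set_reg, set_reg, if_pos (rfl : 0 = 0), if_neg (show ¬96 + a = 0 by omega), h2]
    intro hs'
    have he : Instr.eval X.E ((s.set 0 (s.reg y * s.reg (if a < 4 then 94 else 95))).set 0
        (addr X.K a (s.reg y))) (.store 0 x) =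
          some ((s.set 0 (addr X.K a (s.reg y))).put X.K a (s.reg y) (s.reg x)) := by
      simp only [Instr.eval, set_reg, if_pos, set_mem, if_neg hx]
      rw [if_pos (by omega)]
      simp [Store.set, Store.put]
    exact ⟨1, _, .prim he, hs'.of_eq ((Exec.prim he).bdd hs'.bdd) fun y hy => by
      simp [put_reg, set_reg, show y ≠ 0 by omega], hQ⟩

end macros

/-! ### Moves of the automaton as programs -/

infixr:60 " ;; " => Cmd.seq

/-- `x := c` -/
abbrev iConst (x c : ℕ) : Cmd := .prim (.const x c)
/-- `x := y` -/
abbrev iCopy (x y : ℕ) : Cmd := .prim (.copy x y)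
/-- `x := y + z` -/
abbrev iAdd (x y z : ℕ) : Cmd := .prim (.arith .add x y z)
/-- `x := y - z` -/
abbrev iSub (x y z : ℕ) : Cmd := .prim (.arith .sub x y z)
/-- `x := y * z` -/
abbrev iMul (x y z : ℕ) : Cmd := .prim (.arith .mul x y z)
/-- `x := y / z` -/
abbrev iDiv (x y z : ℕ) : Cmd := .prim (.arith .div x y z)

/-- Register `12` := the child of the state in register `10` along the edge in register `11`. -/
def child : Cmd :=
  ld 6 13 10 ;;
  .ite (.eq 13 93)
    (ld 5 12 10 ;; ld 1 13 12 ;; .ite (.eq 13 11) skip (iConst 12 0))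
    (iAdd 13 13 11 ;; ld 7 12 13)

theorem wp_child {X : Ctx} {s : Store} (h : Inv X s) (hq : s.reg 10 < X.K)
    (h5 : arr X.K s.mem 5 (s.reg 10) < X.K)
    (h7 : arr X.K s.mem 6 (s.reg 10) ≠ 0 → arr X.K s.mem 6 (s.reg 10) + s.reg 11 < X.K) :
    wp X child s (fun T r => T ≤ 12 ∧ r.reg 12 = look (arr X.K s.mem) (s.reg 10) (s.reg 11)) := by
  have hw := X.word
  unfold child
  refine wp_seq (wp_ld hq (wp_ite_eq (fun h1 => wp_seq (wp_ld ?_ (wp_seq (wp_ld ?_ (wp_ite_eq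
    (fun h2 => wp_skip ?_) fun h2 => wp_const ?_ ?_))))) fun h1 => wp_seq (wp_add ?_ (wp_ld ?_
        ?_))))
  all_goals simp [set_reg, set_mem, h.r0] at *
  all_goals try simp [look, *]
  all_goals omega

theorem Ctx.slot_lt (X : Ctx) {r v : ℕ} (hr : r < 3 * X.m) (hv : v ≤ X.m) :
    r * (X.m + 1) + 1 + v < X.K := by
  have h1 := Nat.mul_le_mul_right (X.m + 1) (show r + 1 ≤ 3 * X.m from hr)
  have h2 := Nat.mul_le_mul_right X.m X.two_le
  have h3 : 3 * X.m * (X.m + 1) = 3 * (X.m * X.m) + 3 * X.m := by ring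
  rw [Nat.succ_mul, h3] at h1
  have := X.K_eq
  omega

/-- The arrays `A` hold the trie of `D`, without the failure links. -/
structure HoldsTrie (X : Ctx) (A : ℕ → ℕ → ℕ) (N : ℕ) (node : ℕ → List ℕ) (D : Set (List ℕ)) :
    Prop where
  core : TrieCore X.m A N node
  tables : Tables X.m A N (3 * X.m)
  le_K : N ≤ X.K
  nodes : ∀ w, w ∈ trieNodes D ↔ ∃ k < N, node k = w
  len : ∀ k < N, (node k).length ≤ X.m

/-- The failure links of the states of depth at most `L` are correct. -/
def FailUpTo (A : ℕ → ℕ → ℕ) (N : ℕ) (node : ℕ → List ℕ) (D : Set (List ℕ)) (L : ℕ) : Prop :=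
  ∀ k, 0 < k → k < N → (node k).length ≤ L → A 2 k < N ∧ node (A 2 k) = failure D (node k)

section moves
variable {X : Ctx} {s : Store} {A : ℕ → ℕ → ℕ} {N : ℕ} {node : ℕ → List ℕ} {D : Set (List ℕ)}

theorem TrieCore.ne_nil {m k : ℕ} (h : TrieCore m A N node) (h0 : 0 < k) (hk : k < N) :
    node k ≠ [] := by
  rw [h.node_eq k h0 hk]; simp

theorem Tables.lt_K {s q v : ℕ} (h : Tables X.m A N s) (hs : s ≤ 3 * X.m) (hv : v ≤ X.m)
    (h6 : A 6 q ≠ 0) : A 6 q + v < X.K := by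
  obtain ⟨r, hr, e⟩ := h.form q h6
  rw [e]
  exact X.slot_lt (by omega) hv

theorem HoldsTrie.nil_mem (h : HoldsTrie X A N node D) : [] ∈ trieNodes D :=
  (h.nodes _).2 ⟨0, h.core.pos, h.core.root⟩

theorem HoldsTrie.look_cases (h : HoldsTrie X A N node D) {q v : ℕ} (hq : q < N) (hv : v ≤ X.m) :
    (look A q v = 0 ∧ node q ++ [v] ∉ trieNodes D) ∨
    (look A q v ≠ 0 ∧ node q ++ [v] ∈ trieNodes D ∧ look A q v < N ∧
      node (look A q v) = node q ++ [v]) := by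
  by_cases hl : look A q v = 0
  · refine Or.inl ⟨hl, fun hm => ?_⟩
    obtain ⟨k, hk, he⟩ := (h.nodes _).1 hm
    have := h.core.look_eq hq hk he
    rw [← this, hl, h.core.root] at he
    simp at he
  · obtain ⟨h1, h2⟩ := h.core.node_look hq hv hl
    exact Or.inr ⟨hl, (h.nodes _).2 ⟨_, h1, h2⟩, h1, h2⟩

/-- Register `11` := the label that the parent-distance in register `14` has as seen from the state
in register `10`. -/
def clipLabel : Cmd := ld 4 16 10 ;; iCopy 11 14 ;; .ite (.lt 16 14) (iConst 11 0) skip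

theorem wp_clipLabel (hq : s.reg 10 < X.K) :
    wp X clipLabel s (fun T r => T ≤ 6 ∧
      r.reg 11 = clip (arr X.K s.mem 4 (s.reg 10)) (s.reg 14)) := by
  have hw := X.word
  unfold clipLabel
  refine wp_seq (wp_ld hq (wp_seq (wp_copy fun _ => wp_ite_lt (fun h1 => wp_const ?_ ?_)
    fun h1 => wp_skip ?_)))
  all_goals simp [set_reg] at *
  · omega
  · simp [clip]; omega
  · simp [clip]; omega

/-- Move the state in register `10` on the parent-distance in register `14`. -/
def move : Cmd :=
  iConst 15 1 ;;
  .loop (.eq 15 92)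
    (clipLabel ;; child ;;
      .ite (.eq 12 93) (.ite (.eq 10 93) (iConst 15 0) (ld 2 10 10)) (iCopy 10 12 ;; iConst 15 0))

/-- Every failure link decreases the depth, which pays for it. -/
theorem wp_move (ht : HoldsTrie X (arr X.K s.mem) N node D) {L : ℕ}
    (hf : FailUpTo (arr X.K s.mem) N node D L) (hq : s.reg 10 < N)
    (hL : (node (s.reg 10)).length ≤ L) :
    wp X move s (fun T r => r.reg 10 < N ∧
      node (r.reg 10) = acStep D (node (s.reg 10)) (s.reg 14) ∧
      T + 40 * (node (r.reg 10)).length ≤ 40 * ((node (s.reg 10)).length + 2)) := by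
  have hw := X.word
  have hlen0 := length_acStep_le (D := D) (node (s.reg 10)) (s.reg 14)
  set w := acStep D (node (s.reg 10)) (s.reg 14) with hwdef
  unfold move
  -- each round takes at most `30` steps and, except for the last one, shortens the state
  refine wp_seq (wp_const (by omega) ((wp_loop (k := 30 * ((node (s.reg 10)).length + 2 - w.length)
      + 1)
    (R := fun r => r.reg 10 < N ∧ node (r.reg 10) = w)
    (fun k r => r.reg 10 < N ∧ (
      (r.reg 15 = 0 ∧ node (r.reg 10) = w ∧ k = 1) ∨
      (r.reg 15 = 1 ∧ acStep D (node (r.reg 10)) (s.reg 14) = w ∧ (node (r.reg 10)).length ≤ L ∧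
        k = 30 * ((node (r.reg 10)).length + 2 - w.length) + 1))) ?_ ?_).mono ?_))
  · simp [set_reg, hq, hL, hwdef]
  · rintro k r ⟨hrq, hI⟩ hr hfr
    have hmem : r.mem = s.mem := hfr.mem (by decide)
    have h14 : r.reg 14 = s.reg 14 := hfr.reg 14 (by decide)
    rw [← hmem] at ht hf
    rw [← h14] at hI
    rcases hI with ⟨h15, hN, rfl⟩ | ⟨h15, hac, hrL, rfl⟩
    · left
      exact ⟨by simp [Test.eval, h15, hr.r1], le_rfl, hrq, hN⟩
    · right
      refine ⟨by simp [Test.eval, h15, hr.r1], ?_⟩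
      have hlen := length_acStep_le (D := D) (node (r.reg 10)) (r.reg 14)
      rw [hac] at hlen
      have hdep := ht.core.dep _ hrq
      have hm := ht.len _ hrq
      have hcm := (clip_le (node (r.reg 10)).length (r.reg 14)).trans hm
      have hNK := ht.le_K
      have h5 := ht.tables.only_lt (r.reg 10)
      have h6 := fun h6 => ht.tables.lt_K (q := r.reg 10) le_rfl hcm h6
      have hlook := ht.look_cases hrq hcm
      have hpos := ht.core.pos
      refine wp_seq ((wp_clipLabel (by omega)).mono ?_)
      rintro T0 u hu hfu ⟨hT0, hu11⟩
      rw [hdep] at hu11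
      have hum : u.mem = r.mem := hfu.mem (by decide)
      have hu10 : u.reg 10 = r.reg 10 := hfu.reg 10 (by decide)
      have hu15 : u.reg 15 = 1 := (hfu.reg 15 (by decide)).trans h15
      refine wp_seq ((wp_child hu ?_ ?_ ?_).mono ?_)
      · omega
      · rw [hum, hu10]; omega
      · rw [hum, hu10, hu11]; exact h6
      rintro T1 v hv hfv ⟨hT1, hv12⟩
      have e10 : v.reg 10 = r.reg 10 := (hfv.reg 10 (by decide)).trans hu10
      have e15 : v.reg 15 = 1 := (hfv.reg 15 (by decide)).trans hu15
      have em : v.mem = r.mem := (hfv.mem (by decide)).trans hum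
      rw [hum, hu10, hu11] at hv12
      rw [acStep] at hac
      refine wp_ite_eq (fun h1 => ?_) fun h1 => ?_
      · rw [hv.r0, hv12] at h1
        have hno := (hlook.resolve_right fun h => h.1 h1).2
        rw [if_neg hno] at hac
        refine wp_ite_eq (fun h2 => wp_const (by omega) ?_) fun h2 => wp_ld (by omega) ?_
        · rw [hv.r0, e10] at h2
          rw [h2, ht.core.root, dif_pos rfl] at hac
          refine ⟨1, ?_⟩
          simp only [set_reg]
          refine ⟨?_, by omega⟩
          simp [e10, h2, ht.core.root, hac, hpos]
        · rw [hv.r0, e10] at h2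
          have hne := ht.core.ne_nil (Nat.pos_of_ne_zero h2) hrq
          rw [dif_neg hne] at hac
          obtain ⟨h3, h4⟩ := hf _ (Nat.pos_of_ne_zero h2) hrq hrL
          have h5 := failure_length_lt D _ hne
          have h6 := length_acStep_le (D := D) (failure D (node (r.reg 10))) (r.reg 14)
          rw [hac] at h6
          refine ⟨30 * ((failure D (node (r.reg 10))).length + 2 - w.length) + 1, ?_⟩
          simp only [set_reg]
          refine ⟨?_, by omega⟩
          simp [e10, em, e15, h3, h4, hac, ← h14]
          omega
      · rw [hv.r0, hv12] at h1
        obtain ⟨-, h2, h3, h4⟩ := hlook.resolve_left fun h => h1 h.1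
        rw [if_pos h2] at hac
        refine wp_seq (wp_copy fun _ => wp_const (by omega) ?_)
        refine ⟨1, ?_⟩
        simp only [set_reg]
        refine ⟨?_, by omega⟩
        simp [hv12, h3, h4, hac]
  · rintro T r hr hfr ⟨hT, h10, he⟩
    rw [he]
    exact ⟨h10, rfl, by omega⟩

end moves

/-! ### The search for the parent of a position -/

/-- The number of elements on the chain of parents that starts at position `c`, as a function of
`c + 1`. -/
def chainLength (f : ℕ → ℤ) : ℕ → ℕ
  | 0 => 0
  | c + 1 => chainLength f (prv f c) + 1
termination_by n => n
decreasing_by exact Nat.lt_succ_of_le (prv_le f c)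

theorem chainLength_succ (f : ℕ → ℤ) (c : ℕ) :
    chainLength f (c + 1) = chainLength f (prv f c) + 1 := by rw [chainLength]

/-- A candidate for the parent of `k` that is not smaller lies on a chain at least as long. -/
theorem prv_le_prv {f : ℕ → ℤ} {k c : ℕ} (h1 : prv f k ≤ c) (h2 : c < k) :
    prv f k ≤ prv f c :=
  le_prv h1 ((prv_spec f k).imp_right fun h => h.trans_le (le_of_prv_le h1 h2))

theorem chainLength_prv_le {f : ℕ → ℤ} {k : ℕ} :
    ∀ q, prv f k ≤ q → q ≤ k → chainLength f (prv f k) ≤ chainLength f q := by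
  intro q
  induction q using Nat.strong_induction_on with
  | _ q ih =>
    intro h1 h2
    rcases h1.lt_or_eq with h3 | h3
    · obtain ⟨c, rfl⟩ : ∃ c, q = c + 1 := ⟨q - 1, by omega⟩
      have h4 := prv_le f c
      have := ih (prv f c) (by omega) (prv_le_prv (by omega) h2) (by omega)
      rw [chainLength_succ]
      omega
    · rw [h3]

/-- The number `e` describes the parent of position `k` as far as it is at most `m` positions away;
a parent farther away may be replaced by any position between it and `k - m`. -/
def Near (f : ℕ → ℤ) (m k e : ℕ) : Prop := e ≤ k ∧ prv f k ≤ e ∧ (e = prv f k ∨ e + m ≤ k)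

theorem Near.clip_lab {f : ℕ → ℤ} {m k e d : ℕ} (h : Near f m k e) (hd : d ≤ m) :
    clip d (lab e k) = clip d (lab (prv f k) k) := by
  obtain ⟨h1, h2, h3 | h3⟩ := h
  · rw [h3]
  · unfold clip lab
    split_ifs <;> omega

/-- Register `2` := the parent of the position in register `1`, in the sense of `Near`; it is also
stored in the array `a`, which is used cyclically. The array holds the parents of the preceding `m`
positions, so that the search can follow the chain of parents. -/
def search (cmp : ℕ → ℕ → Test) (a : ℕ) : Cmd :=
  iCopy 2 1 ;; iConst 3 1 ;;
  .loop (.eq 3 92)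
    (iAdd 4 2 90 ;;
      .ite (.lt 1 4)
        (.ite (.lt 93 2)
          (iSub 4 2 92 ;;
            .ite (cmp 4 1) (iConst 3 0) (iDiv 5 4 90 ;; iMul 5 5 90 ;; iSub 4 4 5 ;; ld a 2 4))
          (iConst 3 0))
        (iConst 3 0)) ;;
  iDiv 5 1 90 ;; iMul 5 5 90 ;; iSub 5 1 5 ;; st a 5 2

theorem sub_div_mul (a b : ℕ) : a - a / b * b = a % b := by
  have := Nat.div_add_mod' a b
  omega

section search
variable {X : Ctx} {s : Store} {l : List ℤ} {cmp : ℕ → ℕ → Test} {a : ℕ}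

/-- The array `a` holds the parents of the `m` positions before `pos`. -/
def Ring (X : Ctx) (l : List ℤ) (A : ℕ → ℕ) (pos : ℕ) : Prop :=
  ∀ k < pos, pos ≤ k + X.m → Near (vals l) X.m k (A (k % X.m))

theorem Ring.succ {A : ℕ → ℕ → ℕ} {pos e : ℕ} (h : Ring X l (A a) pos)
    (he : Near (vals l) X.m pos e) : Ring X l (set2 A a (pos % X.m) e a) (pos + 1) := by
  intro k hk hkm
  rw [set2_apply]
  rcases Nat.lt_succ_iff_lt_or_eq.1 hk with h1 | h1
  · rw [if_neg]
    · exact h k h1 (by omega)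
    · rintro ⟨-, h2⟩
      have h3 := Nat.div_add_mod k X.m
      have h4 := Nat.div_add_mod pos X.m
      rw [h2] at h3
      rcases lt_trichotomy (k / X.m) (pos / X.m) with h5 | h5 | h5
      · have := Nat.mul_le_mul_left X.m (Nat.succ_le_of_lt h5)
        rw [Nat.mul_succ] at this
        omega
      · rw [h5] at h3; omega
      · have := Nat.mul_le_mul_left X.m h5.le
        omega
  · rw [h1, if_pos ⟨rfl, rfl⟩]; exact he

theorem wp_search (hcmp : ∀ r : Store, ∀ x y, (cmp x y).eval X.E r = cmpAt l (r.reg x) (r.reg y))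
    (ha : a < 11) (hl : l.length ≤ X.m + X.n) (hpos : s.reg 1 < l.length)
    (hring : Ring X l (arr X.K s.mem a) (s.reg 1)) :
    wp X (search cmp a) s (fun T r => Near (vals l) X.m (s.reg 1) (r.reg 2) ∧
      arr X.K r.mem = set2 (arr X.K s.mem) a (s.reg 1 % X.m) (r.reg 2) ∧
      T + 40 * chainLength (vals l) (s.reg 1 + 1) ≤
        40 * (chainLength (vals l) (s.reg 1) + 2)) := by
  have hw := X.word
  have hmK := X.le_K
  have hm2 := X.two_le
  set pos := s.reg 1 with hposdef
  set f := vals l with hfdef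
  have hcl := chainLength_prv_le (f := f) (k := pos)
  have hle := prv_le f pos
  unfold search
  -- each round takes at most `30` steps and goes to the next element of the chain of parents
  refine wp_seq (wp_copy fun _ => wp_seq (wp_const (by omega) (wp_seq ((wp_loop
    (k := 30 * (chainLength f pos + 1 - chainLength f (prv f pos)) + 1)
    (R := fun r => Near f X.m pos (r.reg 2))
    (fun k r =>
      (r.reg 3 = 0 ∧ Near f X.m pos (r.reg 2) ∧ k = 1) ∨
      (r.reg 3 = 1 ∧ prv f pos ≤ r.reg 2 ∧ r.reg 2 ≤ pos ∧
        (∀ j < pos, r.reg 2 ≤ j → f pos ≤ f j) ∧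
        ((r.reg 2 + X.m ≤ pos ∧ k = 31) ∨
          k = 30 * (chainLength f (r.reg 2) + 1 - chainLength f (prv f pos)) + 1))) ?_ ?_).mono
              ?_))))
  · right
    simp only [set_reg]
    refine ⟨rfl, hle, le_rfl, fun j h1 h2 => ?_, Or.inr rfl⟩
    simp at h2; omega
  · rintro k r hI hr hfr
    have hmem : r.mem = s.mem := hfr.mem rfl
    have h1 : r.reg 1 = pos := hfr.reg 1 rfl
    rw [← hmem] at hring
    rcases hI with ⟨h3, hN, rfl⟩ | ⟨h3, hq1, hq2, hq3, hk⟩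
    · exact Or.inl ⟨by simp [Test.eval, h3, hr.r1], le_rfl, hN⟩
    · right
      refine ⟨by simp [Test.eval, h3, hr.r1], ?_⟩
      have hclq := hcl _ hq1 hq2
      have hk31 : 31 ≤ k := by omega
      refine wp_seq (wp_add (by rw [hr.rM]; omega) (wp_ite_lt (fun h4 => wp_ite_lt (fun h5 =>
        wp_seq (wp_sub (wp_ite_cmp (hcmp _ _ _) ?_ ?_ (fun h6 => wp_const (by omega) ?_)
          (fun h6 => wp_seq (wp_div (wp_seq (wp_mul ?_ (wp_seq (wp_sub (wp_ld ?_ ?_ ha)))))))))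
          ) fun h5 => wp_const (by omega) ?_) fun h4 => wp_const (by omega) ?_))
      all_goals simp only [set_reg, set_mem, hr.r0, hr.r1, hr.rM, h1, h3, Nat.reduceEqDiff,
        reduceIte] at *
      · omega
      · omega
      · refine ⟨1, Or.inl ⟨trivial, ⟨hq2, hq1, Or.inl ?_⟩, rfl⟩, by omega⟩
        exact (prv_eq hq2 (Or.inr h6) fun j h7 h8 => hq3 j h8 h7).symm
      · have := Nat.div_mul_le_self (r.reg 2 - 1) X.m
        omega
      · rw [sub_div_mul]
        have := Nat.mod_lt (r.reg 2 - 1) (show 0 < X.m by omega)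
        omega
      · rw [sub_div_mul]
        obtain ⟨c, hc⟩ : ∃ c, r.reg 2 = c + 1 := ⟨r.reg 2 - 1, by omega⟩
        rw [hc] at h4 h6 hq1 hq2 hq3 hk ⊢
        simp only [Nat.add_sub_cancel] at h6 ⊢
        have hN := hring c (by omega) (by omega)
        set e := arr X.K r.mem a (c % X.m)
        obtain ⟨he1, he2, he3⟩ := hN
        change prv f c ≤ e at he2
        change e = prv f c ∨ e + X.m ≤ c at he3
        have hpc : prv f pos ≤ c := by
          by_contra h7
          have h8 : prv f pos = c + 1 := by omega
          have h9 := (prv_spec f pos).resolve_left (by omega)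
          rw [h8] at h9
          rw [Nat.add_sub_cancel] at h9
          exact absurd h9 (not_lt.2 h6)
        have hpp := prv_le_prv hpc (by omega)
        have hcc := chainLength_succ f c
        have hcl' := hcl (prv f c) hpp (by omega)
        have hkk : k = 30 * (chainLength f (c + 1) + 1 - chainLength f (prv f pos)) + 1 := by omega
        refine ⟨if e + X.m ≤ pos then 31
          else 30 * (chainLength f e + 1 - chainLength f (prv f pos)) + 1,
          Or.inr ⟨trivial, by omega, by omega, fun j h7 h8 => ?_, ?_⟩, ?_⟩
        · rcases lt_trichotomy j c with h9 | h9 | h9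
          · exact le_trans h6 (le_of_prv_le (f := f) (by omega) h9)
          · rw [h9]; exact h6
          · exact hq3 j h7 (by omega)
        · split_ifs with h7
          · exact Or.inl ⟨h7, rfl⟩
          · exact Or.inr rfl
        · split_ifs with h7
          · omega
          · have : e = prv f c := by omega
            rw [this]
            omega
      · exact ⟨1, Or.inl ⟨trivial, ⟨hq2, hq1, Or.inl (by omega)⟩, rfl⟩, by omega⟩
      · exact ⟨1, Or.inl ⟨trivial, ⟨hq2, hq1, Or.inr h4⟩, rfl⟩, by omega⟩
  · rintro T r hr hfr ⟨hT, hN⟩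
    have hmem : r.mem = s.mem := hfr.mem rfl
    have h1 : r.reg 1 = pos := hfr.reg 1 rfl
    have hml := Nat.mod_lt pos (show 0 < X.m by omega)
    refine wp_seq (wp_div (wp_seq (wp_mul ?_ (wp_seq (wp_sub (wp_st ?_ ?_ ha))))))
    · simp [set_reg, hr.rM, h1]
      have := Nat.div_mul_le_self pos X.m
      omega
    · simp [set_reg, hr.rM, h1, sub_div_mul]
      omega
    · have e5 : ∀ r' : Store, r'.reg 5 = pos % X.m → arr X.K (r'.put X.K a (r'.reg 5) (r.reg
        2)).mem =
          set2 (arr X.K r'.mem) a (pos % X.m) (r.reg 2) := fun r' h => by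
        rw [put_arr ha (by omega), h]
      have hcs := chainLength_succ f pos
      have := hcl pos hle le_rfl
      simp [set_reg, hr.rM, h1, sub_div_mul, put_reg, put_arr ha (show pos % X.m < X.K by omega),
        set_mem, hmem, hN]
      omega

end search

/-! ### The candidates as programs -/

/-- Array `9` := the parents of the positions of the pattern. -/
def patternPhase : Cmd := iConst 1 0 ;; .loop (.lt 1 90) (search .patLt 9 ;; iAdd 1 1 92)

/-- Register `11` := the label number `h` of the word given by `i`, `c`, `H`, where these numbers
are in the registers `34`, `31`, `32`, `33`. -/
def labelOf : Cmd :=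
  (ld 9 35 34 ;; iAdd 36 31 92 ;;
    .ite (.lt 36 90)
      (ld 9 37 36 ;;
        .ite (.eq 37 36)
          (.ite (.eq 34 31) (iCopy 35 32)
            (.ite (.eq 34 36) (ld 9 35 31) (.ite (.eq 35 36) (iAdd 35 36 92) skip)))
          (.ite (.eq 34 31) (iCopy 35 37)
            (.ite (.eq 34 36) (iCopy 35 36)
              (iAdd 36 36 92 ;;
                .ite (.eq 35 36) (.ite (.lt 34 33) skip (iSub 35 36 92)) skip))))
      skip) ;;
  .ite (.eq 35 93) (iConst 11 0) (iAdd 11 34 92 ;; iSub 11 11 35)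

/-- The least position from register `31` on whose parent lies before the value in register `32`. -/
def nxtLoop : Cmd :=
  iConst 41 1 ;;
  .loop (.eq 41 92)
    (.ite (.lt 31 90)
      (ld 9 42 31 ;; .ite (.lt 42 32) (iConst 41 0) (iAdd 31 31 92)) (iConst 41 0))

/-- Registers `31`, `32`, `33` := the parameters of the candidate in register `38`. -/
def prep : Cmd :=
  iDiv 39 38 90 ;; iMul 40 39 90 ;; iSub 40 38 40 ;; iCopy 33 90 ;;
  .ite (.eq 39 93) (iCopy 31 40 ;; ld 9 32 31)
    (.ite (.eq 39 92) (iAdd 32 40 92 ;; iCopy 31 32 ;; nxtLoop)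
      (iCopy 33 40 ;; ld 9 41 40 ;;
        .ite (.lt 92 41) (iSub 31 41 92 ;; iSub 31 31 92 ;; ld 9 32 31) (iCopy 31 90)))

section candidates
variable {X : Ctx} {s : Store}

theorem wp_patternPhase :
    wp X patternPhase s (fun T r => (∀ h < X.m, arr X.K r.mem 9 h = prv (vals X.E.pat) h) ∧
      (∀ b, b ≠ 9 → arr X.K r.mem b = arr X.K s.mem b) ∧ T ≤ 90 * X.m + 2) := by
  have hw := X.word
  have hmK := X.le_K
  unfold patternPhase
  refine wp_seq (wp_const (by omega) ((wp_loop (k := 90 * X.m + 1)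
    (R := fun r => Ring X X.E.pat (arr X.K r.mem 9) X.m ∧
      ∀ b, b ≠ 9 → arr X.K r.mem b = arr X.K s.mem b)
    (fun k r => r.reg 1 ≤ X.m ∧ Ring X X.E.pat (arr X.K r.mem 9) (r.reg 1) ∧
      (∀ b, b ≠ 9 → arr X.K r.mem b = arr X.K s.mem b) ∧
      k = 90 * (X.m - r.reg 1) + 40 * chainLength (vals X.E.pat) (r.reg 1) + 1) ?_ ?_).mono ?_))
  · simp only [set_reg, set_mem, reduceIte]
    exact ⟨Nat.zero_le _, fun k hk => by omega, fun _ _ => trivial, by rw [chainLength]; omega⟩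
  · rintro k r ⟨h1, hring, hA, rfl⟩ hr hfr
    rcases h1.lt_or_eq with h2 | h2
    · right
      refine ⟨by simp [Test.eval, hr.rM, h2], ?_⟩
      refine wp_seq ((wp_search (l := X.E.pat) (fun _ _ _ => rfl) (by norm_num)
        (by rw [X.pat_len]; omega) (by rwa [X.pat_len]) hring).mono ?_)
      rintro T u hu hfu ⟨hN, hm, hT⟩
      have e1 : u.reg 1 = r.reg 1 := hfu.reg 1 rfl
      refine wp_add (by rw [hu.r1]; omega) ?_
      refine ⟨90 * (X.m - (r.reg 1 + 1)) + 40 * chainLength (vals X.E.pat) (r.reg 1 + 1) + 1, ?_,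
          by omega⟩
      simp only [set_reg, set_mem, reduceIte, e1, hu.r1, hm]
      refine ⟨h2, hring.succ hN, fun b hb => ?_, trivial⟩
      rw [← hA b hb]
      funext j
      rw [set2_apply, if_neg (fun h => hb h.1)]
    · left
      refine ⟨by simp [Test.eval, hr.rM, h2], by omega, ?_⟩
      rw [h2] at hring
      exact ⟨hring, hA⟩
  · rintro T r hr hfr ⟨hT, hring, hA⟩
    refine ⟨fun h hh => ?_, hA, by omega⟩
    have := hring h hh (by omega)
    rw [Nat.mod_eq_of_lt hh] at this
    obtain ⟨-, -, h3 | h3⟩ := this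
    · exact h3
    · omega

variable {q : ℕ → ℕ}

theorem wp_labelOf (hq : ∀ h < X.m, arr X.K s.mem 9 h = q h) (hqle : ∀ h, q h ≤ h)
    (hi : s.reg 31 ≤ X.m) (hh : s.reg 34 < X.m) :
    wp X labelOf s (fun T r => T ≤ 20 ∧
      r.reg 11 = lab (swapRow q X.m (s.reg 31) (s.reg 32) (s.reg 33) (s.reg 34)) (s.reg 34)) := by
  have hw := X.word
  have hmK := X.le_K
  intro hs
  have hqh := hq _ hh
  have hqi := fun h : s.reg 31 < X.m => hq _ h
  have hqi' := fun h : s.reg 31 + 1 < X.m => hq _ h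
  have := hqle (s.reg 34)
  unfold labelOf
  refine wp_seq (wp.mono (Q := fun T r => T ≤ 16 ∧
    r.reg 35 = swapRow q X.m (s.reg 31) (s.reg 32) (s.reg 33) (s.reg 34)) ?_ ?_) hs
  · refine wp_seq (wp_ld ?_ (wp_seq (wp_add ?_ (wp_ite_lt (fun h1 => wp_seq (wp_ld ?_
      (wp_ite_eq
        (fun h2 => wp_ite_eq (fun h3 => wp_copy fun _ => ?_) fun h3 => wp_ite_eq
          (fun h4 => wp_ld ?_ ?_) fun h4 => wp_ite_eq (fun h5 => wp_add ?_ ?_) fun h5 => wp_skip ?_)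
        fun h2 => wp_ite_eq (fun h3 => wp_copy fun _ => ?_) fun h3 => wp_ite_eq
          (fun h4 => wp_copy fun _ => ?_) fun h4 => wp_seq (wp_add ?_ (wp_ite_eq
            (fun h5 => wp_ite_lt (fun h6 => wp_skip ?_) fun h6 => wp_sub ?_)
            fun h5 => wp_skip ?_)))))
      fun h1 => wp_skip ?_))))
    all_goals try simp only [set_reg, set_mem, hs.r1, hs.rM, Nat.reduceEqDiff, reduceIte] at *
    all_goals try rw [hqh] at *
    all_goals try rw [hqi' ‹_›] at *
    all_goals try rw [hqi (by omega)] at *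
    all_goals first
      | omega
      | (refine ⟨by omega, ?_⟩
         unfold swapRow
         split_ifs <;> omega)
  · rintro T r hr hfr ⟨hT, h35⟩
    have h34 : r.reg 34 = s.reg 34 := hfr.reg 34 rfl
    refine wp_ite_eq (fun h1 => wp_const (by omega) ?_) fun h1 => wp_seq (wp_add ?_ (wp_sub ?_))
    all_goals simp only [set_reg, hr.r0, hr.r1, Nat.reduceEqDiff, reduceIte, h34, h35] at *
    · exact ⟨by omega, by rw [lab, if_pos h1]⟩
    · omega
    · exact ⟨by omega, by rw [lab, if_neg h1]⟩

theorem wp_nxtLoop (hq : ∀ h < X.m, arr X.K s.mem 9 h = q h) (hc : s.reg 32 ≤ X.m)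
    (h31 : s.reg 31 = s.reg 32) :
    wp X nxtLoop s (fun T r => T ≤ 10 * X.m + 11 ∧ r.reg 31 ≤ X.m ∧
      r.reg 31 = nxt q X.m (s.reg 32)) := by
  have hw := X.word
  have hmK := X.le_K
  unfold nxtLoop
  refine wp_seq (wp_const (by omega) ((wp_loop (k := 10 * X.m + 10)
    (R := fun r => r.reg 31 ≤ X.m ∧ r.reg 31 = nxt q X.m (s.reg 32))
    (fun k r =>
      (r.reg 41 = 0 ∧ r.reg 31 ≤ X.m ∧ r.reg 31 = nxt q X.m (s.reg 32) ∧ k = 1) ∨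
      (r.reg 41 = 1 ∧ s.reg 32 ≤ r.reg 31 ∧ r.reg 31 ≤ X.m ∧
        (∀ j, s.reg 32 ≤ j → j < r.reg 31 → j < X.m ∧ s.reg 32 ≤ q j) ∧
        10 * (X.m - r.reg 31) + 10 ≤ k)) ?_ ?_).mono ?_))
  · right
    simp only [set_reg, h31, Nat.reduceEqDiff, reduceIte]
    exact ⟨trivial, le_rfl, hc, fun j h1 h2 => by omega, by omega⟩
  · rintro k r hI hr hfr
    have hmem : r.mem = s.mem := hfr.mem rfl
    have h32 : r.reg 32 = s.reg 32 := hfr.reg 32 rfl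
    rcases hI with ⟨h1, h2, h3, rfl⟩ | ⟨h1, h2, h3, h4, h5⟩
    · exact Or.inl ⟨by simp [Test.eval, h1, hr.r1], le_rfl, h2, h3⟩
    · right
      refine ⟨by simp [Test.eval, h1, hr.r1], ?_⟩
      refine wp_ite_lt (fun h6 => wp_seq (wp_ld (by rw [hr.rM] at h6; omega)
        (wp_ite_lt (fun h7 => wp_const (by omega) ?_)
        fun h7 => wp_add ?_ ?_))) fun h6 => wp_const (by omega) ?_
      all_goals simp only [set_reg, hr.r1, hr.rM, hmem, h32, Nat.reduceEqDiff, reduceIte] at *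
      · rw [hq _ h6] at h7
        exact ⟨1, Or.inl ⟨trivial, h3, (nxt_eq h2 (Or.inr h7) h4).symm, rfl⟩, by omega⟩
      · omega
      · rw [hq _ h6] at h7
        refine ⟨10 * (X.m - (r.reg 31 + 1)) + 10, Or.inr ⟨h1, by omega, h6, fun j h8 h9 => ?_,
            le_rfl⟩,
          by omega⟩
        rcases Nat.lt_succ_iff_lt_or_eq.1 h9 with h10 | h10
        · exact h4 j h8 h10
        · rw [h10]; exact ⟨h6, h7⟩
      · exact ⟨1, Or.inl ⟨trivial, h3, (nxt_eq h2 (Or.inl h6) h4).symm, rfl⟩, by omega⟩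
  · rintro T r hr hfr ⟨hT, h⟩
    exact ⟨by omega, h⟩

theorem wp_prep (hq : ∀ h < X.m, arr X.K s.mem 9 h = q h) (hqle : ∀ h, q h ≤ h)
    (hs3 : s.reg 38 < 3 * X.m) :
    wp X prep s (fun T r => T ≤ 10 * X.m + 30 ∧ r.reg 31 ≤ X.m ∧
      swapRow q X.m (r.reg 31) (r.reg 32) (r.reg 33) = row q X.m (s.reg 38)) := by
  have hw := X.word
  have hmK := X.le_K
  have hml := Nat.mod_lt (s.reg 38) (show 0 < X.m by have := X.two_le; omega)
  have hdm := Nat.div_mul_le_self (s.reg 38) X.m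
  have hqi := hq _ hml
  have hqr := hqle (s.reg 38 % X.m)
  intro hs
  unfold prep
  refine wp_seq (wp_div (wp_seq (wp_mul ?_ (wp_seq (wp_sub (wp_seq (wp_copy fun _ => wp_ite_eq
    (fun h1 => wp_seq (wp_copy fun _ => wp_ld ?_ ?_)) fun h1 => wp_ite_eq
      (fun h2 => wp_seq (wp_add ?_ (wp_seq (wp_copy fun _ => (wp_nxtLoop (q := q) ?_ ?_ ?_).mono
          ?_))))
      fun h2 => wp_seq (wp_copy fun _ => wp_seq (wp_ld ?_ (wp_ite_lt
        (fun h3 => wp_seq (wp_sub (wp_seq (wp_sub (wp_ld ?_ ?_)))))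
        fun h3 => wp_copy fun _ => ?_)))))))))) hs
  all_goals simp only [set_reg, set_mem, hs.r0, hs.r1, hs.rM, Nat.reduceEqDiff, reduceIte,
    sub_div_mul, hqi] at *
  · omega
  · omega
  · exact ⟨by omega, by omega, by rw [row, prm, if_pos h1]⟩
  · omega
  · exact hq
  · omega
  · rintro T r hr hfr ⟨hT, h31, h31'⟩
    have h32 := hfr.reg 32 rfl
    have h33 := hfr.reg 33 rfl
    simp only [set_reg, Nat.reduceEqDiff, reduceIte] at h32 h33
    refine ⟨by omega, h31, ?_⟩
    rw [row, prm, if_neg h1, if_pos h2, h32, h33, h31']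
  · omega
  · omega
  · refine ⟨by omega, by omega, ?_⟩
    rw [hq _ (by omega), row, prm, if_neg h1, if_neg h2, if_pos h3]
    rfl
  · refine ⟨by omega, le_rfl, ?_⟩
    rw [row, prm, if_neg h1, if_neg h2, if_neg (by omega)]
    funext h
    rw [swapRow, swapRow, if_neg (by omega), if_neg (by simp only; omega)]

end candidates

/-! ### Building the trie -/

section built
variable {m N s h c : ℕ} {q : ℕ → ℕ} {A B : ℕ → ℕ → ℕ} {node node' : ℕ → List ℕ}

theorem TrieCore.congr (hc : TrieCore m A N node)
    (e : ∀ a, a < 2 ∨ 4 ≤ a ∧ a < 8 → B a = A a) : TrieCore m B N node := by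
  have e0 := e 0 (by omega)
  have e1 := e 1 (by omega)
  have e4 := e 4 (by omega)
  have el : ∀ q v, look B q v = look A q v := fun q v => by
    simp only [look, e1, e 5 (by omega), e 6 (by omega), e 7 (by omega)]
  exact ⟨hc.pos, hc.root, by rw [e0]; exact hc.par_lt, by rw [e0, e1]; exact hc.node_eq,
    by rw [e1]; exact hc.lab_le, by simp only [e0, e1, el]; exact hc.look_par,
    by simp only [e0, e1, el]; exact hc.look_sound, by rw [e4]; exact hc.dep⟩

theorem Tables.congr (ht : Tables m A N s)
    (e : ∀ a, a < 2 ∨ 4 ≤ a ∧ a < 8 → B a = A a) : Tables m B N s := by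
  have e1 := e 1 (by omega)
  have e5 := e 5 (by omega)
  have e6 := e 6 (by omega)
  have e7 := e 7 (by omega)
  exact ⟨by rw [e5, e6]; exact ht.fresh, by rw [e5]; exact ht.only_lt,
    by rw [e1, e5]; exact ht.only_lab, by rw [e6]; exact ht.form, by rw [e6]; exact ht.inj,
    by rw [e7]; exact ht.zero⟩

theorem Avail.congr (ha : Avail m A N s h)
    (e : ∀ a, a < 2 ∨ 4 ≤ a ∧ a < 8 → B a = A a) : Avail m B N s h := by
  refine ha.imp (fun h => h.congr e) fun h => ⟨h.1.congr e, ?_⟩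
  rw [e 5 (by omega), e 6 (by omega)]
  exact h.2

theorem set2_ne {a b i v : ℕ} (hb : b ≠ a) : set2 A a i v b = A b := by
  funext j
  rw [set2_apply, if_neg fun h => hb h.1]

theorem row_inj {s' h' : ℕ} (hh : h < m) (hh' : h' < m) (e : s * m + h = s' * m + h') :
    s = s' ∧ h = h' := by
  have h1 : (s * m + h) / m = (s' * m + h') / m := by rw [e]
  rw [mul_comm, mul_comm s', Nat.mul_add_div (by omega), Nat.mul_add_div (by omega),
    Nat.div_eq_of_lt hh, Nat.div_eq_of_lt hh'] at h1
  simp only [add_zero] at h1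
  subst h1
  exact ⟨rfl, by omega⟩

theorem word_take_succ (q : ℕ → ℕ) (s : ℕ) (hh : h < m) :
    (word q m s).take (h + 1) = (word q m s).take h ++ [lab (row q m s h) h] := by
  rw [List.take_add_one, List.getElem?_eq_getElem (by simpa using hh)]
  simp [word]

/-- The arrays hold the trie of the words with numbers below `s` and of the first `h` letters of
word number `s`. Array `8` holds the states that are passed when these words are read, array `3` the
flags of the words that are complete, and array `9` the parents in the pattern. -/
structure Built (m : ℕ) (q : ℕ → ℕ) (A : ℕ → ℕ → ℕ) (N : ℕ) (node : ℕ → List ℕ) (s h : ℕ) :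
    Prop where
  core : TrieCore m A N node
  nodes : ∀ w, (∃ k < N, node k = w) ↔
    (∃ s' < s, w <+: word q m s') ∨ ∃ j ≤ h, w = (word q m s).take j
  card : N ≤ 1 + s * m + h
  rows : ∀ s' h', h' < m → s' < s ∨ s' = s ∧ h' < h →
    A 8 (s' * m + h') < N ∧ node (A 8 (s' * m + h')) = (word q m s').take (h' + 1)
  flag : ∀ k, A 3 k = 1 ↔ k < N ∧ ∃ s' < s, node k = word q m s'
  fail : ∀ k, A 2 k = 0
  pat : ∀ h < m, A 9 h = q h

theorem Built.len (hb : Built m q A N node s h) {k : ℕ} (hk : k < N) : (node k).length ≤ m := by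
  rcases (hb.nodes _).1 ⟨k, hk, rfl⟩ with ⟨s', -, h1⟩ | ⟨j, -, h1⟩
  · simpa using h1.length_le
  · rw [h1]; simp

/-- The next letter leads to state `c`, which may be new. -/
theorem Built.step (hb : Built m q A N node s h) (hh : h < m) {N' : ℕ} (hN : N ≤ N')
    (hN' : N' ≤ N + 1) (hc : c < N') (hcN : ∀ k, N ≤ k → k < N' → k = c)
    (e : ∀ a, a = 2 ∨ a = 3 ∨ 8 ≤ a → B a = A a) (hcore : TrieCore m B N' node')
    (hnode : ∀ k < N, node' k = node k) (hcw : node' c = (word q m s).take (h + 1)) :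
    Built m q (set2 B 8 (s * m + h) c) N' node' s (h + 1) := by
  refine ⟨hcore.congr fun a ha => set2_ne (by omega), fun w => ⟨?_, ?_⟩, ?_,
      fun s' h' hh' hs' => ?_,
    fun k => ?_, fun k => ?_, fun k hk => ?_⟩
  · rintro ⟨k, hk, rfl⟩
    by_cases hkN : k < N
    · rw [hnode k hkN]
      refine ((hb.nodes _).1 ⟨k, hkN, rfl⟩).imp id ?_
      rintro ⟨j, hj, hw⟩
      exact ⟨j, by omega, hw⟩
    · rw [hcN k (by omega) hk]
      exact Or.inr ⟨h + 1, le_rfl, hcw⟩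
  · intro hw
    have : (∃ k < N, node k = w) ∨ w = (word q m s).take (h + 1) := by
      rw [hb.nodes]
      rcases hw with hw | ⟨j, hj, hw⟩
      · exact Or.inl (Or.inl hw)
      · rcases hj.lt_or_eq with h1 | rfl
        · exact Or.inl (Or.inr ⟨j, by omega, hw⟩)
        · exact Or.inr hw
    rcases this with ⟨k, hk, hw⟩ | hw
    · exact ⟨k, by omega, by rw [hnode k hk, hw]⟩
    · exact ⟨c, hc, by rw [hcw, hw]⟩
  · have := hb.card; omega
  · rw [set2_apply]
    by_cases h1 : s' * m + h' = s * m + h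
    · obtain ⟨rfl, rfl⟩ := row_inj hh' hh h1
      rw [if_pos ⟨rfl, rfl⟩]
      exact ⟨hc, hcw⟩
    · rw [if_neg fun h => h1 h.2, e 8 (by omega)]
      obtain ⟨h2, h3⟩ := hb.rows s' h' hh' (by
        rcases hs' with h2 | ⟨rfl, h2⟩
        · exact Or.inl h2
        · exact Or.inr ⟨rfl, by omega⟩)
      exact ⟨by omega, by rw [hnode _ h2, h3]⟩
  · rw [set2_ne (by omega), e 3 (by omega), hb.flag]
    constructor
    · rintro ⟨h1, s', h2, h3⟩
      exact ⟨by omega, s', h2, by rw [hnode k h1, h3]⟩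
    · rintro ⟨h1, s', h2, h3⟩
      by_cases hkN : k < N
      · exact ⟨hkN, s', h2, by rw [← hnode k hkN, h3]⟩
      · obtain ⟨k', h4, h5⟩ := (hb.nodes (word q m s')).2 (Or.inl ⟨s', h2, List.prefix_rfl⟩)
        rw [← hnode k' h4, ← h3] at h5
        have := hcore.inj (show k' < N' by omega) h1 h5
        omega
  · rw [set2_ne (by omega), e 2 (by omega), hb.fail]
  · rw [set2_ne (by omega), e 9 (by omega), hb.pat k hk]

/-- A word is complete: its last state becomes final. -/
theorem Built.finish (hb : Built m q A N node s m) (hc : c < N) (hcw : node c = word q m s) :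
    Built m q (set2 A 3 c 1) N node (s + 1) 0 := by
  refine ⟨hb.core.congr fun a ha => set2_ne (by omega), fun w => ?_, ?_, fun s' h' hh' hs' => ?_,
    fun k => ?_, fun k => ?_, fun k hk => ?_⟩
  · rw [hb.nodes]
    constructor
    · rintro (⟨s', h1, h2⟩ | ⟨j, -, rfl⟩)
      · exact Or.inl ⟨s', by omega, h2⟩
      · exact Or.inl ⟨s, by omega, List.take_prefix _ _⟩
    · rintro (⟨s', h1, h2⟩ | ⟨j, h1, rfl⟩)
      · rcases Nat.lt_succ_iff_lt_or_eq.1 h1 with h3 | rfl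
        · exact Or.inl ⟨s', h3, h2⟩
        · exact Or.inr ⟨w.length, by simpa using h2.length_le, List.prefix_iff_eq_take.1 h2⟩
      · exact Or.inr ⟨0, by omega, by simp [show j = 0 by omega]⟩
  · have := hb.card; rw [Nat.succ_mul]; omega
  · rw [set2_ne (by omega)]
    refine hb.rows s' h' hh' ?_
    rcases Nat.lt_succ_iff_lt_or_eq.1 (show s' < s + 1 by omega) with h1 | h1
    · exact Or.inl h1
    · exact Or.inr ⟨h1, hh'⟩
  · rw [set2_apply]
    by_cases h1 : k = c
    · subst h1
      rw [if_pos ⟨rfl, rfl⟩]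
      exact ⟨fun _ => ⟨hc, s, by omega, hcw⟩, fun _ => rfl⟩
    · rw [if_neg fun h => h1 h.2, hb.flag]
      constructor
      · rintro ⟨h2, s', h3, h4⟩
        exact ⟨h2, s', by omega, h4⟩
      · rintro ⟨h2, s', h3, h4⟩
        refine ⟨h2, s', ?_, h4⟩
        rcases Nat.lt_succ_iff_lt_or_eq.1 h3 with h5 | rfl
        · exact h5
        · exact absurd (hb.core.inj h2 hc (h4.trans hcw.symm)) h1
  · rw [set2_ne (by omega), hb.fail]
  · rw [set2_ne (by omega), hb.pat k hk]

end built

/-! ### Inserting the candidates -/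

/-- Move the only child, in register `45`, of the state in register `10` to a table in the slot with
number in register `38`, and add the state in register `20` to that table. -/
def growCmd : Cmd :=
  iAdd 46 90 92 ;; iMul 46 46 38 ;; iAdd 46 46 92 ;; st 6 10 46 ;; ld 1 44 45 ;;
  iAdd 44 44 46 ;; st 7 44 45 ;; iAdd 44 46 11 ;; st 7 44 20

/-- Add the state in register `20` as a child of the state in register `10` along the edge in
register `11`, with slot number in register `38`, and move to the new state. -/
def attachCmd : Cmd :=
  st 0 20 10 ;; st 1 20 11 ;; ld 4 44 10 ;; iAdd 44 44 92 ;; st 4 20 44 ;; ld 6 44 10 ;;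
  .ite (.eq 44 93)
    (ld 5 45 10 ;;
      .ite (.eq 45 93) (st 5 10 20) growCmd)
    (iAdd 44 44 11 ;; st 7 44 20)

/-- Insert one letter of the candidate whose number is in register `38`. -/
def insertLetter : Cmd :=
  labelOf ;; child ;; .ite (.eq 12 93) (attachCmd ;; iCopy 10 20 ;; iAdd 20 20 92) (iCopy 10 12) ;;
  st 8 43 10 ;; iAdd 43 43 92 ;; iAdd 34 34 92

/-- Insert the candidate whose number is in register `38`. -/
def insertWord : Cmd :=
  prep ;; iConst 10 0 ;; iConst 34 0 ;; iMul 43 38 90 ;; .loop (.lt 34 90) insertLetter ;;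
  st 3 10 92 ;; iAdd 38 38 92

/-- Insert all candidates. -/
def triePhase : Cmd := iConst 20 1 ;; iConst 38 0 ;; .loop (.lt 38 107) insertWord

section insertion
variable {X : Ctx} {s : Store} {q : ℕ → ℕ}

theorem wp_growCmd (hq : s.reg 10 < X.K) (h45 : s.reg 45 < X.K) (hv : s.reg 11 ≤ X.m)
    (hc : arr X.K s.mem 1 (s.reg 45) ≤ X.m) (hs : s.reg 38 < 3 * X.m) :
    wp X growCmd s (fun T r => T ≤ 20 ∧ arr X.K r.mem =
      set2 (set2 (set2 (arr X.K s.mem) 6 (s.reg 10) (s.reg 38 * (X.m + 1) + 1)) 7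
        (s.reg 38 * (X.m + 1) + 1 + arr X.K s.mem 1 (s.reg 45)) (s.reg 45)) 7
        (s.reg 38 * (X.m + 1) + 1 + s.reg 11) (s.reg 20)) := by
  have hw := X.word
  have hmK := X.le_K
  have hs1 := X.slot_lt hs hv
  have hs2 := X.slot_lt hs hc
  have hco := mul_comm (X.m + 1) (s.reg 38)
  intro hi
  unfold growCmd
  refine wp_seq (wp_add ?_ (wp_seq (wp_mul ?_ (wp_seq (wp_add ?_ (wp_seq (wp_st ?_ (wp_seq
    (wp_ld ?_ (wp_seq (wp_add ?_ (wp_seq (wp_st ?_ (wp_seq (wp_add ?_ (wp_st ?_ ?_))))))))))))))))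
        hi
  all_goals simp only [set_reg, set_mem, put_reg, put_arr, hq, hi.r1, hi.rM, set2_apply, hco,
    Nat.reduceEqDiff, Nat.reduceLT, reduceIte, false_and]
  any_goals omega
  refine ⟨by omega, ?_⟩
  rw [put_arr (by norm_num) hs1, set_mem, set_mem, put_arr (by norm_num) (by omega),
    Nat.add_comm (arr X.K s.mem 1 (s.reg 45))]
  simp only [set_mem]
  rw [put_arr (by norm_num) hq]
  rfl

theorem wp_attachCmd (hN : s.reg 20 < X.K) (hq : s.reg 10 < s.reg 20) (hv : s.reg 11 ≤ X.m)
    (hs : s.reg 38 < 3 * X.m) (h4 : arr X.K s.mem 4 (s.reg 10) ≤ X.m)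
    (ht : Tables X.m (arr X.K s.mem) (s.reg 20) (s.reg 38 + 1)) :
    wp X attachCmd s (fun T r => T ≤ 45 ∧ arr X.K r.mem =
      attach (arr X.K s.mem) X.m (s.reg 20) (s.reg 38) (s.reg 10) (s.reg 11)) := by
  have hw := X.word
  have hmK := X.le_K
  have h5 := ht.only_lt (s.reg 10)
  have h5v := ht.only_lab (s.reg 10)
  have h6 := ht.lt_K (q := s.reg 10) (v := s.reg 11) (X := X) (by omega) hv
  have hs1 := X.slot_lt hs hv
  have hs2 := fun h => X.slot_lt hs (h5v h)
  have hs0 := X.slot_lt hs (Nat.zero_le _)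
  have hq' := hq.ne
  have hN1 : s.reg 20 + 1 ≤ X.K := hN
  have hqK : s.reg 10 < X.K := by omega
  have h5K : arr X.K s.mem 5 (s.reg 10) < X.K := by omega
  intro hi
  unfold attachCmd
  refine wp_seq (wp_st ?_ (wp_seq (wp_st ?_ (wp_seq (wp_ld ?_ (wp_seq (wp_add ?_ (wp_seq (wp_st ?_
    (wp_seq (wp_ld ?_ (wp_ite_eq (fun h1 => wp_seq (wp_ld ?_ (wp_ite_eq (fun h2 => wp_st ?_ ?_)
      fun h2 => (wp_growCmd ?_ ?_ ?_ ?_ ?_).mono ?_))) fun h1 => wp_seq (wp_add ?_ (wp_st ?_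
          ?_))))))))))))))
        hi
  all_goals simp only [set_reg, set_mem, put_reg, put_arr, hN, hqK, h5K, hi.r0, hi.r1, set2_apply,
    Nat.reduceEqDiff, Nat.reduceLT, reduceIte, false_and, true_and, hq', h5.ne] at *
  any_goals omega
  · refine ⟨by omega, ?_⟩
    simp [attach, *]
  · rintro T r - - ⟨hT, hr⟩
    refine ⟨by omega, ?_⟩
    simp [attach, *]
  · refine ⟨by omega, ?_⟩
    rw [put_arr (by norm_num) (h6 h1)]
    simp [attach, h1, set_mem, put_arr, show s.reg 20 < X.K from hN1]

/-- The arrays hold the trie built so far, and the word being inserted has led to state `c`. -/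
structure Inserting (X : Ctx) (q : ℕ → ℕ) (A : ℕ → ℕ → ℕ) (N s h c : ℕ) (node : ℕ → List ℕ) :
    Prop where
  built : Built X.m q A N node s h
  avail : Avail X.m A N s c
  lt : c < N
  eq : node c = (word q X.m s).take h

theorem card_le (X : Ctx) {s h : ℕ} (hs : s < 3 * X.m) (hh : h ≤ X.m) :
    1 + s * X.m + h < X.K ∧ s * X.m + h < X.K := by
  have h1 := Nat.mul_le_mul_right X.m (show s + 1 ≤ 3 * X.m from hs)
  have h2 := Nat.mul_le_mul_right X.m X.two_le
  rw [Nat.succ_mul, Nat.mul_assoc] at h1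
  have := X.K_eq
  omega

/-- Each letter takes constant time. -/
theorem wp_insertLetter {node : ℕ → List ℕ} {h : ℕ} (hqle : ∀ h, q h ≤ h)
    (hI : Inserting X q (arr X.K s.mem) (s.reg 20) (s.reg 38) h (s.reg 10) node)
    (hs3 : s.reg 38 < 3 * X.m) (hh : h < X.m) (h34 : s.reg 34 = h)
    (h43 : s.reg 43 = s.reg 38 * X.m + h) (h31 : s.reg 31 ≤ X.m)
    (hrow : swapRow q X.m (s.reg 31) (s.reg 32) (s.reg 33) = row q X.m (s.reg 38)) :
    wp X insertLetter s (fun T r => T ≤ 90 ∧ r.reg 34 = h + 1 ∧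
      r.reg 43 = s.reg 38 * X.m + (h + 1) ∧
      ∃ node, Inserting X q (arr X.K r.mem) (r.reg 20) (s.reg 38) (h + 1) (r.reg 10) node) := by
  have hw := X.word
  have hmK := X.le_K
  obtain ⟨hb, hav, hlt, heq⟩ := hI
  have hcard := hb.card
  obtain ⟨hc1, hc2⟩ := card_le X hs3 hh.le
  have ht := hav.tables
  unfold insertLetter
  refine wp_seq ((wp_labelOf hb.pat hqle h31 (by omega)).mono ?_)
  rintro T1 r1 hr1 hf1 ⟨hT1, hv⟩
  rw [hrow, h34] at hv
  have hvm : lab (row q X.m (s.reg 38) h) h ≤ X.m := (lab_le _ _).trans hh.le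
  have e10 : r1.reg 10 = s.reg 10 := hf1.reg 10 rfl
  have e20 : r1.reg 20 = s.reg 20 := hf1.reg 20 rfl
  have e38 : r1.reg 38 = s.reg 38 := hf1.reg 38 rfl
  have e34 : r1.reg 34 = s.reg 34 := hf1.reg 34 rfl
  have e43 : r1.reg 43 = s.reg 43 := hf1.reg 43 rfl
  have em : r1.mem = s.mem := hf1.mem rfl
  have htake := word_take_succ q (s.reg 38) hh
  have h5 := ht.only_lt (s.reg 10)
  have h6 := fun h => ht.lt_K (q := s.reg 10) (X := X) (by omega) hvm h
  refine wp_seq ((wp_child hr1 ?_ ?_ ?_).mono ?_)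
  · omega
  · rw [em, e10]; omega
  · rw [em, e10, hv]; exact h6
  rintro T2 r2 hr2 hf2 ⟨hT2, h12⟩
  rw [em, e10, hv] at h12
  rw [← hf2.mem rfl] at em
  rw [← hf2.reg 10 rfl] at e10
  rw [← hf2.reg 20 rfl] at e20
  rw [← hf2.reg 38 rfl] at e38
  rw [← hf2.reg 34 rfl] at e34
  rw [← hf2.reg 43 rfl] at e43
  rw [← hf2.reg 11 rfl] at hv
  -- after the state has been found, it is stored in the row of the word
  have tail : ∀ r : Store, r.reg 10 < X.K → r.reg 43 = s.reg 43 → r.reg 34 = h →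
      (∃ node, Inserting X q (set2 (arr X.K r.mem) 8 (s.reg 38 * X.m + h) (r.reg 10)) (r.reg 20)
        (s.reg 38) (h + 1) (r.reg 10) node) →
      wp X (st 8 43 10 ;; iAdd 43 43 92 ;; iAdd 34 34 92) r (fun T u => T ≤ 5 ∧ u.reg 34 = h + 1 ∧
        u.reg 43 = s.reg 38 * X.m + (h + 1) ∧
        ∃ node, Inserting X q (arr X.K u.mem) (u.reg 20) (s.reg 38) (h + 1) (u.reg 10) node) := by
    intro r k10 k43 k34 hex hr
    refine wp_seq (wp_st (by omega) (wp_seq (wp_add ?_ (wp_add ?_ ?_)))) hr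
    all_goals simp only [set_reg, set_mem, put_reg, hr.r1, k43, h43, k34, Nat.reduceEqDiff,
        reduceIte]
    · omega
    · omega
    · rw [put_arr (by norm_num) hc2]
      exact ⟨by omega, trivial, by omega, hex⟩
  refine wp_seq (wp_ite_eq (fun h0 => wp_seq ((wp_attachCmd ?_ ?_ ?_ ?_ ?_ ?_).mono ?_)) fun h0 =>
      wp_copy fun _ => ?_)
  · omega
  · omega
  · omega
  · omega
  · rw [em, e10, hb.core.dep _ hlt]; exact hb.len hlt
  · rw [em, e20, e38]; exact ht
  · rintro T3 r3 hr3 hf3 ⟨hT3, hA⟩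
    rw [hr2.r0, h12] at h0
    rw [em, e20, e38, e10, hv] at hA
    rw [← hf3.reg 20 rfl] at e20
    rw [← hf3.reg 34 rfl] at e34
    rw [← hf3.reg 43 rfl] at e43
    refine wp_seq (wp_copy fun _ => wp_add ?_ ((tail _ ?_ ?_ ?_ ?_).mono ?_))
    all_goals try simp only [set_reg, set_mem, hr3.r1, e20, e34, e43, hA, h34, Nat.reduceEqDiff,
        reduceIte]
    · omega
    · omega
    · have hcore := hb.core.attach hav hlt hvm h0
      refine ⟨_, hb.step hh (by omega) le_rfl (by omega) (fun k _ _ => by omega) (fun a ha =>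
        attach_other ha) hcore (fun k hk => Function.update_of_ne hk.ne _ _) ?_,
        (avail_attach hav hlt hvm).congr fun a ha => set2_ne (by omega), by omega, ?_⟩
      all_goals rw [Function.update_self, heq, htake]
    · rintro T r - - ⟨hT, h⟩
      exact ⟨by omega, h⟩
  · rw [hr2.r0, h12] at h0
    obtain ⟨k1, k2⟩ := hb.core.node_look hlt hvm h0
    refine (tail _ ?_ ?_ ?_ ⟨node, ?_⟩).mono ?_
    all_goals try simp only [set_reg, set_mem, e20, e34, e43, em, h12, h34, Nat.reduceEqDiff,
        reduceIte]
    · omega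
    · have hnew := hb.step hh le_rfl (by omega) k1 (fun k _ _ => by omega) (fun _ _ => rfl) hb.core
        (fun _ _ => rfl) (by rw [k2, heq, htake])
      refine ⟨hnew, (hav.look h0).congr fun a ha => set2_ne (by omega), k1, by rw [k2, heq, htake]⟩
    · rintro T r - - ⟨hT, h⟩
      exact ⟨by omega, h⟩

theorem wp_insertWord {node : ℕ → List ℕ} (hqle : ∀ h, q h ≤ h)
    (hb : Built X.m q (arr X.K s.mem) (s.reg 20) node (s.reg 38) 0)
    (ht : Tables X.m (arr X.K s.mem) (s.reg 20) (s.reg 38)) (hs3 : s.reg 38 < 3 * X.m) :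
    wp X insertWord s (fun T r => T ≤ 101 * X.m + 100 ∧ r.reg 38 = s.reg 38 + 1 ∧
      Tables X.m (arr X.K r.mem) (r.reg 20) (s.reg 38 + 1) ∧
      ∃ node, Built X.m q (arr X.K r.mem) (r.reg 20) node (s.reg 38 + 1) 0) := by
  have hw := X.word
  have hmK := X.le_K
  have hc0 := card_le X hs3 (Nat.zero_le _)
  intro hs
  unfold insertWord
  refine wp_seq ((wp_prep hb.pat hqle hs3).mono ?_) hs
  rintro T1 r1 hr1 hf1 ⟨hT1, h31, hrow⟩
  have em : r1.mem = s.mem := hf1.mem rfl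
  have e38 : r1.reg 38 = s.reg 38 := hf1.reg 38 rfl
  have e20 : r1.reg 20 = s.reg 20 := hf1.reg 20 rfl
  refine wp_seq (wp_const (by omega) (wp_seq (wp_const (by omega) (wp_seq (wp_mul ?_ (wp_seq
    ((wp_loop (k := 91 * X.m + 1) (R := fun r => ∃ node,
      Inserting X q (arr X.K r.mem) (r.reg 20) (s.reg 38) X.m (r.reg 10) node)
    (fun k r => ∃ h ≤ X.m, r.reg 34 = h ∧ r.reg 43 = s.reg 38 * X.m + h ∧ k = 91 * (X.m - h) + 1 ∧
      ∃ node, Inserting X q (arr X.K r.mem) (r.reg 20) (s.reg 38) h (r.reg 10) node) ?_ ?_).mono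
          ?_)))))))
  · simp only [set_reg, hr1.rM, e38, Nat.reduceEqDiff, reduceIte]
    omega
  · refine ⟨0, Nat.zero_le _, ?_⟩
    simp only [set_reg, set_mem, hr1.rM, e38, e20, em, Nat.reduceEqDiff, reduceIte]
    refine ⟨trivial, rfl, rfl, node, hb, Or.inl ht, hb.core.pos, ?_⟩
    rw [hb.core.root]; simp
  · rintro k r ⟨h, hh, h34, h43, rfl, node, hI⟩ hr hfr
    have k38 : r.reg 38 = s.reg 38 := by
      rw [hfr.reg 38 rfl]
      simp only [set_reg, Nat.reduceEqDiff, reduceIte, e38]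
    rcases hh.lt_or_eq with h1 | rfl
    · right
      have k31 : r.reg 31 = r1.reg 31 := by
        rw [hfr.reg 31 rfl]; simp only [set_reg, Nat.reduceEqDiff, reduceIte]
      have k32 : r.reg 32 = r1.reg 32 := by
        rw [hfr.reg 32 rfl]; simp only [set_reg, Nat.reduceEqDiff, reduceIte]
      have k33 : r.reg 33 = r1.reg 33 := by
        rw [hfr.reg 33 rfl]; simp only [set_reg, Nat.reduceEqDiff, reduceIte]
      refine ⟨by simp [Test.eval, hr.rM, h34, h1], (wp_insertLetter (node := node) (h := h) hqle ?_
          ?_ h1 h34 ?_ ?_ ?_).mono ?_⟩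
      · rw [k38]; exact hI
      · omega
      · rw [k38]; exact h43
      · omega
      · rw [k31, k32, k33, k38]; exact hrow
      · rintro T u - - ⟨hT, u1, u2, u3⟩
        rw [k38] at u2 u3
        exact ⟨91 * (X.m - (h + 1)) + 1, ⟨h + 1, h1, u1, u2, rfl, u3⟩, by omega⟩
    · left
      exact ⟨by simp [Test.eval, hr.rM, h34], by omega, node, hI⟩
  · rintro T r hr hfr ⟨hT, node, hI⟩
    have k38 : r.reg 38 = s.reg 38 := by
      rw [hfr.reg 38 rfl]
      simp only [set_reg, Nat.reduceEqDiff, reduceIte, e38]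
    obtain ⟨hb', hav, hlt, heq⟩ := hI
    have hcard := hb'.card
    have hc := card_le X hs3 le_rfl
    refine wp_seq (wp_st (by omega) (wp_add ?_ ?_))
    all_goals simp only [set_reg, put_reg, set_mem, k38, hr.r1, Nat.reduceEqDiff, reduceIte]
    · omega
    · rw [put_arr (by norm_num) (by omega)]
      refine ⟨by omega, trivial, hav.tables.congr fun a ha => set2_ne (by omega), node,
        hb'.finish hlt ?_⟩
      rw [heq, List.take_of_length_le (by simp)]

theorem built_empty {m : ℕ} {A : ℕ → ℕ → ℕ} (hA : ∀ a, a ≠ 9 → ∀ i, A a i = 0)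
    (h9 : ∀ h < m, A 9 h = q h) : Built m q A 1 (fun _ => []) 0 0 := by
  have hl : ∀ k v, look A k v = 0 := fun k v =>
    look_eq_zero (hA 5 (by omega) k) (hA 6 (by omega) k) v
  refine ⟨⟨one_pos, rfl, fun k _ _ => by omega, fun k _ _ => by omega, fun k _ _ => by omega,
    fun k _ _ => by omega, fun k _ v _ h => absurd (hl k v) h, fun k _ => hA 4 (by omega) k⟩,
    fun w => ?_, by omega, fun s' h' _ _ => by omega, fun k => ?_, fun k => hA 2 (by omega) k, h9⟩
  · constructor
    · rintro ⟨k, -, rfl⟩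
      exact Or.inr ⟨0, le_rfl, rfl⟩
    · rintro (⟨s', h, -⟩ | ⟨j, hj, rfl⟩)
      · omega
      · exact ⟨0, one_pos, by simp [show j = 0 by omega]⟩
  · rw [hA 3 (by omega)]
    constructor
    · intro h; omega
    · rintro ⟨-, s', h, -⟩; omega

theorem tables_empty {m N : ℕ} {A : ℕ → ℕ → ℕ} (hA : ∀ a, a ≠ 9 → ∀ i, A a i = 0) (hN : 0 < N) :
    Tables m A N 0 := by
  have h5 := hA 5 (by omega)
  have h6 := hA 6 (by omega)
  exact ⟨fun k _ => ⟨h5 k, h6 k⟩, fun q => by rw [h5]; exact hN, fun q h => absurd (h5 q) h,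
    fun q h => absurd (h6 q) h, fun q q' h => absurd (h6 q) h, fun r _ v _ => hA 7 (by omega) _⟩

theorem wp_triePhase (hqle : ∀ h, q h ≤ h) (hA : ∀ a, a ≠ 9 → ∀ i, arr X.K s.mem a i = 0)
    (h9 : ∀ h < X.m, arr X.K s.mem 9 h = q h) :
    wp X triePhase s (fun T r => T ≤ 3 * X.m * (101 * X.m + 101) + 3 ∧
      Tables X.m (arr X.K r.mem) (r.reg 20) (3 * X.m) ∧
      ∃ node, Built X.m q (arr X.K r.mem) (r.reg 20) node (3 * X.m) 0) := by
  have hw := X.word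
  unfold triePhase
  refine wp_seq (wp_const (by omega) (wp_seq (wp_const (by omega) ((wp_loop
    (k := 3 * X.m * (101 * X.m + 101) + 1) (R := fun r =>
      Tables X.m (arr X.K r.mem) (r.reg 20) (3 * X.m) ∧
      ∃ node, Built X.m q (arr X.K r.mem) (r.reg 20) node (3 * X.m) 0)
    (fun k r => ∃ b, b + r.reg 38 = 3 * X.m ∧ k = b * (101 * X.m + 101) + 1 ∧
      Tables X.m (arr X.K r.mem) (r.reg 20) (r.reg 38) ∧
      ∃ node, Built X.m q (arr X.K r.mem) (r.reg 20) node (r.reg 38) 0) ?_ ?_).mono ?_))))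
  · simp only [set_reg, set_mem, Nat.reduceEqDiff, reduceIte]
    exact ⟨_, rfl, rfl, tables_empty hA one_pos, _, built_empty hA h9⟩
  · rintro k r ⟨b, hb, rfl, ht, node, hbu⟩ hr hfr
    rcases Nat.eq_zero_or_pos b with rfl | hb0
    · rw [Nat.zero_add] at hb
      rw [hb] at ht hbu
      exact Or.inl ⟨by simp [Test.eval, hr.rW, hb], by omega, ht, node, hbu⟩
    · right
      refine ⟨by simp [Test.eval, hr.rW]; omega, (wp_insertWord hqle hbu ht (by omega)).mono ?_⟩
      rintro T u - - ⟨hT, u1, u2, u3⟩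
      rw [← u1] at u2 u3
      obtain ⟨b, rfl⟩ : ∃ b', b = b' + 1 := ⟨b - 1, by omega⟩
      refine ⟨_, ⟨b, by omega, rfl, u2, u3⟩, ?_⟩
      rw [Nat.succ_mul b]
      omega
  · rintro T r - - ⟨hT, h⟩
    exact ⟨by omega, h⟩

/-- The set of all candidate words. -/
def candidates (q : ℕ → ℕ) (m : ℕ) : Set (List ℕ) := {w | ∃ s < 3 * m, w = word q m s}

theorem Built.holdsTrie {A : ℕ → ℕ → ℕ} {N : ℕ} {node : ℕ → List ℕ}
    (hb : Built X.m q A N node (3 * X.m) 0) (ht : Tables X.m A N (3 * X.m)) :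
    HoldsTrie X A N node (candidates q X.m) := by
  refine ⟨hb.core, ht, ?_, fun w => ?_, fun k hk => hb.len hk⟩
  · have := hb.card
    have h2 := Nat.mul_le_mul X.two_le X.two_le
    have := X.K_eq
    rw [Nat.mul_assoc] at *
    omega
  · rw [hb.nodes]
    constructor
    · rintro ⟨_, ⟨s', h, rfl⟩, hw⟩
      exact Or.inl ⟨s', h, hw⟩
    · rintro (⟨s', h, hw⟩ | ⟨j, hj, rfl⟩)
      · exact ⟨_, ⟨s', h, rfl⟩, hw⟩
      · have := X.two_le
        exact ⟨_, ⟨0, by omega, rfl⟩, by simp [show j = 0 by omega]⟩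

end insertion

/-! ### The failure links -/

/-- Compute the failure links by increasing depth: for each depth `d + 1` in register `24` all
candidates are considered, with the number in register `25`. -/
def failPhase : Cmd :=
  iConst 24 1 ;; iConst 25 0 ;;
  .loop (.lt 24 90)
    (.ite (.lt 25 107)
      (iMul 26 25 90 ;; iAdd 26 26 24 ;; ld 8 26 26 ;; ld 1 14 26 ;; ld 0 10 26 ;; ld 2 10 10 ;;
        move ;; st 2 26 10 ;; iAdd 25 25 92)
      (iConst 25 0 ;; iAdd 24 24 92))

/-- The sum of the values of `φ` at the current depths of the `M` candidates, where the first `s`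
candidates are already at depth `d + 1` and the other ones are at depth `d`. -/
def potential (φ : ℕ → ℕ → ℕ) (M d s : ℕ) : ℕ :=
  ∑ s' ∈ Finset.range M, if s' < s then φ (d + 1) s' else φ d s'

theorem potential_succ {φ : ℕ → ℕ → ℕ} {M d s : ℕ} (hs : s < M) :
    potential φ M d (s + 1) + φ d s = potential φ M d s + φ (d + 1) s := by
  have key : ∀ M, potential φ M d (s + 1) + (if s < M then φ d s else 0) =
      potential φ M d s + if s < M then φ (d + 1) s else 0 := by
    intro M
    induction M with
    | zero => simp [potential]
    | succ M ih =>
      simp only [potential, Finset.sum_range_succ] at ih ⊢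
      rcases eq_or_ne s M with rfl | h
      · simp at ih ⊢
        omega
      · simp only [show M < s + 1 ↔ M < s by omega, show s < M + 1 ↔ s < M by omega] at ih ⊢
        split_ifs at ih ⊢ <;> omega
  simpa [hs] using key M

/-- Once all candidates are at depth `d + 1`, the next round begins. -/
theorem potential_self (φ : ℕ → ℕ → ℕ) (M d : ℕ) : potential φ M d M = potential φ M (d + 1) 0 :=
  Finset.sum_congr rfl fun s' h => by
    rw [if_pos (Finset.mem_range.1 h), if_neg (Nat.not_lt_zero _)]

section failure
variable {X : Ctx} {s : Store} {q : ℕ → ℕ} {A B : ℕ → ℕ → ℕ} {N : ℕ} {node : ℕ → List ℕ}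
  {D : Set (List ℕ)}

theorem HoldsTrie.congr (ht : HoldsTrie X A N node D)
    (e : ∀ a, a < 2 ∨ 4 ≤ a ∧ a < 8 → B a = A a) : HoldsTrie X B N node D :=
  { ht with
    core := ht.core.congr e
    tables := ht.tables.congr e }

/-- The failure link of state `k` is correct. -/
def FailAt (A : ℕ → ℕ → ℕ) (N : ℕ) (node : ℕ → List ℕ) (D : Set (List ℕ)) (k : ℕ) : Prop :=
  A 2 k < N ∧ node (A 2 k) = failure D (node k)

theorem FailAt.set2 {k k' c : ℕ} (h : FailAt A N node D k') (hc : c < N)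
    (he : node c = failure D (node k)) : FailAt (SwapCT.set2 A 2 k c) N node D k' := by
  unfold FailAt
  rw [set2_apply]
  by_cases hk : k' = k
  · rw [if_pos ⟨rfl, hk⟩, hk]
    exact ⟨hc, he⟩
  · rw [if_neg fun h => hk h.2]
    exact h

theorem failAt_set2 {k c : ℕ} (hc : c < N) (he : node c = failure D (node k)) :
    FailAt (SwapCT.set2 A 2 k c) N node D k := by
  unfold FailAt
  rw [set2_apply, if_pos ⟨rfl, rfl⟩]
  exact ⟨hc, he⟩

/-- The time for each move is paid by the decrease of `potential` for the lengths of the failure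
states. -/
theorem wp_failPhase (hb : Built X.m q (arr X.K s.mem) N node (3 * X.m) 0)
    (ht : Tables X.m (arr X.K s.mem) N (3 * X.m)) :
    wp X failPhase s (fun T r => T ≤ 100 * ((3 * X.m + 1) * X.m) + 3 ∧
      (∀ a, a ≠ 2 → arr X.K r.mem a = arr X.K s.mem a) ∧
      FailUpTo (arr X.K r.mem) N node (candidates q X.m) X.m) := by
  have hw := X.word
  have hm2 := X.two_le
  have hmK := X.le_K
  have hT := hb.holdsTrie ht
  have h0 := hT.nil_mem
  set D := candidates q X.m with hD
  set φ : ℕ → ℕ → ℕ := fun d s => (failure D ((word q X.m s).take d)).length with hφ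
  unfold failPhase
  refine wp_seq (wp_const (by omega) (wp_seq (wp_const (by omega) ((wp_loop
    (k := 100 * ((3 * X.m + 1) * X.m) + 1) (R := fun r =>
      (∀ a, a ≠ 2 → arr X.K r.mem a = arr X.K s.mem a) ∧ FailUpTo (arr X.K r.mem) N node D X.m)
    (fun k r => ∃ b d s', r.reg 24 = d ∧ r.reg 25 = s' ∧ 0 < d ∧ d ≤ X.m ∧ s' ≤ 3 * X.m ∧
      (d = X.m → s' = 0) ∧ b + s' + (3 * X.m + 1) * d = (3 * X.m + 1) * X.m ∧
      (∀ a, a ≠ 2 → arr X.K r.mem a = arr X.K s.mem a) ∧ FailUpTo (arr X.K r.mem) N node D d ∧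
      (∀ j < s', d < X.m → FailAt (arr X.K r.mem) N node D (arr X.K s.mem 8 (j * X.m + d))) ∧
      40 * potential φ (3 * X.m) d s' + 100 * b + 1 ≤ k) ?_ ?_).mono ?_))))
  · simp only [set_reg, set_mem, Nat.reduceEqDiff, reduceIte]
    have e := Nat.mul_le_mul_left (3 * X.m + 1) (show 1 ≤ X.m by omega)
    refine ⟨(3 * X.m + 1) * X.m - (3 * X.m + 1) * 1, 1, 0, rfl, rfl, one_pos, by omega, by omega,
      by omega, by omega, fun _ _ => trivial, fun k hk0 hk hl => ?_, fun _ _ => by omega, ?_⟩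
    · have := failure_length_lt D _ (hb.core.ne_nil hk0 hk)
      rw [hb.fail, hb.core.root, List.length_eq_zero_iff.1 (by omega : (failure D (node k)).length
          = 0)]
      exact ⟨hb.core.pos, rfl⟩
    · have : potential φ (3 * X.m) 1 0 = 0 := by
        refine Finset.sum_eq_zero fun s' _ => ?_
        rw [if_neg (Nat.not_lt_zero _)]
        have hne : (word q X.m s').take 1 ≠ [] := fun h => by
          have := congrArg List.length h
          simp at this
          omega
        have := failure_length_lt D _ hne
        simp only [hφ, List.length_take] at this ⊢
        omega
      omega
  · rintro k r ⟨b, d, s', h24, h25, hd0, hd, hs', hds, hbud, hA, hF, hrow, hk⟩ hr hfr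
    rcases hd.lt_or_eq with hdm | rfl
    · right
      refine ⟨by simp [Test.eval, hr.rM, h24, hdm], ?_⟩
      have hnext := Nat.mul_le_mul_left (3 * X.m + 1) (show d + 1 ≤ X.m from hdm)
      rw [Nat.mul_succ] at hnext
      have hb1 : 0 < b := by omega
      refine wp_ite_lt (fun h1 => ?_) fun h1 => ?_
      · rw [hr.rW, h25] at h1
        obtain ⟨hc1, hc2⟩ := card_le X h1 hd
        obtain ⟨hk1, hk2⟩ := hb.rows s' d hdm (Or.inl h1)
        set x := arr X.K s.mem 8 (s' * X.m + d) with hx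
        have hx0 : 0 < x := by
          by_contra h
          rw [show x = 0 by omega, hb.core.root] at hk2
          have := congrArg List.length hk2
          simp at this
          omega
        have hpar := hb.core.par_lt x hx0 hk1
        have hnx := hb.core.node_eq x hx0 hk1
        have hnp : node (arr X.K s.mem 0 x) = (word q X.m s').take d := by
          rw [hnx, word_take_succ q s' hdm] at hk2
          exact (List.append_inj' hk2 rfl).1
        have hlp : (node (arr X.K s.mem 0 x)).length = d := by
          rw [hnp]; simp; omega
        have hp0 : 0 < arr X.K s.mem 0 x := by
          by_contra h
          rw [show arr X.K s.mem 0 x = 0 by omega, hb.core.root] at hlp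
          simp at hlp; omega
        obtain ⟨hf1, hf2⟩ := hF _ hp0 (hpar.trans hk1) hlp.le
        have hNK := hT.le_K
        have hTr : HoldsTrie X (arr X.K r.mem) N node D := hT.congr fun a ha => hA a (by omega)
        have hfl := failure_length_lt D _ (hb.core.ne_nil hp0 (hpar.trans hk1))
        refine wp_seq (wp_mul ?_ (wp_seq (wp_add ?_ (wp_seq (wp_ld ?_ (wp_seq (wp_ld ?_
          (wp_seq (wp_ld ?_ (wp_seq (wp_ld ?_ (wp_seq ((wp_move (N := N) (node := node) (D := D)
            (L := d) ?_ ?_ ?_ ?_).mono ?_)))))))))))))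
        all_goals simp only [set_reg, set_mem, hr.rM, h24, h25, hA 8 (by omega), hA 0 (by omega),
            hA 1 (by omega),
          Nat.reduceEqDiff, reduceIte, ← hx]
        · omega
        · omega
        · omega
        · omega
        · omega
        · omega
        · exact hTr
        · exact hF
        · exact hf1
        · rw [hf2]; omega
        rintro T u hu hfu ⟨hu1, hu2, hu3⟩
        have um := hfu.mem rfl
        have u24 := hfu.reg 24 rfl
        have u25 := hfu.reg 25 rfl
        have u26 := hfu.reg 26 rfl
        simp only [set_reg, set_mem, h24, h25, 
          Nat.reduceEqDiff, reduceIte] at um u24 u25 u26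
        rw [hf2, ← failure_concat h0 (hb.core.ne_nil hp0 (hpar.trans hk1)), ← hnx] at hu2
        have hgood := fun k' (h : FailAt (arr X.K r.mem) N node D k') => h.set2 hu1 hu2
        have hpot := potential_succ (φ := φ) (d := d) h1
        have hφ1 : φ d s' = (node (arr X.K r.mem 2 (arr X.K s.mem 0 x))).length := by
          rw [hf2, hnp]
        have hφ2 : φ (d + 1) s' = (node (u.reg 10)).length := by
          rw [hu2, hk2]
        refine wp_seq (wp_st ?_ (wp_add ?_ ?_))
        all_goals simp only [set_reg, set_mem, put_reg, hu.r1, u24, u25, u26, Nat.reduceEqDiff,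
            reduceIte]
        · omega
        · omega
        · rw [put_arr (by norm_num) (by omega), set_mem, um]
          refine ⟨_, ⟨b - 1, d, s' + 1, rfl, rfl, hd0, hd, h1, fun h => by omega, by omega,
            fun a ha => ?_, fun k' h2 h3 h4 => hgood k' (hF k' h2 h3 h4), fun j hj hdm => ?_,
                le_rfl⟩, ?_⟩
          · rw [set2_ne ha, hA a ha]
          · rcases Nat.lt_succ_iff_lt_or_eq.1 hj with h2 | rfl
            · exact hgood _ (hrow j h2 hdm)
            · exact failAt_set2 hu1 hu2
          · omega
      · rw [hr.rW, h25] at h1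
        obtain rfl : s' = 3 * X.m := by omega
        refine wp_seq (wp_const (by omega) (wp_add ?_ ?_))
        all_goals simp only [set_reg, set_mem, hr.r1, h24, Nat.reduceEqDiff, reduceIte]
        · omega
        · refine ⟨_, ⟨b - 1, d + 1, 0, rfl, rfl, by omega, hdm, by omega, fun _ => rfl, ?_, hA,
            fun k' h2 h3 h4 => ?_, fun _ _ => by omega, le_rfl⟩, ?_⟩
          · rw [Nat.mul_succ]; omega
          · rcases h4.lt_or_eq with h5 | h5
            · exact hF k' h2 h3 (by omega)
            · obtain ⟨_, ⟨j, hj, rfl⟩, hpre⟩ := (hT.nodes (node k')).2 ⟨k', h3, rfl⟩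
              obtain ⟨h6, h7⟩ := hb.rows j d hdm (Or.inl hj)
              rw [List.prefix_iff_eq_take, h5, ← h7] at hpre
              rw [hb.core.inj h3 h6 hpre]
              exact hrow j hj hdm
          · rw [potential_self] at hk
            omega
    · left
      refine ⟨by simp [Test.eval, hr.rM, h24], by omega, hA, hF⟩
  · rintro T r hr hfr ⟨hT, hA, hF⟩
    exact ⟨by omega, hA, hF⟩

end failure

/-! ### Reading the text -/

/-- Find the parent of the next text position, make a move on its parent-distance, and report the
current window if the state reached is final. -/
def textStep : Cmd :=
  iCopy 1 21 ;; search .textLt 10 ;;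
  .ite (.eq 2 93) (iConst 14 0) (iAdd 14 1 92 ;; iSub 14 14 2) ;;
  iCopy 10 22 ;; move ;; iCopy 22 10 ;; iAdd 21 21 92 ;; ld 3 17 10 ;;
  .ite (.eq 17 92) (iSub 17 21 90 ;; .prim (.emit 17)) skip

/-- The arrays `A` hold the Aho-Corasick automaton of `D`. -/
structure HoldsArrays (X : Ctx) (A : ℕ → ℕ → ℕ) (N : ℕ) (node : ℕ → List ℕ) (D : Set (List ℕ)) :
    Prop where
  trie : HoldsTrie X A N node D
  fail : FailUpTo A N node D X.m
  final : ∀ k < N, A 3 k = 1 ↔ node k ∈ D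

/-- The store after `k` text positions. The array `10`, with the parents of the last text positions,
is the only one that changes while the text is read. -/
structure Reading (X : Ctx) (D : Set (List ℕ)) (A : ℕ → ℕ → ℕ) (N : ℕ) (node : ℕ → List ℕ) (k : ℕ)
    (s : Store) : Prop where
  pos : s.reg 21 = k
  size : s.reg 20 = N
  state : s.reg 22 < N
  run : node (s.reg 22) = acRun D X.E.text k
  ring : Ring X X.E.text (arr X.K s.mem 10) k
  arrays : ∀ a, a ≠ 10 → arr X.K s.mem a = A a

theorem HoldsArrays.congr {X : Ctx} {A B : ℕ → ℕ → ℕ} {N : ℕ} {node : ℕ → List ℕ}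
    {D : Set (List ℕ)} (h : HoldsArrays X A N node D) (e : ∀ a, a < 8 → B a = A a) :
    HoldsArrays X B N node D := by
  refine ⟨h.trie.congr fun a ha => e a (by omega), ?_, ?_⟩
  · have := h.fail
    rwa [FailUpTo, ← e 2 (by omega)] at this
  · rw [e 3 (by omega)]
    exact h.final

open Classical in
/-- The longer the state and the chain of parents get, the less time is left: this amortizes the
failure links and the search for the parent. -/
theorem wp_textStep {X : Ctx} {D : Set (List ℕ)} {A : ℕ → ℕ → ℕ} {N k : ℕ} {node : ℕ → List ℕ}
    {s : Store} (hA : HoldsArrays X A N node D) (hs : Reading X D A N node k s) (hk : k < X.n) :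
    wp X textStep s (fun T r => Reading X D A N node (k + 1) r ∧
      r.out = (if acRun D X.E.text (k + 1) ∈ D then s.out ++ [k + 1 - X.m] else s.out) ∧
      T + 40 * ((acRun D X.E.text (k + 1)).length + chainLength (vals X.E.text) (k + 1)) ≤
        40 * ((acRun D X.E.text k).length + chainLength (vals X.E.text) k) + 200) := by
  have hw := X.word
  have htl := X.text_len
  intro hi
  unfold textStep
  refine wp_seq (wp_copy fun _ => wp_seq ((wp_search (l := X.E.text) (fun _ _ _ => rfl) (by
      norm_num)
    (by omega) ?_ ?_).mono ?_)) hi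
  · simp only [set_reg, reduceIte, hs.pos]; omega
  · simp only [set_reg, set_mem, reduceIte, hs.pos]; exact hs.ring
  rintro T1 u hu hfu ⟨hN, hm, hT1⟩
  have u1 := hfu.reg 1 rfl
  have u21 := hfu.reg 21 rfl
  have u20 := hfu.reg 20 rfl
  have u22 := hfu.reg 22 rfl
  have uo := hfu.out rfl
  simp only [set_reg, set_mem, set_out, Nat.reduceEqDiff, reduceIte, hs.pos,
      hs.size] at hN hm hT1 u1 u21 u20 u22 uo
  have hring := hs.ring.succ (A := arr X.K s.mem) hN
  rw [← hm] at hring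
  have harr : ∀ a, a ≠ 10 → arr X.K u.mem a = A a := fun a ha => by
    rw [hm, set2_ne ha, hs.arrays a ha]
  have hA' := hA.congr fun a ha => harr a (by omega)
  have hlen := hA.trie.len _ hs.state
  have hNK := hA.trie.le_K
  refine wp_seq (wp.mono (Q := fun T r => T ≤ 3 ∧ r.reg 14 = lab (u.reg 2) k) ?_ ?_)
  · refine wp_ite_eq (fun h1 => wp_const (by omega) ?_) fun h1 => wp_seq (wp_add ?_ (wp_sub ?_))
    all_goals simp only [set_reg, hu.r0, hu.r1, u1, Nat.reduceEqDiff, reduceIte] at *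
    · exact ⟨by omega, by rw [lab, if_pos h1]⟩
    · omega
    · exact ⟨by omega, by rw [lab, if_neg h1]⟩
  rintro T2 v hv hfv ⟨hT2, v14⟩
  have vm := hfv.mem rfl
  have vo := (hfv.out rfl).trans uo
  have v21 := (hfv.reg 21 rfl).trans u21
  have v20 := (hfv.reg 20 rfl).trans u20
  have v22 := (hfv.reg 22 rfl).trans u22
  rw [← vm] at hA' hring harr
  refine wp_seq (wp_copy fun _ => wp_seq ((wp_move (N := N) (node := node) (D := D) (L := X.m)
    ?_ ?_ ?_ ?_).mono ?_))
  all_goals simp only [set_reg, set_mem, v22, Nat.reduceEqDiff, reduceIte]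
  · exact hA'.trie
  · exact hA'.fail
  · exact hs.state
  · exact hlen
  rintro T3 w hwi hfw ⟨w10, hrun, hT3⟩
  have wm := hfw.mem rfl
  have wo := (hfw.out rfl).trans vo
  have w21 := hfw.reg 21 rfl
  have w20 := hfw.reg 20 rfl
  simp only [set_reg, set_mem, Nat.reduceEqDiff, reduceIte, v20, v21] at wm w20 w21
  have hstep : node (w.reg 10) = acRun D X.E.text (k + 1) := by
    rw [hrun, acRun, ← hs.run, v14, pdAt_eq]
    exact acStep_congr fun d hd => hN.clip_lab (hd.trans hlen)
  rw [← wm] at hA' hring harr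
  have hfin := hA'.final _ w10
  rw [hstep] at hfin hT3
  rw [hs.run] at hT3
  have hread : ∀ r : Store, r.reg 21 = k + 1 → r.reg 20 = w.reg 20 → r.reg 22 = w.reg 10 →
      r.mem = w.mem →
      Reading X D A N node (k + 1) r := fun r h1 h2 h3 h4 =>
    ⟨h1, h2.trans w20, by rw [h3]; exact w10, by rw [h3, hstep], by rw [h4]; exact hring,
        by rw [h4]; exact harr⟩
  refine wp_seq (wp_copy fun _ => wp_seq (wp_add ?_ (wp_seq (wp_ld ?_ (wp_ite_eq
    (fun h1 => wp_seq (wp_sub (wp_emit ?_))) fun h1 => wp_skip ?_)))))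
  all_goals simp only [set_reg, set_mem, set_out, hwi.r1, hwi.rM, w21, wo, Nat.reduceEqDiff,
      reduceIte] at *
  · omega
  · omega
  · refine ⟨hread _ ?_ ?_ ?_ rfl, by rw [if_pos (hfin.1 h1)], by omega⟩
    all_goals simp only [set_reg, Nat.reduceEqDiff, reduceIte]
  · refine ⟨hread _ ?_ ?_ ?_ rfl, by rw [if_neg fun h => h1 (hfin.2 h)], by omega⟩
    all_goals simp only [set_reg, Nat.reduceEqDiff, reduceIte]

/-! ### The whole program -/

/-- Assign the constants to the registers from `90` on: the two lengths, small numbers, the base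
addresses of the eleven arrays, and the number `3m` of candidates. -/
def initConsts : Cmd :=
  .prim (.patLen 90) ;; .prim (.textLen 91) ;; iConst 92 1 ;; iConst 93 0 ;; iConst 94 4 ;;
  iConst 95 8 ;; iMul 50 90 90 ;; iConst 51 20 ;; iMul 100 50 51 ;; iConst 96 0 ;; iConst 97 1 ;;
  iConst 98 2 ;; iConst 99 3 ;; iAdd 101 100 92 ;; iAdd 102 101 92 ;; iAdd 103 102 92 ;;
  iAdd 104 103 92 ;; iAdd 105 104 92 ;; iAdd 106 105 92 ;; iMul 107 99 90

/-- Build the automaton. -/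
def buildCmd : Cmd :=
  initConsts ;; patternPhase ;; triePhase ;; failPhase ;; iConst 21 0 ;; iConst 22 0

/-- The matching program. Register `20` holds the number of states; while the text is read,
registers `21`, `22` hold the number of positions read and the current state. -/
def program : MatchProgram where
  build := buildCmd
  step := textStep
  pos := 21
  len := 91
  size := 20
  state := 22

/-- The program `c` halts if it is started in `s`, in such a way that `Q` holds for the number of
steps and the final store. -/
def Halts (E : Env) (c : Cmd) (s : Store) (Q : ℕ → Store → Prop) : Prop :=
  ∃ T r, Exec E c s T r ∧ Q T r

theorem Halts.seq {E : Env} {a b : Cmd} {s : Store} {Q : ℕ → Store → Prop}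
    (h : Halts E a s (fun T r => Halts E b r (fun U u => Q (T + U) u))) :
    Halts E (.seq a b) s Q := by
  obtain ⟨T, r, h1, U, u, h2, h3⟩ := h
  exact ⟨_, u, .seq h1 h2, h3⟩

theorem Halts.set {E : Env} {i : Instr} {s : Store} {x v : ℕ} {Q : ℕ → Store → Prop}
    (hi : i.eval E s = s.setReg E x v) (hv : v < E.word) (hQ : Q 1 (s.set x v)) :
    Halts E (.prim i) s Q :=
  ⟨1, _, .prim (by rw [hi, setReg_eq_some]; exact ⟨hv, rfl⟩), hQ⟩

theorem halts_initConsts (X : Ctx) :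
    Halts X.E initConsts Store.init (fun T r => T ≤ 20 ∧ Inv X r ∧ r.mem = Store.init.mem) := by
  have hw := X.word
  have hp := X.pat_len
  have ht := X.text_len
  have hK := X.K_eq
  have hmK := X.le_K
  have key : Halts X.E initConsts Store.init (fun T r => T ≤ 20 ∧ (Bdd X.E r → Inv X r) ∧
      r.mem = Store.init.mem) := by
    unfold initConsts
    repeat' first
      | refine Halts.seq ?_
      | refine Halts.set rfl ?_ ?_
    all_goals try simp only [set_reg, Op.eval, Nat.reduceEqDiff, reduceIte, hp, ht]
    any_goals omega
    refine ⟨by omega, fun hb => ⟨hb, ?_, ?_, ?_, ?_, ?_, ?_, fun a ha => ?_, ?_⟩, rfl⟩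
    case refine_7 => interval_cases a <;> simp only [set_reg, Nat.reduceAdd, Nat.reduceEqDiff,
        Nat.reduceLT,
      Nat.reduceSub, reduceIte] <;> omega
    all_goals simp only [set_reg, Nat.reduceEqDiff, reduceIte]
  obtain ⟨T, r, h1, h2, h3, h4⟩ := key
  exact ⟨T, r, h1, h2, h3 (h1.bdd ⟨fun _ => by simp [Store.init]; omega,
      fun _ => by simp [Store.init]; omega⟩), h4⟩

theorem arr_eq_mem {K a i : ℕ} (ha : a < 4) (hi : i < K) (mem : ℕ → ℕ) :
    arr K mem a i = mem (4 * i + a) := by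
  rw [arr, if_pos ⟨by omega, hi⟩, addr, if_pos ha]

theorem HoldsArrays.holdsAutomaton {X : Ctx} {s : Store} {N : ℕ} {node : ℕ → List ℕ}
    {D : Set (List ℕ)} (h : HoldsArrays X (arr X.K s.mem) N node D) :
    HoldsAutomaton X.E D s N node := by
  have hNK := h.trie.le_K
  have hsp := X.space
  refine ⟨by omega, ⟨fun k hk => (h.trie.nodes _).2 ⟨k, hk, rfl⟩, h.trie.core.inj, fun w hw =>
    (h.trie.nodes w).1 hw⟩, h.trie.core.root, fun k h0 hk => ?_, fun k h0 hk => ?_, fun k hk => ?_⟩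
  · have h1 := h.trie.core.par_lt k h0 hk
    have h2 := h.trie.core.node_eq k h0 hk
    rw [arr_eq_mem (by norm_num) (by omega), Nat.add_zero] at h1 h2
    rw [arr_eq_mem (by norm_num) (by omega)] at h2
    exact ⟨by omega, h2⟩
  · have h1 := h.fail k h0 hk (h.trie.len k hk)
    rwa [arr_eq_mem (by norm_num) (by omega)] at h1
  · rw [← h.final k hk, arr_eq_mem (by norm_num) (by omega)]

theorem halts_buildCmd (X : Ctx) :
    Halts X.E buildCmd Store.init (fun T r => T ≤ 1000 * (X.m * X.m) ∧ Inv X r ∧ r.out = [] ∧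
      ∃ N node, HoldsArrays X (arr X.K r.mem) N node (candidates (prv (vals X.E.pat)) X.m) ∧
        Reading X (candidates (prv (vals X.E.pat)) X.m) (arr X.K r.mem) N node 0 r) := by
  have hw := X.word
  have hm2 := Nat.mul_le_mul_right X.m X.two_le
  have hm := X.two_le
  set D := candidates (prv (vals X.E.pat)) X.m
  have key : Halts X.E buildCmd Store.init (fun T r => T ≤ 1000 * (X.m * X.m) ∧ Inv X r ∧
      ∃ N node, HoldsArrays X (arr X.K r.mem) N node D ∧ Reading X D (arr X.K r.mem) N node 0 r) :=
          by
    obtain ⟨T, r, hx, hT, hr, hm0⟩ := halts_initConsts X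
    suffices h : wp X (patternPhase ;; triePhase ;; failPhase ;; iConst 21 0 ;; iConst 22 0) r
        (fun U u => U ≤ 990 * (X.m * X.m) ∧ ∃ N node, HoldsArrays X (arr X.K u.mem) N node D ∧
          Reading X D (arr X.K u.mem) N node 0 u) by
      obtain ⟨U, u, h1, h2, h3, h4⟩ := h hr
      exact ⟨_, u, .seq hx h1, by omega, h2, h4⟩
    refine wp_seq (wp_patternPhase.mono ?_)
    rintro T1 r1 - - ⟨h9, hA, hT1⟩
    refine wp_seq ((wp_triePhase (q := prv (vals X.E.pat)) (prv_le _) (fun a ha i => ?_) h9).mono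
        ?_)
    · rw [hA a ha, hm0]
      unfold arr
      split_ifs <;> rfl
    rintro T2 r2 - - ⟨hT2, ht, node, hb⟩
    refine wp_seq ((wp_failPhase hb ht).mono ?_)
    rintro T3 r3 - hf3 ⟨hT3, hA3, hfail⟩
    have r20 := hf3.reg 20 rfl
    have hb0 := hb.holdsTrie ht
    refine wp_seq (wp_const (by omega) (wp_const (by omega) ⟨?_, r2.reg 20, node, ⟨?_, hfail,
        fun k hk => ?_⟩, ?_⟩))
    · have e1 : 3 * X.m * (101 * X.m + 101) = 303 * (X.m * X.m) + 303 * X.m := by ring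
      have e2 : (3 * X.m + 1) * X.m = 3 * (X.m * X.m) + X.m := by ring
      omega
    · exact hb0.congr fun a ha => hA3 a (by omega)
    · simp only [set_mem]
      rw [hA3 3 (by omega), hb.flag]
      exact ⟨fun h => h.2, fun h => ⟨hk, h⟩⟩
    · refine ⟨?_, ?_, ?_, ?_, fun k hk => by omega, fun _ _ => rfl⟩
      all_goals simp only [set_reg, Nat.reduceEqDiff, reduceIte]
      · exact r20
      · exact hb0.core.pos
      · exact hb0.core.root
  obtain ⟨T, r, h1, h2, h3, h4⟩ := key
  exact ⟨T, r, h1, h2, h3, h1.frame.out rfl, h4⟩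

/-- Steps that preserve an invariant can be put together to a run. -/
theorem exists_run {α : Type*} {I : ℕ → α → Prop} {R : ℕ → α → α → Prop} {n : ℕ} {a₀ : α}
    (h0 : I 0 a₀) (step : ∀ k < n, ∀ a, I k a → ∃ b, R k a b ∧ I (k + 1) b) :
    ∃ f : ℕ → α, f 0 = a₀ ∧ (∀ k ≤ n, I k (f k)) ∧ ∀ k < n, R k (f k) (f (k + 1)) := by
  classical
  let f : ℕ → α := fun k => Nat.rec a₀
    (fun k a => if h : k < n ∧ I k a then (step k h.1 a h.2).choose else a) k
  have hs : ∀ k (h : k < n ∧ I k (f k)), f (k + 1) = (step k h.1 _ h.2).choose :=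
    fun k h => dif_pos h
  have hI : ∀ k ≤ n, I k (f k) := by
    intro k
    induction k with
    | zero => exact fun _ => h0
    | succ k ih =>
      intro hk
      have h : k < n ∧ I k (f k) := ⟨hk, ih (by omega)⟩
      rw [hs k h]
      exact (step k h.1 _ h.2).choose_spec.2
  refine ⟨f, rfl, hI, fun k hk => ?_⟩
  have h : k < n ∧ I k (f k) := ⟨hk, hI k hk.le⟩
  rw [hs k h]
  exact (step k h.1 _ h.2).choose_spec.1

/-- A loop whose iterations number `k = 0, …, n - 1` each take at most the time by which the
potential decreases, plus `c`. -/
theorem exec_loop {E : Env} {t : Test} {a : Cmd} {f : ℕ → Store} {Φ : ℕ → ℕ} {n c : ℕ}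
    (hend : t.eval E (f n) = some false) (htest : ∀ k < n, t.eval E (f k) = some true)
    (hstep : ∀ k < n, ∃ T, Exec E a (f k) T (f (k + 1)) ∧ T + Φ (k + 1) ≤ Φ k + c) :
    ∃ T, Exec E (.loop t a) (f 0) T (f n) ∧ T ≤ Φ 0 + (c + 1) * n + 1 := by
  have key : ∀ b k, b + k = n →
      ∃ T, Exec E (.loop t a) (f k) T (f n) ∧ T ≤ Φ k + (c + 1) * b + 1 := by
    intro b
    induction b with
    | zero =>
      rintro k hk
      obtain rfl : k = n := by omega
      exact ⟨1, .loopFalse hend, by omega⟩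
    | succ b ih =>
      intro k hk
      obtain ⟨T, h1, h2⟩ := hstep k (by omega)
      obtain ⟨U, h3, h4⟩ := ih (k + 1) (by omega)
      refine ⟨_, .loopTrue (htest k (by omega)) h1 h3, ?_⟩
      rw [Nat.mul_succ]
      omega
  exact key n 0 (by omega)

open Classical in
/-- The output after `k` text positions, if the windows that end at the positions in `S` are
reported. -/
theorem output_spec {S : ℕ → Prop} {m n : ℕ} {out : ℕ → List ℕ} (hS : ∀ k ≤ n, S k → m ≤ k)
    (h0 : ¬ S 0) (hout0 : out 0 = [])
    (hout : ∀ k < n, out (k + 1) = if S (k + 1) then out k ++ [k + 1 - m] else out k) :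
    ∀ k ≤ n, (out k).Nodup ∧ ∀ j, j ∈ out k ↔ j + m ≤ k ∧ S (j + m) := by
  intro k
  induction k with
  | zero =>
    intro _
    rw [hout0]
    refine ⟨List.nodup_nil, fun j => ⟨fun h => absurd h List.not_mem_nil, fun h => ?_⟩⟩
    rw [show j + m = 0 by omega] at h
    exact absurd h.2 h0
  | succ k ih =>
    intro hk
    obtain ⟨h1, h2⟩ := ih (by omega)
    rw [hout k hk]
    split_ifs with hc
    · have hm := hS _ hk hc
      refine ⟨?_, fun j => ?_⟩
      · refine List.nodup_append.2 ⟨h1, List.nodup_singleton _, fun a ha b hb => ?_⟩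
        rw [h2] at ha
        rw [List.mem_singleton] at hb
        omega
      · rw [List.mem_append, h2, List.mem_singleton]
        constructor
        · rintro (h | rfl)
          · exact ⟨by omega, h.2⟩
          · rw [Nat.sub_add_cancel hm]
            exact ⟨le_rfl, hc⟩
        · rintro ⟨h3, h4⟩
          by_cases h5 : j + m ≤ k
          · exact Or.inl ⟨h5, h4⟩
          · exact Or.inr (by omega)
    · refine ⟨h1, fun j => (h2 j).trans ⟨fun h => ⟨by omega, h.2⟩, fun h => ⟨?_, h.2⟩⟩⟩
      by_contra h5
      rw [show j + m = k + 1 by omega] at h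
      exact hc h.2

/-- The program solves the matching problem, in linear time in `m² + n`. -/
theorem program_spec (X : Ctx) {p t : List ℤ} (hEp : X.E.pat = p) (hEt : X.E.text = t)
    (hp : p.Nodup) (ht : t.Nodup) :
    ∃ (tr : ℕ → Store) (T : ℕ), program.RunsAutomaton X.E (neighbourTables p) tr ∧
      Exec X.E program.cmd Store.init T (tr t.length) ∧
      T ≤ 1000 * (p.length * p.length) + 201 * t.length + 1 ∧ (tr t.length).out.Nodup ∧
      ∀ j, j ∈ (tr t.length).out ↔ j + p.length ≤ t.length ∧ SwapMatch (factor t j p.length) p := by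
  classical
  have hm2 := X.two_le
  have hm : X.m = p.length := by rw [← X.pat_len, hEp]
  have hn : X.n = t.length := by rw [← X.text_len, hEt]
  have hD : neighbourTables p = candidates (prv (vals p)) p.length :=
    neighbourTables_eq hp (by omega)
  obtain ⟨T₀, r₀, hx₀, hT₀, hi₀, ho₀, N, node, hA, hR₀⟩ := halts_buildCmd X
  rw [hEp, hm, ← hD] at hA hR₀
  set D := neighbourTables p
  -- the potential that pays for the failure links and the search for parents
  set Φ : ℕ → ℕ := fun k => 40 * ((acRun D t k).length + chainLength (vals t) k) with hΦ
  obtain ⟨tr, htr0, hI, hstep⟩ := exists_run (n := t.length) (a₀ := r₀)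
    (I := fun k s => Inv X s ∧ Reading X D (arr X.K r₀.mem) N node k s)
    (R := fun k s r => (∃ T, Exec X.E textStep s T r ∧ T + Φ (k + 1) ≤ Φ k + 200) ∧
      r.out = if acRun D t (k + 1) ∈ D then s.out ++ [k + 1 - p.length] else s.out)
    ⟨hi₀, hR₀⟩ (fun k hk s hs => by
      obtain ⟨T, r, h1, h2, h3, h4, h5⟩ := wp_textStep hA hs.2 (by omega) hs.1
      rw [hEt] at h4 h5
      rw [hm] at h4
      exact ⟨r, ⟨⟨T, h1, h5⟩, h4⟩, h2, h3⟩)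
  rw [← htr0] at hx₀ ho₀ hA
  have hlen : ∀ k, Inv X (tr k) → (tr k).reg 91 = t.length := fun k h => h.rN.trans hn
  have h0 : [] ∈ trieNodes D := hA.trie.nil_mem
  have hDlen : ∀ d ∈ D, d.length = p.length := by
    rw [hD]
    rintro _ ⟨s, -, rfl⟩
    exact length_word _ _ _
  have hmem := fun k (hk : k ≤ t.length) => acRun_mem_iff hDlen h0 t hk
  obtain ⟨T₁, hx₁, hT₁⟩ := exec_loop (E := X.E) (t := .lt 21 91) (a := textStep) (f := tr)
    (Φ := Φ) (n := t.length) (c := 200)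
    (by
      obtain ⟨h1, h2⟩ := hI _ le_rfl
      simp [Test.eval, h2.pos, hlen _ h1])
    (fun k hk => by
      obtain ⟨h1, h2⟩ := hI k hk.le
      simp [Test.eval, h2.pos, hlen _ h1, hk])
    (fun k hk => (hstep k hk).1)
  have hout := output_spec (S := fun k => acRun D t k ∈ D) (m := p.length)
    (n := t.length) (out := fun k => (tr k).out) (fun k hk h => ((hmem k hk).1 h).1)
    (fun h => by
      have := hDlen _ h
      simp [acRun] at this
      omega)
    ho₀ (fun k hk => (hstep k hk).2) t.length le_rfl
  refine ⟨tr, T₀ + T₁, ⟨⟨T₀, hx₀⟩, fun k hk => ?_, ⟨N, node, hA.holdsAutomaton, ?_, fun k hk => ?_⟩,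
    ho₀, fun k hk => ?_⟩, .seq hx₀ hx₁, ?_, hout.1, fun j => ?_⟩
  · rw [hEt] at hk
    obtain ⟨T, h1, -⟩ := (hstep k hk).1
    exact ⟨T, h1⟩
  · exact (hI 0 (Nat.zero_le _)).2.size
  · rw [hEt] at hk ⊢
    obtain ⟨h1, h2⟩ := hI k hk
    exact ⟨h2.pos, hlen k h1, h2.state, h2.run.trans (by rw [hEt])⟩
  · rw [hEt] at hk ⊢
    rw [hEp]
    exact (hstep k hk).2
  · have h1 : Φ 0 = 0 := by simp [hΦ, acRun, chainLength]
    rw [hm] at hT₀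
    omega
  · rw [hout.2]
    refine and_congr_right fun hj => ?_
    rw [hmem _ hj, Nat.add_sub_cancel, swapMatch_iff hp]
    · exact ⟨fun h => h.2, fun h => ⟨by omega, h⟩⟩
    · exact ht.sublist ((List.take_sublist _ _).trans (List.drop_sublist _ _))

theorem word_bound {m n C : ℕ} (hm : 2 ≤ m) (hC : 10 ≤ C) :
    12 * (5 * (m * m)) + n + 100 ≤ (m + n) ^ C := by
  refine le_trans ?_ (Nat.pow_le_pow_right (by omega) hC)
  have h1 : (m + n) ^ 2 * 2 ^ 8 ≤ (m + n) ^ 2 * (m + n) ^ 8 :=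
    Nat.mul_le_mul_left _ (Nat.pow_le_pow_left (by omega) 8)
  rw [← pow_add] at h1
  refine le_trans ?_ h1
  nlinarith

/-- Since `log m ≥ log 2 > 1 / 2`, the logarithmic factor may be added. -/
theorem time_bound {m n T C : ℕ} (hm : 2 ≤ m) (hC : 4000 ≤ C)
    (hT : T ≤ 1000 * (m * m) + 201 * n + 1) :
    (T : ℝ) ≤ C * (((m : ℝ) ^ 2 + n) * Real.log m) := by
  have hm' : (2 : ℝ) ≤ m := by exact_mod_cast hm
  have hC' : (4000 : ℝ) ≤ C := by exact_mod_cast hC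
  have hlog : 1 / 2 ≤ Real.log m :=
    (by have := Real.log_two_gt_d9; linarith : (1 : ℝ) / 2 ≤ Real.log 2).trans
      (Real.log_le_log (by norm_num) hm')
  have hn : (0 : ℝ) ≤ n := n.cast_nonneg
  have h1 : ((m : ℝ) ^ 2 + n) * (1 / 2) ≤ ((m : ℝ) ^ 2 + n) * Real.log m :=
    mul_le_mul_of_nonneg_left hlog (by positivity)
  have h2 : (T : ℝ) ≤ 1000 * (m * m) + 201 * n + 1 := by exact_mod_cast hT
  calc (T : ℝ) ≤ 4000 * (((m : ℝ) ^ 2 + n) * (1 / 2)) := by nlinarith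
    _ ≤ C * (((m : ℝ) ^ 2 + n) * Real.log m) := by gcongr

end SwapCT

theorem mainTheorem11 :
    ∃ (P : SwapCT.MatchProgram) (C : ℕ), ∀ (p t : List ℤ), p.Nodup → t.Nodup → 2 ≤ p.length →
      ∀ E : SwapCT.Env,
        -- `O(m²)` memory cells, each a word of `O(log (m + n))` bits
        E = { pat := p, text := t, space := C * p.length ^ 2,
              word := (p.length + t.length) ^ C } →
        ∃ (tr : ℕ → SwapCT.Store) (T : ℕ),
          -- the program builds and runs the automaton of the swap neighbourhood of the pattern
          P.RunsAutomaton E (SwapCT.neighbourTables p) tr ∧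
          -- it halts in time `O((m² + n) log m)`
          SwapCT.Exec E P.cmd SwapCT.Store.init T (tr t.length) ∧
          (T : ℝ) ≤ C * (((p.length : ℝ) ^ 2 + t.length) * Real.log p.length) ∧
          -- and its output lists each match exactly once
          (tr t.length).out.Nodup ∧
          ∀ j : ℕ, j ∈ (tr t.length).out ↔
            j + p.length ≤ t.length ∧ SwapCT.SwapMatch (SwapCT.factor t j p.length) p := by
  -- only a lower bound on the constant matters, which should not be evaluated as an exponent
  obtain ⟨C, hC⟩ : ∃ C : ℕ, 4000 ≤ C := ⟨_, le_rfl⟩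
  refine ⟨SwapCT.program, C, fun p t hp ht hm E hE => ?_⟩
  obtain ⟨tr, T, h1, h2, h3, h4⟩ := SwapCT.program_spec
    ⟨E, 5 * (p.length * p.length), p.length, t.length, hm, rfl, by rw [hE], by rw [hE],
      by rw [hE]; simp only [sq]; nlinarith, by rw [hE]; exact SwapCT.word_bound hm (by omega)⟩
    (show E.pat = p by rw [hE]) (show E.text = t by rw [hE]) hp ht
  exact ⟨tr, T, h1, h2, SwapCT.time_bound hm hC h3, h4⟩
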